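/- **Theorem 9.1.** *$\mathcal R$-graphs and their semigroups.* Let $\mathfrak P,\mathcal E^-,\mathcal E^+$ be finite sets, and let every edge in $\mathcal E^-\cup\mathcal E^+$ have a source $s$ and a target $t$ in $\mathfrak P$. Put $\mathcal E^-(\mathfrak q,\mathfrak r)=\{e\in\mathcal E^-: s(e)=\mathfrak q,\ t(e)=\mathfrak r\}$ and $\mathcal E^+(\mathfrak q,\mathfrak r)=\{e\in\mathcal E^+: s(e)=\mathfrak r,\ t(e)=\mathfrak q\}$. Assume that $\mathcal E^-(\mathfrak q,\mathfrak r)\neq\emptyset$ if and only if $\mathcal E^+(\mathfrak q,\mathfrak r)\ne\emptyset$, that $(\mathfrak P,\mathcal E^-)$ is strongly connected, and let $\mathcal R=\bigcup_{\mathfrak q,\mathfrak r}\mathcal R(\mathfrak q,\mathfrak r)$ with $\mathcal R(\mathfrak q,\mathfrak r)\subset\mathcal E^-(\mathfrak q,\mathfrak r)\times\mathcal E^+(\mathfrak q,\mathfrak r)$. Let $\mathcal S=\mathcal S_{\mathcal R}(\mathfrak P,\mathcal E^-,\mathcal E^+)$ be the semigroup with zero that is generated by $\mathcal E^-\cup\mathcal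 E^+$ and elements $\mathbf 1_{\mathfrak p}$, $\mathfrak p\in\mathfrak P$, with the defining relations $\mathbf 1_{\mathfrak p}^2=\mathbf 1_{\mathfrak p}$; $\mathbf 1_{\mathfrak q}\mathbf 1_{\mathfrak r}=0$ for $\mathfrak q\ne\mathfrak r$; $\mathbf 1_{s(e)}e=e\mathbf 1_{t(e)}=e$ for all edges $e$; and, for $f^-\in\mathcal E^-$, $g^+\in\mathcal E^+$, $f^-g^+=\mathbf 1_{s(f^-)}$ if $(f^-,g^+)\in\mathcal R$ and $f^-g^+=0$ otherwise. Let $\mathcal S^\pm$ be the set of non-zero elements of the subsemigroup generated by $\mathcal E^\pm$, and let $\mathbf 1=\{\mathbf 1_{\mathfrak p}:\mathfrak p\in\mathfrak P\}$. *Presentations.* Let $(\mathcal V,\Sigma,\lambda)$ be a finite strongly connected directed graph with vertex set $\mathcal V$, edge set $\Sigma$ and a labeling $\lambda:\Sigma\to\mathcal S^-\cup\mathbf 1\cup\mathcal S^+$, extended to non-empty words by $\lambda(\sigma_1\cdots\sigma_I)=\lambda(\sigma_1)\cdots\lambda(\sigma_I)$. Let $\mathcal V(\mathfrak p)$ be the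 set of $V\in\mathcal V$ such that there is a non-empty cycle from $V$ to $V$ with label $\mathbf 1_{\mathfrak p}$. Assume that the sets $\mathcal V(\mathfrak p)$, $\mathfrak p\in\mathfrak P$, are non-empty and form a partition of $\mathcal V$; that for $V\in\mathcal V(\mathfrak p)$ one has $\mathbf 1_{\mathfrak p}\lambda(\sigma)\neq0$ for all edges $\sigma$ leaving $V$ and $\lambda(\sigma)\mathbf 1_{\mathfrak p}\ne0$ for all edges $\sigma$ entering $V$; and that for $f\in\mathcal S$ with $\mathbf 1_{\mathfrak q}f\mathbf 1_{\mathfrak r}\neq0$ and $U\in\mathcal V(\mathfrak q)$, $W\in\mathcal V(\mathfrak r)$ there is a non-empty path from $U$ to $W$ with label $f$. A word is admissible if it is a non-empty path with non-zero label. Let $X=X(\mathcal V,\Sigma,\lambda)\subset\Sigma^{\mathbb Z}$ be the subshift of all points all of whose non-empty finite subwords are admissible; $X$ is called an $\mathcal S_{\mathcal R}(\mathfrak P,\mathcal E^-,\mathcal E^+)$-presentation. *Markov chains.* Let $\Sigma^-=\{\sigma:\lambda(\sigma)\in\mathcal S^-\cup\mathbf 1\}$ and $\Sigma^+=\{\sigma:\lambda(\sigma)\in\mathbf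 1\cup\mathcal S^+\}$, let $A^\pm$ be the $0$-$1$ matrix indexed by $\Sigma^\pm$ with $A^\pm(\rho,\tau)=1$ if and only if $t(\rho)=s(\tau)$, and let $\mathcal L(\Sigma^\pm,A^\pm)$ be the set of non-empty finite paths with all edges in $\Sigma^\pm$. *Markov codes.* A Markov code is a set $\mathcal C$ of non-empty words over a finite alphabet together with maps $s,t$ from $\mathcal C$ to a finite set $\mathcal V$. A parsing of a bi-infinite sequence $x$ is a strictly increasing sequence $(I_k)_{k\in\mathbb Z}$ of integers with $I_0\le 0<I_1$, such that $x_{[I_k,I_{k+1})}\in\mathcal C$ and $t(x_{[I_{k-1},I_k)})=s(x_{[I_k,I_{k+1})})$ for all $k$. The Markov code is circular if every periodic sequence has at most one parsing. Let $H^{\mathcal C}(z)$ be the $\mathcal V\times\mathcal V$-matrix with entries $\sum_{n}\operatorname{card}\{c\in\mathcal C:s(c)=u,\ t(c)=v,\ \ell(c)=n\}\,z^n$, where $\ell(c)$ is the length of $c$. Let - $\mathcal C^0$ be the set of admissible words with label in $\mathbf 1$ that have no proper non-empty prefix with label in $\mathbf 1$; - $\mathcal C^-_\circ$ be the set of admissible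 words of length $>1$ with label in $\mathcal S^-\cup\mathbf 1$, all of whose proper non-empty suffixes have their label in $\mathcal S^+$; - $\mathcal C^+_\circ$ be the set of admissible words of length $>1$ with label in $\mathbf 1\cup\mathcal S^+$, all of whose proper non-empty prefixes have their label in $\mathcal S^-$; - $\mathcal C^\pm$ be the set of the words in $\mathcal C^\pm_\circ$ and of the paths that are a concatenation of a word in $\mathcal C_\circ^\pm$ and a word in $\mathcal L(\Sigma^\pm,A^\pm)$, each with the maps $s,t$ that give the source and the target of a path. *Claim.* The Markov codes $\mathcal C^0,\mathcal C^-,\mathcal C^+$ are circular, and, with $\Pi_n(X)$ denoting the number of points of period $n$ of $X$, the zeta function $\zeta_X(z)=\exp\big(\sum_{n\ge1}\Pi_n(X)z^n/n\big)$ is given, as a formal power series, by $$\zeta_X(z)=\frac{\det(\mathbf 1-H^{\mathcal C^0}(z))}{\det(\mathbf 1-A^-z)\,\det(\mathbf 1-H^{\mathcal C^-}(z))\,\det(\mathbf 1-H^{\mathcal C^+}(z))\,\det(\mathbf 1-A^+z)},$$ where the denominator is an invertible power series. -/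

import Mathlib

/-! ## Symbolic dynamics: periodic points, zeta functions, Markov codes -/

section SymbolicDynamics

/-- The word `x_{[i, j)} = x_i x_{i+1} ⋯ x_{j-1}`. -/
def zword {A : Type*} (x : ℤ → A) (i j : ℤ) : List A :=
  (List.range (j - i).toNat).map fun k => x (i + k)

/-- The number `Π_n(X)` of points of period `n` of `X`, that is, the number of `x ∈ X` that
are fixed by the `n`-th power of the shift. -/
noncomputable def periodCount {A : Type*} (X : Set (ℤ → A)) (n : ℕ) : ℕ :=
  {x : ℤ → A | x ∈ X ∧ ∀ i : ℤ, x (i + n) = x i}.ncard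

/-- The zeta function `ζ_X(z) = exp (∑_{n ≥ 1} Π_n(X) z^n / n)` as a formal power series.
(The coefficient at `n = 0` of the exponent is `Π_0(X) / 0 = 0`.) -/
noncomputable def zetaSeries {A : Type*} (X : Set (ℤ → A)) : PowerSeries ℚ :=
  PowerSeries.subst (PowerSeries.mk fun n : ℕ => (periodCount X n : ℚ) / (n : ℚ))
    (PowerSeries.exp ℚ)

/-- A Markov code over the alphabet `A` with vertex set `V`: a set of non-empty words, together
with a source and a target map from the set of code words to `V`. -/
structure MarkovCode (A V : Type*) where
  words : Set (List A)
  ne_nil : ∀ c ∈ words, c ≠ []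
  src : words → V
  tgt : words → V

namespace MarkovCode

variable {A V : Type*} (C : MarkovCode A V)

/-- The indices `I_k`, `k ∈ ℤ`, cut `x` into code words such that the target of every code word
is the source of the next one; the normalization is `I_0 ≤ 0 < I_1`. -/
def IsParsing (x : ℤ → A) (I : ℤ → ℤ) : Prop :=
  I 0 ≤ 0 ∧ 0 < I 1 ∧ (∀ k, I k < I (k + 1)) ∧
    ∃ h : ∀ k, zword x (I k) (I (k + 1)) ∈ C.words,
      ∀ k, C.tgt ⟨_, h k⟩ = C.src ⟨_, h (k + 1)⟩

/-- The shift invariant set `X_{(C, t, s)}`. -/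
def shiftSet : Set (ℤ → A) := {x | ∃ I, C.IsParsing x I}

/-- Circularity: every periodic point of `X_{(C, t, s)}` has only one parsing. -/
def IsCircular : Prop :=
  ∀ x ∈ C.shiftSet, (∃ n : ℕ, 0 < n ∧ ∀ i : ℤ, x (i + n) = x i) →
    ∀ I J, C.IsParsing x I → C.IsParsing x J → I = J

/-- The generating function
`g_{C(u, v)}(z) = ∑_n card {c ∈ C : s(c) = u, t(c) = v, ℓ(c) = n} z^n`. -/
noncomputable def genFun (u v : V) : PowerSeries ℚ :=
  PowerSeries.mk fun n : ℕ =>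
    (({c : C.words | C.src c = u ∧ C.tgt c = v ∧ c.1.length = n}.ncard : ℕ) : ℚ)

/-- The matrix `H^C(z)`. -/
noncomputable def H : Matrix V V (PowerSeries ℚ) := Matrix.of C.genFun

end MarkovCode

/-- `det (1 - A z)` as a power series in `z`. -/
noncomputable def detOneSub {ι : Type*} [Fintype ι] [DecidableEq ι] (A : Matrix ι ι ℚ) :
    PowerSeries ℚ :=
  (1 - (PowerSeries.X : PowerSeries ℚ) • A.map (PowerSeries.C (R := ℚ))).det

end SymbolicDynamics

/-! ## `R`-graphs and their semigroups -/

/-- An `R`-graph with vertex set `P` and edge set `Em ⊔ Ep` (`E⁻` and `E⁺`).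
`Em(q, r)` consists of the edges from `q` to `r`, and `Ep(q, r)` of the edges from `r` to `q`. -/
structure RGraph (P Em Ep : Type*) where
  /-- source and target of the edges in `E⁻` -/
  sm : Em → P
  tm : Em → P
  /-- source and target of the edges in `E⁺` -/
  sp : Ep → P
  tp : Ep → P
  /-- the union of the relations `R(q, r) ⊆ E⁻(q, r) × E⁺(q, r)` -/
  R : Em → Ep → Prop
  R_subset : ∀ e f, R e f → sp f = tm e ∧ tp f = sm e
  nonempty_iff : ∀ q r, (∃ e, sm e = q ∧ tm e = r) ↔ (∃ f, sp f = r ∧ tp f = q)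
  /-- `(P, E⁻)` is strongly connected -/
  strong : ∀ q r, Relation.ReflTransGen (fun a b => ∃ e, sm e = a ∧ tm e = b) q r

namespace RGraph

variable {P Em Ep : Type*}

/-- Generators of the `R`-graph semigroup (a semigroup with zero). -/
inductive Gen (P Em Ep : Type*)
  | zero : Gen P Em Ep
  | one : P → Gen P Em Ep
  | neg : Em → Gen P Em Ep
  | pos : Ep → Gen P Em Ep

open FreeSemigroup in
/-- The defining relations of the `R`-graph semigroup. -/
inductive Rel (G : RGraph P Em Ep) :
    FreeSemigroup (Gen P Em Ep) → FreeSemigroup (Gen P Em Ep) → Prop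
  | zero_mul (w) : Rel G (of .zero * w) (of .zero)
  | mul_zero (w) : Rel G (w * of .zero) (of .zero)
  | one_mul_self (p) : Rel G (of (.one p) * of (.one p)) (of (.one p))
  | one_mul_one (q r) (h : q ≠ r) : Rel G (of (.one q) * of (.one r)) (of .zero)
  | one_mul_neg (e) : Rel G (of (.one (G.sm e)) * of (.neg e)) (of (.neg e))
  | neg_mul_one (e) : Rel G (of (.neg e) * of (.one (G.tm e))) (of (.neg e))
  | one_mul_pos (f) : Rel G (of (.one (G.sp f)) * of (.pos f)) (of (.pos f))
  | pos_mul_one (f) : Rel G (of (.pos f) * of (.one (G.tp f))) (of (.pos f))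
  | neg_mul_pos (e f) (h : G.R e f) :
      Rel G (of (.neg e) * of (.pos f)) (of (.one (G.sm e)))
  | neg_mul_pos_zero (e f) (h : ¬ G.R e f) :
      Rel G (of (.neg e) * of (.pos f)) (of .zero)

/-- The `R`-graph semigroup, given by generators and relations. -/
def S (G : RGraph P Em Ep) : Type _ := (conGen G.Rel).Quotient

variable (G : RGraph P Em Ep)

instance : Semigroup G.S := inferInstanceAs (Semigroup (conGen G.Rel).Quotient)

/-- The class of a generator. -/
def gen (a : Gen P Em Ep) : G.S :=
  ((FreeSemigroup.of a : FreeSemigroup (Gen P Em Ep)) : (conGen G.Rel).Quotient)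

instance : Zero G.S := ⟨G.gen .zero⟩

/-- The idempotents `1_p`. -/
def one (p : P) : G.S := G.gen (.one p)

/-- The set `{1_p : p ∈ P}`. -/
def ones : Set G.S := Set.range G.one

/-- The set `S⁻` of non-zero elements of the subsemigroup generated by `E⁻`. -/
def Sneg : Set G.S :=
  {f | f ≠ 0 ∧ f ∈ Subsemigroup.closure (Set.range fun e : Em => G.gen (.neg e))}

/-- The set `S⁺` of non-zero elements of the subsemigroup generated by `E⁺`. -/
def Spos : Set G.S :=
  {f | f ≠ 0 ∧ f ∈ Subsemigroup.closure (Set.range fun e : Ep => G.gen (.pos e))}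

end RGraph

/-! ## Presentations -/

/-- A directed graph with vertex set `V` and edge set `E`, whose edges are labelled by elements
of the `R`-graph semigroup of `G`. -/
structure LabelledGraph {P Em Ep : Type*} (G : RGraph P Em Ep) (V E : Type*) where
  src : E → V
  tgt : E → V
  lab : E → G.S

namespace LabelledGraph

variable {P Em Ep V E : Type*} {G : RGraph P Em Ep} (L : LabelledGraph G V E)

/-- `w` is a (possibly empty) path from `U` to `W`. -/
def IsPath : V → List E → V → Prop
  | U, [], W => U = W
  | U, a :: w, W => L.src a = U ∧ IsPath (L.tgt a) w W

/-- The label `λ(w)` of a word. It is the product in the semigroup of the labels of the edges,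
considered in the monoid that arises from the semigroup by adjoining a new unit, which is the
label of the empty word only. -/
def label (w : List E) : WithOne G.S := (w.map fun a => ((L.lab a : G.S) : WithOne G.S)).prod

/-- `w` is non-empty and its label is in the subset `T` of the semigroup. -/
def LabelIn (w : List E) (T : Set G.S) : Prop := ∃ f ∈ T, L.label w = (f : WithOne G.S)

/-- The vertices `V(p)`: those with a (non-empty) cycle with label `1_p`. -/
def vertexSet (p : P) : Set V :=
  {U | ∃ w, w ≠ [] ∧ L.IsPath U w U ∧ L.label w = (G.one p : WithOne G.S)}

/-- The requirements on a labelled graph under which it gives rise to a presentation. -/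
structure IsPresentation : Prop where
  strong : ∀ U W, ∃ w, L.IsPath U w W
  g1 : ∀ a, L.lab a ∈ G.Sneg ∪ G.ones ∪ G.Spos
  g2 : ∀ p, (L.vertexSet p).Nonempty
  g3 : ∀ U, ∃! p, U ∈ L.vertexSet p
  g4_leave : ∀ p, ∀ a, L.src a ∈ L.vertexSet p → G.one p * L.lab a ≠ 0
  g4_enter : ∀ p, ∀ a, L.tgt a ∈ L.vertexSet p → L.lab a * G.one p ≠ 0
  g5 : ∀ (f : G.S) (q r : P), G.one q * f * G.one r ≠ 0 →
    ∀ U ∈ L.vertexSet q, ∀ W ∈ L.vertexSet r,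
      ∃ w, w ≠ [] ∧ L.IsPath U w W ∧ L.label w = (f : WithOne G.S)

/-- The admissible words: non-empty paths with non-zero label. -/
def Admissible (w : List E) : Prop :=
  w ≠ [] ∧ (∃ U W, L.IsPath U w W) ∧ L.label w ≠ ((0 : G.S) : WithOne G.S)

/-- The subshift `X(V, Σ, λ)`. -/
def shift : Set (ℤ → E) := {x | ∀ i j : ℤ, i < j → L.Admissible (zword x i j)}

/-- The state space `Σ⁻`. -/
def NegState : Type _ := {a : E // L.lab a ∈ G.Sneg ∪ G.ones}

/-- The state space `Σ⁺`. -/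
def PosState : Type _ := {a : E // L.lab a ∈ G.ones ∪ G.Spos}

noncomputable instance [Finite E] : Fintype L.NegState :=
  @Fintype.ofFinite _ (inferInstanceAs (Finite {a : E // L.lab a ∈ G.Sneg ∪ G.ones}))

noncomputable instance [Finite E] : Fintype L.PosState :=
  @Fintype.ofFinite _ (inferInstanceAs (Finite {a : E // L.lab a ∈ G.ones ∪ G.Spos}))

noncomputable instance : DecidableEq L.NegState := Classical.decEq _

noncomputable instance : DecidableEq L.PosState := Classical.decEq _

/-- The 0-1 transition matrix `A⁻`. -/
def Aneg [DecidableEq V] : Matrix L.NegState L.NegState ℚ :=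
  Matrix.of fun a b => if L.tgt a.1 = L.src b.1 then 1 else 0

/-- The 0-1 transition matrix `A⁺`. -/
def Apos [DecidableEq V] : Matrix L.PosState L.PosState ℚ :=
  Matrix.of fun a b => if L.tgt a.1 = L.src b.1 then 1 else 0

/-- The words of `L(Σ⁻, A⁻)`: non-empty finite words over `Σ⁻` all of whose transitions are
allowed by `A⁻`, that is, non-empty paths with edges in `Σ⁻`. -/
def negWords : Set (List E) :=
  {w | w ≠ [] ∧ (∃ U W, L.IsPath U w W) ∧ ∀ a ∈ w, L.lab a ∈ G.Sneg ∪ G.ones}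

/-- The words of `L(Σ⁺, A⁺)`. -/
def posWords : Set (List E) :=
  {w | w ≠ [] ∧ (∃ U W, L.IsPath U w W) ∧ ∀ a ∈ w, L.lab a ∈ G.ones ∪ G.Spos}

/-- `C⁰`: admissible words with label in `{1_p}`, no proper non-empty prefix of which has its
label in `{1_p}`. -/
def words0 : Set (List E) :=
  {w | L.Admissible w ∧ L.LabelIn w G.ones ∧
    ∀ J, 1 ≤ J → J < w.length → ¬ L.LabelIn (w.take J) G.ones}

/-- `C⁻_∘`: admissible words of length `> 1` with label in `S⁻ ∪ {1_p}`, all of whose proper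
non-empty suffixes have their label in `S⁺`. -/
def coreNeg : Set (List E) :=
  {w | L.Admissible w ∧ 1 < w.length ∧ L.LabelIn w (G.Sneg ∪ G.ones) ∧
    ∀ J, 1 ≤ J → J < w.length → L.LabelIn (w.drop J) G.Spos}

/-- `C⁺_∘`: admissible words of length `> 1` with label in `{1_p} ∪ S⁺`, all of whose proper
non-empty prefixes have their label in `S⁻`. -/
def corePos : Set (List E) :=
  {w | L.Admissible w ∧ 1 < w.length ∧ L.LabelIn w (G.ones ∪ G.Spos) ∧
    ∀ J, 1 ≤ J → J < w.length → L.LabelIn (w.take J) G.Sneg}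

/-- `C⁻`: the words in `C⁻_∘`, and the paths that are a concatenation of a word in `C⁻_∘` and a
word in `L(Σ⁻, A⁻)`. -/
def wordsNeg : Set (List E) :=
  L.coreNeg ∪
    {w | (∃ U W, L.IsPath U w W) ∧ ∃ c ∈ L.coreNeg, ∃ d ∈ L.negWords, w = c ++ d}

/-- `C⁺`: the words in `C⁺_∘`, and the paths that are a concatenation of a word in `C⁺_∘` and a
word in `L(Σ⁺, A⁺)`. -/
def wordsPos : Set (List E) :=
  L.corePos ∪
    {w | (∃ U W, L.IsPath U w W) ∧ ∃ c ∈ L.corePos, ∃ d ∈ L.posWords, w = c ++ d}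

/-- A set of non-empty paths, with the source and target of paths, is a Markov code. -/
def codeOf (T : Set (List E)) (hT : ∀ c ∈ T, c ≠ []) : MarkovCode E V where
  words := T
  ne_nil := hT
  src c := L.src (c.1.head (hT c.1 c.2))
  tgt c := L.tgt (c.1.getLast (hT c.1 c.2))

/-- The Markov code `C⁰(V, Σ, λ)`. -/
def code0 : MarkovCode E V := L.codeOf L.words0 fun _ hc => hc.1.1

/-- The Markov code `C⁻(V, Σ, λ)`. -/
def codeNeg : MarkovCode E V := L.codeOf L.wordsNeg (by
  rintro c (hc | ⟨-, c', hc', d, -, rfl⟩)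
  · exact hc.1.1
  · exact List.append_ne_nil_of_left_ne_nil hc'.1.1 d)

/-- The Markov code `C⁺(V, Σ, λ)`. -/
def codePos : MarkovCode E V := L.codeOf L.wordsPos (by
  rintro c (hc | ⟨-, c', hc', d, -, rfl⟩)
  · exact hc.1.1
  · exact List.append_ne_nil_of_left_ne_nil hc'.1.1 d)

end LabelledGraph

/-!
The points of period `n` of the shift are counted by means of heights. Give an edge of the
presentation the height of its label, that is, the number of its factors in `E⁻` minus the number
of its factors in `E⁺`. The label of a non-zero word is then in `S⁻ ∪ 1` if and only if all
prefixes of the word have non-negative height, in `1 ∪ S⁺` if and only if all suffixes have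
non-positive height, and in `1` if moreover the height of the word is zero (`labelIn_ones_iff`,
`labelIn_Sneg_iff`, `labelIn_Spos_iff`). This rests on two facts about the semigroup: depth and
height are invariants of its non-zero elements, since they are constant along all defining relations
between words that do not represent zero (`RGraph.shapeCon`), and every non-zero element has a
normal form (`RGraph.classification`). An action on stacks (`RGraph.act`) shows that
matching elements of `S⁻ ∪ 1`, or of `1 ∪ S⁺`, have a non-zero product.

The height function of a periodic point tends to `±∞`, or is bounded. If it does not decrease along
a period, then the point has a unique decomposition into "steps", the blocks between consecutive
right minima of the height (`HeightSystem.steps`). Since the words that never fall below their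
initial height are freely generated by the steps, their generating matrix is `(1 - H)⁻¹`, where `H`
is the generating matrix of the steps (`HeightSystem.one_sub_walkMatrix_steps_mul`). A periodic
point corresponds to the step around `0`, the position of `0` in that step, and the closing word
that fills the rest of the period. Hence the generating series of the numbers of periodic points is
`tr (H' (1 - H)⁻¹)`, which is the logarithmic derivative of `1 / det (1 - H)` by Jacobi's formula
(`HeightSystem.derivative_det_walkMatrix_steps`).

This is applied three times. For the presentation itself the steps are the edges of `Σ⁻` and the
words of `C⁻_∘`, and `det (1 - H) = det (1 - A⁻ z) det (1 - H^{C⁻})` (`det_codeNeg`). Reversal of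
time exchanges the signs (`det_codePos`). The steps of height zero are the words of `C⁰`, and they
account for the periodic points that are counted by both signs (`det_code0`, `periodCount_add`).
The asserted formula follows since both of its sides solve the same linear differential equation.

The codes are circular because the cutting points of a parsing can be recognized from the height
function: they are the minima for `C⁰`, and for `C⁻` (respectively `C⁺`) the right (left) minima
whose successor is not one.
-/

/-! ### Determinants and power series -/

section DeterminantsAndPowerSeries

open PowerSeries

theorem Derivation.map_finset_prod {R A ι : Type*} [CommRing R] [CommRing A] [Algebra R A]
    [DecidableEq ι] (D : Derivation R A A) (s : Finset ι) (f : ι → A) :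
    D (∏ i ∈ s, f i) = ∑ i ∈ s, (∏ j ∈ s.erase i, f j) * D (f i) := by
  induction s using Finset.induction_on with
  | empty => simp
  | insert a s ha ih =>
    rw [Finset.prod_insert ha, D.leibniz, ih, Finset.sum_insert ha, Finset.erase_insert ha,
      smul_eq_mul, smul_eq_mul, Finset.mul_sum, add_comm]
    congr 1
    refine Finset.sum_congr rfl fun i hi => ?_
    have hai : a ≠ i := fun h => ha (h ▸ hi)
    rw [Finset.erase_insert_of_ne hai, Finset.prod_insert fun h => ha (Finset.mem_of_mem_erase h),
      mul_assoc]

/-- Jacobi's formula for the derivative of a determinant. -/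
theorem Derivation.map_det {R A n : Type*} [CommRing R] [CommRing A] [Algebra R A]
    [Fintype n] [DecidableEq n] (D : Derivation R A A) (M : Matrix n n A) :
    D M.det = (M.adjugate * M.map D).trace := by
  have h1 : ∀ i, (M.adjugate * M.map D) i i = (M.updateCol i fun j => D (M j i)).det := by
    intro i
    rw [← Matrix.cramer_apply, Matrix.cramer_eq_adjugate_mulVec]
    rfl
  rw [Matrix.trace, Finset.sum_congr rfl fun i _ => (Matrix.diag_apply _ i).trans (h1 i)]
  simp only [Matrix.det_apply]
  rw [map_sum, Finset.sum_comm]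
  refine Finset.sum_congr rfl fun σ _ => ?_
  rw [← Finset.smul_sum]
  have h2 : D (Equiv.Perm.sign σ • ∏ i, M (σ i) i) =
      Equiv.Perm.sign σ • D (∏ i, M (σ i) i) := by
    rcases Int.units_eq_one_or (Equiv.Perm.sign σ) with h | h <;> simp [h]
  rw [h2, D.map_finset_prod]
  congr 1
  refine Finset.sum_congr rfl fun i _ => ?_
  rw [← Finset.mul_prod_erase _ _ (Finset.mem_univ i), Matrix.updateCol_self, mul_comm]
  congr 1
  refine Finset.prod_congr rfl fun j hj => ?_
  rw [Matrix.updateCol_ne (Finset.ne_of_mem_erase hj)]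

theorem derivative_det_one_sub {n : Type*} [Fintype n] [DecidableEq n]
    {H N : Matrix n n ℚ⟦X⟧} (h : (1 - H) * N = 1) :
    d⁄dX ℚ (1 - H).det = -((H.map (d⁄dX ℚ) * N).trace * (1 - H).det) := by
  have hadj : (1 - H).adjugate = (1 - H).det • N := by
    calc (1 - H).adjugate = (1 - H).adjugate * ((1 - H) * N) := by rw [h, mul_one]
      _ = (1 - H).det • N := by rw [← mul_assoc, Matrix.adjugate_mul, smul_mul_assoc, one_mul]
  have hmap : (1 - H).map (d⁄dX ℚ) = -(H.map (d⁄dX ℚ)) := by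
    ext i j : 2
    by_cases hij : i = j <;> simp [hij]
  rw [Derivation.map_det, hadj, hmap, smul_mul_assoc, Matrix.trace_smul, Matrix.mul_neg,
    Matrix.trace_neg, Matrix.trace_mul_comm, smul_eq_mul]
  ring

/-- A linear first order differential equation has at most one power series solution with a given
non-zero constant coefficient. -/
theorem PowerSeries.eq_of_derivative_eq_mul {f g c : ℚ⟦X⟧} (hf : d⁄dX ℚ f = c * f)
    (hg : d⁄dX ℚ g = c * g) (hf0 : constantCoeff f = 1) (hg0 : constantCoeff g = 1) : f = g := by
  have hne : constantCoeff g ≠ 0 := by rw [hg0]; exact one_ne_zero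
  have hgi : g * g⁻¹ = 1 := PowerSeries.mul_inv_cancel g hne
  have h1 : f * g⁻¹ = 1 := by
    refine derivative.ext ?_ ?_
    · rw [Derivation.leibniz, derivative_inv', hf, hg, Derivation.map_one_eq_zero]
      simp only [smul_eq_mul]
      linear_combination (-(f * c * g⁻¹)) * hgi
    · simp [hf0, hg0]
  calc f = f * (g * g⁻¹) := by rw [hgi, mul_one]
    _ = (f * g⁻¹) * g := by ring
    _ = g := by rw [h1, one_mul]

theorem constantCoeff_det_one_sub {n : Type*} [Fintype n] [DecidableEq n]
    {H : Matrix n n ℚ⟦X⟧} (h : ∀ i j, constantCoeff (H i j) = 0) :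
    constantCoeff (1 - H).det = 1 := by
  rw [RingHom.map_det]
  have : (constantCoeff (R := ℚ)).mapMatrix (1 - H) = 1 := by
    ext i j
    simp [h, Matrix.one_apply, apply_ite]
  rw [this, Matrix.det_one]

theorem derivative_zetaSeries {A : Type*} (X : Set (ℤ → A)) :
    d⁄dX ℚ (zetaSeries X) = (mk fun n => (periodCount X (n + 1) : ℚ)) * zetaSeries X := by
  have h0 : constantCoeff (mk fun n : ℕ => (periodCount X n : ℚ) / (n : ℚ)) = 0 := by
    simp [← coeff_zero_eq_constantCoeff_apply]
  rw [zetaSeries, derivative_subst (HasSubst.of_constantCoeff_zero' h0), derivative_exp, mul_comm]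
  congr 1
  ext n
  rw [coeff_derivative, coeff_mk, coeff_mk]
  have : ((n : ℚ) + 1) ≠ 0 := by positivity
  push_cast
  field_simp

theorem constantCoeff_zetaSeries {A : Type*} (X : Set (ℤ → A)) :
    constantCoeff (zetaSeries X) = 1 := by
  have h0 : constantCoeff (mk fun n : ℕ => (periodCount X n : ℚ) / (n : ℚ)) = 0 := by
    simp [← coeff_zero_eq_constantCoeff_apply]
  have h1 : exp ℚ = (exp ℚ - 1) + 1 := by ring
  have hs := HasSubst.of_constantCoeff_zero' h0
  rw [zetaSeries, h1, subst_add hs, map_add]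
  have h2 : constantCoeff (subst (mk fun n : ℕ => (periodCount X n : ℚ) / (n : ℚ))
      (exp ℚ - 1)) = 0 := PowerSeries.constantCoeff_subst_eq_zero h0 (exp ℚ - 1) (by simp)
  rw [h2, zero_add]
  have : subst (mk fun n : ℕ => (periodCount X n : ℚ) / (n : ℚ)) (1 : ℚ⟦X⟧) = (1 : ℚ⟦X⟧) := by
    rw [← coe_substAlgHom hs, map_one]
  rw [this, map_one]

end DeterminantsAndPowerSeries

/-! ### Generating series of sized types -/

section GeneratingSeries

open PowerSeries

/-- The generating series `∑_n card {a : size a = n} z ^ n` of a type with a size function. It is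
meaningful when there are finitely many elements of each size, since `Nat.card` of an infinite
type is `0`. -/
noncomputable def genSeries {α : Type*} (size : α → ℕ) : ℚ⟦X⟧ :=
  mk fun n => (Nat.card {a // size a = n} : ℚ)

theorem genSeries_congr {α β : Type*} {sa : α → ℕ} {sb : β → ℕ} (e : α ≃ β)
    (h : ∀ a, sb (e a) = sa a) : genSeries sa = genSeries sb := by
  ext n
  rw [genSeries, genSeries, coeff_mk, coeff_mk]
  congr 1
  exact Nat.card_congr (e.subtypeEquiv fun a => by rw [h])

theorem genSeries_of_isEmpty {α : Type*} [IsEmpty α] (sa : α → ℕ) : genSeries sa = 0 := by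
  ext n
  rw [genSeries, coeff_mk]
  simp

theorem genSeries_of_unique {α : Type*} [Unique α] (sa : α → ℕ) :
    genSeries sa = X ^ (sa default) := by
  ext n
  rw [genSeries, coeff_mk, coeff_X_pow]
  split_ifs with h
  · have : Unique {a // sa a = n} :=
      ⟨⟨⟨default, h.symm⟩⟩, fun a => Subtype.ext (Subsingleton.elim _ _)⟩
    simp
  · have : IsEmpty {a // sa a = n} :=
      ⟨fun a => h (by rw [← a.2, Subsingleton.elim a.1 default])⟩
    simp

theorem genSeries_sum {α β : Type*} {sa : α → ℕ} {sb : β → ℕ}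
    (ha : ∀ n, Finite {a // sa a = n}) (hb : ∀ n, Finite {b // sb b = n}) :
    genSeries (Sum.elim sa sb) = genSeries sa + genSeries sb := by
  ext n
  rw [map_add, genSeries, genSeries, genSeries, coeff_mk, coeff_mk, coeff_mk]
  have : Finite {a // Sum.elim sa sb (.inl a) = n} := ha n
  have : Finite {b // Sum.elim sa sb (.inr b) = n} := hb n
  rw [Nat.card_congr (Equiv.subtypeSum), Nat.card_sum]
  push_cast
  rfl

/-- The elements of size `n` of a disjoint union. -/
def sigmaFiberEquiv {ι : Type*} {α : ι → Type*} (s : ∀ i, α i → ℕ) (n : ℕ) :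
    {p : Σ i, α i // s p.1 p.2 = n} ≃ Σ i, {a // s i a = n} where
  toFun p := ⟨p.1.1, p.1.2, p.2⟩
  invFun p := ⟨⟨p.1, p.2.1⟩, p.2.2⟩
  left_inv _ := rfl
  right_inv _ := rfl

theorem finite_fiber_sigma {ι : Type*} [Finite ι] {α : ι → Type*} {s : ∀ i, α i → ℕ}
    (h : ∀ i n, Finite {a // s i a = n}) (n : ℕ) : Finite {p : Σ i, α i // s p.1 p.2 = n} := by
  have := fun i => h i n
  exact Finite.of_equiv _ (sigmaFiberEquiv s n).symm

theorem genSeries_sigma {ι : Type*} [Fintype ι] {α : ι → Type*} {s : ∀ i, α i → ℕ}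
    (h : ∀ i n, Finite {a // s i a = n}) :
    genSeries (fun p : Σ i, α i => s p.1 p.2) = ∑ i, genSeries (s i) := by
  ext n
  rw [map_sum]
  simp only [genSeries, coeff_mk]
  have := fun i => h i n
  rw [Nat.card_congr (sigmaFiberEquiv s n), Nat.card_sigma]
  push_cast
  rfl

/-- The elements of size `n` of a product with additive size. -/
def prodFiberEquiv {α β : Type*} (sa : α → ℕ) (sb : β → ℕ) (n : ℕ) :
    {p : α × β // sa p.1 + sb p.2 = n} ≃
      Σ k : Finset.HasAntidiagonal.antidiagonal n, {a // sa a = k.1.1} × {b // sb b = k.1.2} where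
  toFun p := ⟨⟨(sa p.1.1, sb p.1.2), Finset.HasAntidiagonal.mem_antidiagonal.2 p.2⟩,
    ⟨p.1.1, rfl⟩, ⟨p.1.2, rfl⟩⟩
  invFun p := ⟨(p.2.1.1, p.2.2.1), by
    rw [p.2.1.2, p.2.2.2]; exact Finset.HasAntidiagonal.mem_antidiagonal.1 p.1.2⟩
  left_inv _ := rfl
  right_inv := by
    rintro ⟨⟨⟨k, l⟩, hk⟩, ⟨a, ha⟩, ⟨b, hb⟩⟩
    obtain rfl : sa a = k := ha
    obtain rfl : sb b = l := hb
    rfl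

theorem finite_fiber_prod {α β : Type*} {sa : α → ℕ} {sb : β → ℕ}
    (ha : ∀ n, Finite {a // sa a = n}) (hb : ∀ n, Finite {b // sb b = n}) (n : ℕ) :
    Finite {p : α × β // sa p.1 + sb p.2 = n} := by
  have (k : Finset.HasAntidiagonal.antidiagonal n) :
      Finite ({a // sa a = k.1.1} × {b // sb b = k.1.2}) := by
    have := ha k.1.1
    have := hb k.1.2
    infer_instance
  exact Finite.of_equiv _ (prodFiberEquiv sa sb n).symm

theorem genSeries_prod {α β : Type*} {sa : α → ℕ} {sb : β → ℕ}
    (ha : ∀ n, Finite {a // sa a = n}) (hb : ∀ n, Finite {b // sb b = n}) :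
    genSeries (fun p : α × β => sa p.1 + sb p.2) = genSeries sa * genSeries sb := by
  ext n
  rw [coeff_mul]
  simp only [genSeries, coeff_mk]
  have : ∀ k : Finset.HasAntidiagonal.antidiagonal n, Finite ({a // sa a = k.1.1} × {b // sb b = k.1.2}) :=
    fun k => by have := ha k.1.1; have := hb k.1.2; infer_instance
  rw [Nat.card_congr (prodFiberEquiv sa sb n), Nat.card_sigma]
  push_cast
  rw [← Finset.sum_coe_sort (Finset.HasAntidiagonal.antidiagonal n)
    (fun p => (Nat.card {a // sa a = p.1} : ℚ) * (Nat.card {b // sb b = p.2} : ℚ))]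
  refine Finset.sum_congr rfl fun k _ => ?_
  rw [Nat.card_prod]
  push_cast
  rfl

/-- The marked elements `(a, i)`, `i < size a`, with `size a = n + 1`. -/
def markFiberEquiv {α : Type*} (sa : α → ℕ) (n : ℕ) :
    {p : Σ a, Fin (sa a) // sa p.1 - 1 = n} ≃ {a // sa a = n + 1} × Fin (n + 1) where
  toFun p :=
    have h : sa p.1.1 = n + 1 := by have := p.1.2.2; have := p.2; omega
    ⟨⟨p.1.1, h⟩, Fin.cast h p.1.2⟩
  invFun p := ⟨⟨p.1.1, Fin.cast p.1.2.symm p.2⟩, by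
    have h : sa p.1.1 = n + 1 := p.1.2
    change sa p.1.1 - 1 = n
    omega⟩
  left_inv _ := rfl
  right_inv _ := rfl

theorem finite_fiber_mark {α : Type*} {sa : α → ℕ} (ha : ∀ n, Finite {a // sa a = n}) (n : ℕ) :
    Finite {p : Σ a, Fin (sa a) // sa p.1 - 1 = n} := by
  have := ha (n + 1)
  exact Finite.of_equiv _ (markFiberEquiv sa n).symm

/-- Differentiation of a generating series counts elements `a` with a mark `i < size a`. -/
theorem derivative_genSeries {α : Type*} (sa : α → ℕ) :
    d⁄dX ℚ (genSeries sa) = genSeries fun p : Σ a, Fin (sa a) => sa p.1 - 1 := by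
  ext n
  rw [coeff_derivative]
  simp only [genSeries, coeff_mk]
  rw [Nat.card_congr (markFiberEquiv sa n), Nat.card_prod, Nat.card_fin]
  push_cast
  ring

end GeneratingSeries

/-! ### Factors of bi-infinite sequences -/

section Factors

variable {A : Type*}

theorem zword_eq_map (x : ℤ → A) (i j : ℤ) :
    zword x i j = (List.range (j - i).toNat).map fun k : ℕ => x (i + (k : ℤ)) := by
  rw [zword]
  change List.map _ (List.flatMap (fun a : ℕ => [(a : ℤ)]) _) = _
  rw [← List.map_eq_flatMap, List.map_map]
  rfl

theorem length_zword (x : ℤ → A) (i j : ℤ) : (zword x i j).length = (j - i).toNat := by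
  simp [zword]

theorem zword_of_le (x : ℤ → A) {i j : ℤ} (h : j ≤ i) : zword x i j = [] := by
  have : (j - i).toNat = 0 := by omega
  simp [zword, this]

theorem zword_ne_nil (x : ℤ → A) {i j : ℤ} (h : i < j) : zword x i j ≠ [] := by
  rw [← List.length_pos_iff, length_zword]
  omega

theorem getElem_zword (x : ℤ → A) (i j : ℤ) (k : ℕ) (h : k < (zword x i j).length) :
    (zword x i j)[k] = x (i + k) := by
  simp [zword_eq_map]

theorem zword_append (x : ℤ → A) {i j k : ℤ} (hij : i ≤ j) (hjk : j ≤ k) :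
    zword x i j ++ zword x j k = zword x i k := by
  refine List.ext_getElem (by simp only [List.length_append, length_zword]; omega) ?_
  intro n h1 h2
  rw [List.getElem_append, getElem_zword]
  split_ifs with h
  · rw [getElem_zword]
  · rw [getElem_zword]
    congr 1
    rw [length_zword] at h ⊢
    omega

theorem zword_succ (x : ℤ → A) (i : ℤ) : zword x i (i + 1) = [x i] := by
  simp [zword]

theorem take_zword (x : ℤ → A) {i j : ℤ} (J : ℕ) (h : i + J ≤ j) :
    (zword x i j).take J = zword x i (i + J) := by
  rw [← zword_append x (show i ≤ i + J by omega) h]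
  refine List.take_left' ?_
  rw [length_zword]
  omega

theorem drop_zword (x : ℤ → A) {i j : ℤ} (J : ℕ) (h : i + J ≤ j) :
    (zword x i j).drop J = zword x (i + J) j := by
  rw [← zword_append x (show i ≤ i + J by omega) h]
  refine List.drop_left' ?_
  rw [length_zword]
  omega

theorem zword_eq_of_shift (x y : ℤ → A) (c i j : ℤ) (h : ∀ k, x (k + c) = y k) :
    zword x (i + c) (j + c) = zword y i j := by
  refine List.ext_getElem (by simp only [length_zword]; congr 1; omega) fun n h1 h2 => ?_
  rw [getElem_zword, getElem_zword, ← h]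
  congr 1
  omega

theorem zword_eq_append_singleton (x : ℤ → A) {i j : ℤ} (h : i ≤ j) :
    zword x i (j + 1) = zword x i j ++ [x j] := by
  rw [← zword_succ, zword_append x h (by omega)]

theorem zword_eq_cons (x : ℤ → A) {i j : ℤ} (h : i < j) :
    zword x i j = x i :: zword x (i + 1) j := by
  rw [← zword_append x (show i ≤ i + 1 by omega) (by omega), zword_succ, List.singleton_append]

theorem apply_add_mul_of_periodic {x : ℤ → A} {n : ℤ} (h : ∀ i, x (i + n) = x i) (i m : ℤ) :
    x (i + m * n) = x i := by
  induction m using Int.induction_on with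
  | zero => simp
  | succ m ih =>
    rw [← ih, ← h (i + m * n)]
    congr 1
    ring
  | pred m ih =>
    rw [← ih, ← h (i + (-m - 1) * n)]
    congr 1
    ring

theorem exists_periodic_extension (w : List A) (hw : w ≠ []) (c : ℤ) :
    ∃ x : ℤ → A, (∀ i, x (i + w.length) = x i) ∧ zword x c (c + w.length) = w := by
  have hpos : (0 : ℤ) < w.length := by exact_mod_cast List.length_pos_iff.2 hw
  have hlt : ∀ i : ℤ, ((i - c) % w.length).toNat < w.length := fun i => by
    have := Int.emod_lt_of_pos (i - c) hpos
    have := Int.emod_nonneg (i - c) hpos.ne'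
    omega
  refine ⟨fun i => w[((i - c) % w.length).toNat]'(hlt i), fun i => ?_, ?_⟩
  · have : (i + w.length - c) % w.length = (i - c) % w.length := by
      rw [show i + (w.length : ℤ) - c = (i - c) + w.length by ring, Int.add_emod_right]
    simp only [this]
  · refine List.ext_getElem (by rw [length_zword]; omega) fun n h1 h2 => ?_
    rw [getElem_zword]
    congr 1
    rw [show c + (n : ℤ) - c = n by ring, Int.emod_eq_of_lt (by omega) (by omega)]
    simp

/-- A periodic sequence is determined by the word on one period. -/
theorem eq_of_zword_eq_of_periodic {x y : ℤ → A} {n c : ℤ} (hn : 0 < n)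
    (hx : ∀ i, x (i + n) = x i) (hy : ∀ i, y (i + n) = y i)
    (h : zword x c (c + n) = zword y c (c + n)) : x = y := by
  funext i
  have h1 := Int.emod_lt_of_pos (i - c) hn
  have h2 := Int.emod_nonneg (i - c) hn.ne'
  have h3 : i = (c + ((i - c) % n).toNat) + (i - c) / n * n := by
    have := Int.emod_add_mul_ediv (i - c) n
    rw [Int.toNat_of_nonneg h2, mul_comm]
    linarith
  rw [h3, apply_add_mul_of_periodic hx, apply_add_mul_of_periodic hy]
  have hlx : ((i - c) % n).toNat < (zword x c (c + n)).length := by rw [length_zword]; omega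
  have hly : ((i - c) % n).toNat < (zword y c (c + n)).length := by rw [length_zword]; omega
  rw [← getElem_zword x c (c + n) _ hlx, ← getElem_zword y c (c + n) _ hly]
  simp only [h]

end Factors

/-! ### Heights of words and sequences -/

section Heights

variable {E : Type*} (ht : E → ℤ)

/-- The height of a word is the sum of the heights of its letters. -/
def wordHeight (w : List E) : ℤ := (w.map ht).sum

@[simp] theorem wordHeight_nil : wordHeight ht [] = 0 := rfl

@[simp] theorem wordHeight_cons (a : E) (w : List E) :
    wordHeight ht (a :: w) = ht a + wordHeight ht w := by simp [wordHeight]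

@[simp] theorem wordHeight_append (v w : List E) :
    wordHeight ht (v ++ w) = wordHeight ht v + wordHeight ht w := by simp [wordHeight]

theorem wordHeight_take_add_drop (w : List E) (J : ℕ) :
    wordHeight ht (w.take J) + wordHeight ht (w.drop J) = wordHeight ht w := by
  rw [← wordHeight_append, List.take_append_drop]

/-- The height function of a bi-infinite sequence: the function on `ℤ` with value `0` at `0`
whose increment at `i` is the height of the letter `x i`. -/
def heightAt (x : ℤ → E) (i : ℤ) : ℤ := wordHeight ht (zword x 0 i) - wordHeight ht (zword x i 0)

theorem heightAt_succ (x : ℤ → E) (i : ℤ) : heightAt ht x (i + 1) = heightAt ht x i + ht (x i) := by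
  rcases le_or_gt 0 i with h | h
  · rw [heightAt, heightAt, zword_eq_append_singleton x h, zword_of_le x h,
      zword_of_le x (show (0 : ℤ) ≤ i + 1 by omega)]
    simp
  · rw [heightAt, heightAt, zword_eq_cons x h, zword_of_le x h.le,
      zword_of_le x (show i + 1 ≤ (0 : ℤ) by omega)]
    simp only [wordHeight_nil, wordHeight_cons]
    ring

theorem wordHeight_zword (x : ℤ → E) {i j : ℤ} (h : i ≤ j) :
    wordHeight ht (zword x i j) = heightAt ht x j - heightAt ht x i := by
  induction j, h using Int.leInduction with
  | base => simp [zword_of_le]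
  | succ j h ih =>
    rw [zword_eq_append_singleton x h, wordHeight_append, ih, heightAt_succ]
    simp only [wordHeight_cons, wordHeight_nil]
    ring

theorem heightAt_add_period {x : ℤ → E} {n : ℤ} (hn : 0 ≤ n) (h : ∀ i, x (i + n) = x i) (i : ℤ) :
    heightAt ht x (i + n) = heightAt ht x i + wordHeight ht (zword x 0 n) := by
  have key : ∀ i, heightAt ht x (i + n) - heightAt ht x i = heightAt ht x n - heightAt ht x 0 := by
    intro i
    induction i using Int.induction_on with
    | zero => simp
    | succ i ih =>
      have e : (i : ℤ) + 1 + n = i + n + 1 := by ring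
      rw [e, heightAt_succ, heightAt_succ, h]
      linarith
    | pred i ih =>
      have h1 := heightAt_succ ht x (-(i : ℤ) - 1)
      have h2 := heightAt_succ ht x (-(i : ℤ) - 1 + n)
      rw [h] at h2
      have e1 : -(i : ℤ) - 1 + 1 = -i := by ring
      have e2 : -(i : ℤ) - 1 + n + 1 = -i + n := by ring
      rw [e1] at h1
      rw [e2] at h2
      linarith
  rw [wordHeight_zword ht x hn]
  linarith [key i]

/-- The interval `[j, j')` contains `0`, and it is a step between consecutive positions after
which the function `h` never falls below its value there. -/
def IsStep (h : ℤ → ℤ) (j j' : ℤ) : Prop :=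
  j ≤ 0 ∧ 0 < j' ∧ h j ≤ h j' ∧ (∀ l, j < l → l < j' → h j' < h l) ∧ ∀ l, j' ≤ l → h j' ≤ h l

theorem IsStep.unique {h : ℤ → ℤ} {i i' j j' : ℤ} (hi : IsStep h i i') (hj : IsStep h j j') :
    i = j ∧ i' = j' := by
  have key : ∀ {i i' j j' : ℤ}, IsStep h i i' → IsStep h j j' → i' ≤ j' ∧ (i' = j' → j ≤ i) := by
    rintro i i' j j' ⟨hi1, hi2, hi3, hi4, hi5⟩ ⟨hj1, hj2, hj3, hj4, hj5⟩
    refine ⟨?_, ?_⟩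
    · by_contra hlt
      have := hi4 j' (by omega) (by omega)
      have := hj5 i' (by omega)
      omega
    · rintro rfl
      by_contra hlt
      have := hi4 j (by omega) (by omega)
      omega
  have h1 := key hi hj
  have h2 := key hj hi
  have h3 : i' = j' := le_antisymm h1.1 h2.1
  exact ⟨le_antisymm (h2.2 h3.symm) (h1.2 h3), h3⟩

theorem add_mul_of_add_period {h : ℤ → ℤ} {n K : ℤ} (hK : ∀ i, h (i + n) = h i + K) (i m : ℤ) :
    h (i + m * n) = h i + m * K := by
  induction m using Int.induction_on with
  | zero => simp
  | succ m ih =>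
    rw [show i + ((m : ℤ) + 1) * n = i + m * n + n by ring, hK, ih]
    ring
  | pred m ih =>
    have := hK (i + (-(m : ℤ) - 1) * n)
    rw [show i + (-(m : ℤ) - 1) * n + n = i + -(m : ℤ) * n by ring, ih] at this
    linarith

theorem exists_isStep {h : ℤ → ℤ} {n K : ℤ} (hn : 0 < n) (hK0 : 0 ≤ K)
    (hK : ∀ i, h (i + n) = h i + K) : ∃ j j', IsStep h j j' ∧ j' ≤ j + n := by
  obtain ⟨m, hm, hmin⟩ := Finset.exists_min_image (Finset.Icc (1 : ℤ) n) h
    ⟨1, Finset.mem_Icc.2 ⟨le_rfl, hn⟩⟩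
  rw [Finset.mem_Icc] at hm
  have hglob : ∀ l, 1 ≤ l → h m ≤ h l := by
    intro l hl
    have h1 := Int.emod_lt_of_pos (l - 1) hn
    have h2 := Int.emod_nonneg (l - 1) hn.ne'
    have h3 : 0 ≤ (l - 1) / n := Int.ediv_nonneg (by omega) hn.le
    have h4 : l = ((l - 1) % n + 1) + (l - 1) / n * n := by
      have := Int.emod_add_mul_ediv (l - 1) n
      rw [mul_comm ((l - 1) / n)]
      linarith
    rw [h4, add_mul_of_add_period hK]
    have h5 := hmin ((l - 1) % n + 1) (Finset.mem_Icc.2 ⟨by omega, by omega⟩)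
    have := mul_nonneg h3 hK0
    linarith
  obtain ⟨j', ⟨hj'1, hj'2⟩, hj'3⟩ := Int.exists_least_of_bdd (P := fun l => 1 ≤ l ∧ h l ≤ h m)
    ⟨1, fun z hz => hz.1⟩ ⟨m, hm.1, le_rfl⟩
  have hj'm := hj'3 m ⟨hm.1, le_rfl⟩
  have hback : h (j' - n) ≤ h j' := by
    have := hK (j' - n)
    rw [sub_add_cancel] at this
    linarith
  obtain ⟨j, ⟨hj1, hj2⟩, hj3⟩ := Int.exists_greatest_of_bdd (P := fun l => l ≤ 0 ∧ h l ≤ h j')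
    ⟨0, fun z hz => hz.1⟩ ⟨j' - n, by omega, hback⟩
  refine ⟨j, j', ⟨hj1, by omega, hj2, fun l hl1 hl2 => ?_, fun l hl => ?_⟩, ?_⟩
  · by_contra hle
    rcases le_or_gt l 0 with hl | hl
    · have := hj3 l ⟨hl, by omega⟩
      omega
    · have := hj'3 l ⟨by omega, by omega⟩
      omega
  · exact hj'2.trans (hglob l (by omega))
  · have := hj3 (j' - n) ⟨by omega, hback⟩
    omega

end Heights

/-! ### Walks and their generating matrices -/

section Walks

open PowerSeries

variable {V E : Type*} (s t : E → V)

/-- The word `w` is a (possibly empty) walk from `u` to `v` in the directed graph with source map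
`s` and target map `t`. -/
def IsWalk : V → List E → V → Prop
  | u, [], v => u = v
  | u, a :: w, v => s a = u ∧ IsWalk (t a) w v

variable {s t}

theorem isWalk_append {u v : V} {w w' : List E} :
    IsWalk s t u (w ++ w') v ↔ ∃ m, IsWalk s t u w m ∧ IsWalk s t m w' v := by
  induction w generalizing u with
  | nil => simp [IsWalk]
  | cons a w ih => simp [IsWalk, ih, and_assoc]

theorem IsWalk.target_unique {u v v' : V} {w : List E} (h : IsWalk s t u w v)
    (h' : IsWalk s t u w v') : v = v' := by
  induction w generalizing u with
  | nil => exact h.symm.trans h'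
  | cons a w ih => exact ih h.2 h'.2

theorem IsWalk.endpoints_unique {u u' v v' : V} {w : List E} (hw : w ≠ [])
    (h : IsWalk s t u w v) (h' : IsWalk s t u' w v') : u = u' ∧ v = v' := by
  obtain ⟨a, w, rfl⟩ := List.exists_cons_of_ne_nil hw
  obtain rfl : u = u' := h.1.symm.trans h'.1
  exact ⟨rfl, h.target_unique h'⟩

theorem isWalk_zword {x : ℤ → E} (h : ∀ i, t (x i) = s (x (i + 1))) {i j : ℤ} (hij : i ≤ j) :
    IsWalk s t (s (x i)) (zword x i j) (s (x j)) := by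
  induction j, hij using Int.leInduction with
  | base => simp [zword_of_le, IsWalk]
  | succ j hij ih =>
    rw [zword_eq_append_singleton x hij, isWalk_append]
    exact ⟨_, ih, rfl, h j⟩

variable (s t)

/-- The walks from `u` to `v` that belong to the set of words `A`. -/
def WalkIn (A : Set (List E)) (u v : V) : Type _ := {w : List E // w ∈ A ∧ IsWalk s t u w v}

/-- The matrix of the generating series of the walks in `A`, counted by length. -/
noncomputable def walkMatrix (A : Set (List E)) : Matrix V V ℚ⟦X⟧ :=
  Matrix.of fun u v => genSeries fun w : WalkIn s t A u v => w.1.length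

variable {s t}

theorem finite_walkIn [Finite E] (A : Set (List E)) (u v : V) (n : ℕ) :
    Finite {w : WalkIn s t A u v // w.1.length = n} := by
  have : Finite {w : List E // w.length = n} := List.finite_length_eq E n
  exact Finite.of_injective
    (fun w : {w : WalkIn s t A u v // w.1.length = n} =>
      (⟨w.1.1, w.2⟩ : {w : List E // w.length = n}))
    fun w w' h => Subtype.ext (Subtype.ext (congrArg (fun l => l.1) h))

theorem walkMatrix_congr {A B : Set (List E)}
    (h : ∀ u v w, IsWalk s t u w v → (w ∈ A ↔ w ∈ B)) : walkMatrix s t A = walkMatrix s t B := by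
  ext u v : 1
  exact genSeries_congr (Equiv.subtypeEquivRight fun w =>
    and_congr_left fun hw => h u v w hw) fun _ => rfl

theorem walkMatrix_union [Finite E] {A B : Set (List E)} (h : Disjoint A B) :
    walkMatrix s t (A ∪ B) = walkMatrix s t A + walkMatrix s t B := by
  ext u v : 1
  rw [Matrix.add_apply]
  refine Eq.trans (Eq.symm ?_) (genSeries_sum (finite_walkIn A u v) (finite_walkIn B u v))
  refine genSeries_congr (Equiv.ofBijective (Sum.elim
    (fun w => (⟨w.1, Or.inl w.2.1, w.2.2⟩ : WalkIn s t (A ∪ B) u v))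
    fun w => ⟨w.1, Or.inr w.2.1, w.2.2⟩) ⟨?_, ?_⟩) ?_
  · rintro (w | w) (w' | w') hw
    · exact congrArg _ (Subtype.ext (congrArg (fun l : WalkIn s t (A ∪ B) u v => l.1) hw))
    · exact (Set.disjoint_left.1 h w.2.1 ((congrArg Subtype.val hw : w.1 = w'.1) ▸ w'.2.1)).elim
    · exact (Set.disjoint_left.1 h w'.2.1 ((congrArg Subtype.val hw : w.1 = w'.1) ▸ w.2.1)).elim
    · exact congrArg _ (Subtype.ext (congrArg (fun l : WalkIn s t (A ∪ B) u v => l.1) hw))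
  · rintro ⟨w, hw | hw, hw'⟩
    · exact ⟨.inl ⟨w, hw, hw'⟩, rfl⟩
    · exact ⟨.inr ⟨w, hw, hw'⟩, rfl⟩
  · rintro (w | w) <;> rfl

theorem walkMatrix_singleton_nil [DecidableEq V] : walkMatrix s t {([] : List E)} = 1 := by
  ext u v : 1
  rw [walkMatrix, Matrix.of_apply, Matrix.one_apply]
  split_ifs with h
  · have : Unique (WalkIn s t {([] : List E)} u v) :=
      ⟨⟨⟨[], rfl, h⟩⟩, fun w => Subtype.ext w.2.1⟩
    rw [genSeries_of_unique, (default : WalkIn s t {([] : List E)} u v).2.1]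
    simp
  · have : IsEmpty (WalkIn s t {([] : List E)} u v) := by
      refine ⟨fun w => h ?_⟩
      obtain ⟨w, rfl, hw⟩ := w
      exact hw
    exact genSeries_of_isEmpty _

/-- The generating matrix of an unambiguous product of sets of words is the product of the
generating matrices. -/
theorem walkMatrix_mul [Fintype V] [Finite E] {A B C : Set (List E)}
    (hmem : ∀ u v w a b, IsWalk s t u a v → IsWalk s t v b w → a ∈ A → b ∈ B → a ++ b ∈ C)
    (hex : ∀ u v c, IsWalk s t u c v → c ∈ C → ∃ a ∈ A, ∃ b ∈ B, a ++ b = c)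
    (huniq : ∀ a ∈ A, ∀ b ∈ B, ∀ a' ∈ A, ∀ b' ∈ B, a ++ b = a' ++ b' → a = a') :
    walkMatrix s t C = walkMatrix s t A * walkMatrix s t B := by
  ext u v : 1
  rw [Matrix.mul_apply]
  have h1 : ∀ w, walkMatrix s t A u w * walkMatrix s t B w v =
      genSeries fun p : WalkIn s t A u w × WalkIn s t B w v => p.1.1.length + p.2.1.length :=
    fun w => (genSeries_prod (finite_walkIn A u w) (finite_walkIn B w v)).symm
  rw [Finset.sum_congr rfl fun w _ => h1 w, ← genSeries_sigma
    fun w => finite_fiber_prod (finite_walkIn A u w) (finite_walkIn B w v)]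
  symm
  refine genSeries_congr (Equiv.ofBijective
    (fun p : Σ w, WalkIn s t A u w × WalkIn s t B w v => (⟨p.2.1.1 ++ p.2.2.1,
      hmem _ _ _ _ _ p.2.1.2.2 p.2.2.2.2 p.2.1.2.1 p.2.2.2.1,
      isWalk_append.2 ⟨_, p.2.1.2.2, p.2.2.2.2⟩⟩ : WalkIn s t C u v)) ⟨?_, ?_⟩) ?_
  · rintro ⟨w, ⟨a, ha, ha2⟩, ⟨b, hb, hb2⟩⟩ ⟨w', ⟨a', ha', ha2'⟩, ⟨b', hb', hb2'⟩⟩ heq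
    have heq : a ++ b = a' ++ b' := congrArg Subtype.val heq
    obtain rfl := huniq a ha b hb a' ha' b' hb' heq
    obtain rfl := List.append_cancel_left heq
    obtain rfl := ha2.target_unique ha2'
    rfl
  · rintro ⟨c, hc, hc2⟩
    obtain ⟨a, ha, b, hb, rfl⟩ := hex u v c hc2 hc
    obtain ⟨w, hw1, hw2⟩ := isWalk_append.1 hc2
    exact ⟨⟨w, ⟨a, ha, hw1⟩, ⟨b, hb, hw2⟩⟩, rfl⟩
  · intro p
    exact List.length_append

end Walks

/-! ### Periodic points of a system of walks with heights -/

section HeightSystems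

open PowerSeries

/-- A directed graph with integer heights of its edges and a factorial set of words, the good
words, such that walks that never fall below their initial height can be concatenated within the
set of good words. -/
structure HeightSystem (V E : Type*) where
  /-- the source of an edge -/
  src : E → V
  /-- the target of an edge -/
  tgt : E → V
  /-- the height of an edge -/
  ht : E → ℤ
  /-- the set of good words -/
  good : Set (List E)
  nil_mem : [] ∈ good
  factor_mem : ∀ u v w, u ++ v ++ w ∈ good → v ∈ good
  append_mem : ∀ p q r u v, IsWalk src tgt p u q → IsWalk src tgt q v r → u ∈ good → v ∈ good →
    (∀ J, 0 ≤ wordHeight ht (u.take J)) → (∀ J, 0 ≤ wordHeight ht (v.take J)) → u ++ v ∈ good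

/-- A set of non-negative integers that contains a sum of non-negative integers if and only if it
contains the summands: either all non-negative integers, or `0` only. -/
structure IsNonnegFace (Z : Set ℤ) : Prop where
  zero_mem : 0 ∈ Z
  nonneg : ∀ z ∈ Z, 0 ≤ z
  add_mem_iff : ∀ a b, 0 ≤ a → 0 ≤ b → (a + b ∈ Z ↔ a ∈ Z ∧ b ∈ Z)

theorem isNonnegFace_Ici : IsNonnegFace (Set.Ici 0) where
  zero_mem := Set.mem_Ici.2 le_rfl
  nonneg _ h := h
  add_mem_iff a b ha hb := by simp only [Set.mem_Ici]; omega

theorem isNonnegFace_singleton_zero : IsNonnegFace {0} where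
  zero_mem := rfl
  nonneg z h := by rw [Set.mem_singleton_iff] at h; omega
  add_mem_iff a b ha hb := by simp only [Set.mem_singleton_iff]; omega

namespace HeightSystem

variable {V E : Type*} (S : HeightSystem V E) (Z : Set ℤ)

/-- Good words with height in `Z` that never fall below their initial height. -/
def nonnegWords : Set (List E) :=
  {w | w ∈ S.good ∧ wordHeight S.ht w ∈ Z ∧ ∀ J, 0 ≤ wordHeight S.ht (w.take J)}

/-- Non-empty good words with height in `Z` that stay strictly above their final height between
their ends. They are the irreducible elements of `S.nonnegWords Z`. -/
def steps : Set (List E) :=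
  {w | w ≠ [] ∧ w ∈ S.good ∧ wordHeight S.ht w ∈ Z ∧
    ∀ J, 1 ≤ J → J < w.length → wordHeight S.ht (w.drop J) < 0}

/-- The bi-infinite walks with period `n`, all of whose factors are good, that change their height
by an element of `Z` along a period. -/
def periodicWalks (n : ℕ) : Set (ℤ → E) :=
  {x | (∀ i, S.tgt (x i) = S.src (x (i + 1))) ∧ (∀ i j, zword x i j ∈ S.good) ∧
    (∀ i : ℤ, x (i + n) = x i) ∧ wordHeight S.ht (zword x 0 n) ∈ Z}

variable {S Z}

theorem steps_subset (hZ : IsNonnegFace Z) : S.steps Z ⊆ S.nonnegWords Z := by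
  rintro w ⟨_, hg, hz, hs⟩
  refine ⟨hg, hz, fun J => ?_⟩
  have h0 := hZ.nonneg _ hz
  rcases Nat.eq_zero_or_pos J with rfl | hJ
  · simp
  rcases le_or_gt w.length J with hJ' | hJ'
  · rwa [List.take_of_length_le hJ']
  · have := hs J hJ hJ'
    have := wordHeight_take_add_drop S.ht w J
    omega

theorem append_mem_nonnegWords (hZ : IsNonnegFace Z) {p q r : V} {u v : List E}
    (hu : IsWalk S.src S.tgt p u q) (hv : IsWalk S.src S.tgt q v r)
    (hu' : u ∈ S.nonnegWords Z) (hv' : v ∈ S.nonnegWords Z) : u ++ v ∈ S.nonnegWords Z := by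
  refine ⟨S.append_mem p q r u v hu hv hu'.1 hv'.1 hu'.2.2 hv'.2.2, ?_, fun J => ?_⟩
  · rw [wordHeight_append]
    exact (hZ.add_mem_iff _ _ (hZ.nonneg _ hu'.2.1) (hZ.nonneg _ hv'.2.1)).2 ⟨hu'.2.1, hv'.2.1⟩
  · rw [List.take_append, wordHeight_append]
    exact add_nonneg (hu'.2.2 _) (hv'.2.2 _)

/-- A non-empty word of `S.nonnegWords Z` begins with a step, which ends at the first position at
which the minimal height of the non-empty prefixes is attained. -/
theorem exists_step_append (hZ : IsNonnegFace Z) {w : List E} (hw : w ∈ S.nonnegWords Z)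
    (hne : w ≠ []) : ∃ a ∈ S.steps Z, ∃ b ∈ S.nonnegWords Z, a ++ b = w := by
  have hlen : 1 ≤ w.length := List.length_pos_iff.2 hne
  set h : ℕ → ℤ := fun J => wordHeight S.ht (w.take J) with hh
  obtain ⟨m, hm, hmin⟩ := Finset.exists_min_image (Finset.Icc 1 w.length) h
    ⟨1, Finset.mem_Icc.2 ⟨le_rfl, hlen⟩⟩
  rw [Finset.mem_Icc] at hm
  classical
  have hex : ∃ j, 1 ≤ j ∧ h j ≤ h m := ⟨m, hm.1, le_rfl⟩
  obtain ⟨hj1, hj2⟩ := Nat.find_spec hex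
  have hjmin : ∀ l, 1 ≤ l → l < Nat.find hex → h m < h l := fun l hl hlt => by
    have := Nat.find_min hex hlt
    by_contra hc
    exact this ⟨hl, by omega⟩
  have hjm : Nat.find hex ≤ m := Nat.find_min' hex ⟨hm.1, le_rfl⟩
  set j := Nat.find hex with hj
  have hja : h j = h m := le_antisymm hj2 (hmin j (Finset.mem_Icc.2 ⟨hj1, by omega⟩))
  have hsplit := wordHeight_take_add_drop S.ht w j
  have hdrop : ∀ J, 0 ≤ wordHeight S.ht ((w.drop j).take J) := by
    intro J
    have h1 : h (j + J) = h j + wordHeight S.ht ((w.drop j).take J) := by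
      simp only [hh]
      rw [List.take_add, wordHeight_append]
    rcases le_or_gt (j + J) w.length with hle | hlt
    · have := hmin (j + J) (Finset.mem_Icc.2 ⟨by omega, hle⟩)
      omega
    · have := hmin w.length (Finset.mem_Icc.2 ⟨hlen, le_rfl⟩)
      have h2 : h (j + J) = h w.length := by
        simp only [hh]
        rw [List.take_of_length_le hlt.le, List.take_length]
      omega
  have hdrop' : 0 ≤ wordHeight S.ht (w.drop j) := by
    have := hdrop (w.drop j).length
    rwa [List.take_length] at this
  have hz := (hZ.add_mem_iff _ _ (hw.2.2 j) hdrop').1 (by rw [hsplit]; exact hw.2.1)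
  refine ⟨w.take j, ⟨?_, ?_, hz.1, fun J hJ hJ' => ?_⟩, w.drop j, ⟨?_, hz.2, hdrop⟩,
    List.take_append_drop j w⟩
  · rw [← List.length_pos_iff, List.length_take]
    omega
  · refine S.factor_mem [] (w.take j) (w.drop j) ?_
    rw [List.nil_append, List.take_append_drop]
    exact hw.1
  · rw [List.length_take] at hJ'
    have h1 := wordHeight_take_add_drop S.ht (w.take j) J
    rw [List.take_take, min_eq_left (by omega)] at h1
    have h2 := hjmin J hJ (by omega)
    simp only [hh] at h2 hja
    omega
  · refine S.factor_mem (w.take j) (w.drop j) [] ?_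
    rw [List.append_nil, List.take_append_drop]
    exact hw.1

theorem step_unique {a b a' b' : List E} (ha : a ∈ S.steps Z) (hb : b ∈ S.nonnegWords Z)
    (ha' : a' ∈ S.steps Z) (hb' : b' ∈ S.nonnegWords Z) (h : a ++ b = a' ++ b') : a = a' := by
  have key : ∀ {a b a' b' : List E}, a ∈ S.steps Z → b ∈ S.nonnegWords Z → a' ∈ S.steps Z →
      a ++ b = a' ++ b' → a'.length ≤ a.length := by
    intro a b a' b' ha hb ha' h
    by_contra hlt
    have h1 : a.length < a'.length := by omega
    have h2 := ha'.2.2.2 a.length (List.length_pos_iff.2 ha.1) h1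
    have h3 : b.take (a'.length - a.length) = a'.drop a.length := by
      have : (a ++ b).take a'.length = a' := by rw [h, List.take_left]
      rw [List.take_append, List.take_of_length_le h1.le] at this
      rw [← this, List.drop_left]
      simp
    have := hb.2.2 (a'.length - a.length)
    rw [h3] at this
    omega
  exact (List.append_inj h (le_antisymm (key ha' hb' ha h.symm) (key ha hb ha' h))).1

theorem one_sub_walkMatrix_steps_mul [Fintype V] [DecidableEq V] [Finite E]
    (hZ : IsNonnegFace Z) :
    (1 - walkMatrix S.src S.tgt (S.steps Z)) * walkMatrix S.src S.tgt (S.nonnegWords Z) = 1 := by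
  have hnil : [] ∈ S.nonnegWords Z :=
    ⟨S.nil_mem, by simpa using hZ.zero_mem, fun J => by simp⟩
  have h1 : S.nonnegWords Z = {[]} ∪ (S.nonnegWords Z \ {[]}) := by
    rw [Set.union_sdiff_self, Set.union_eq_self_of_subset_left (by simpa using hnil)]
  have h2 : walkMatrix S.src S.tgt (S.nonnegWords Z \ {[]}) =
      walkMatrix S.src S.tgt (S.steps Z) * walkMatrix S.src S.tgt (S.nonnegWords Z) := by
    refine walkMatrix_mul ?_ ?_ ?_
    · intro u v w a b hwa hwb ha hb
      refine ⟨append_mem_nonnegWords hZ hwa hwb (steps_subset hZ ha) hb, ?_⟩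
      exact List.append_ne_nil_of_left_ne_nil ha.1 b
    · intro u v c _ hc
      exact exists_step_append hZ hc.1 hc.2
    · intro a ha b hb a' ha' b' hb' h
      exact step_unique ha hb ha' hb' h
  have h3 : walkMatrix S.src S.tgt (S.nonnegWords Z) = 1 +
      walkMatrix S.src S.tgt (S.steps Z) * walkMatrix S.src S.tgt (S.nonnegWords Z) := by
    rw [← h2, ← walkMatrix_singleton_nil (s := S.src) (t := S.tgt),
      ← walkMatrix_union Set.disjoint_sdiff_right, ← h1]
  rw [sub_mul, one_mul]
  nth_rewrite 1 [h3]
  rw [add_sub_cancel_right]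

end HeightSystem

end HeightSystems

section CountingPeriodicWalks

open PowerSeries

namespace HeightSystem

variable {V E : Type*} {S : HeightSystem V E} {Z : Set ℤ}

theorem zword_mem_steps {x : ℤ → E} {i j : ℤ} (hij : i < j) :
    zword x i j ∈ S.steps Z ↔ zword x i j ∈ S.good ∧
      heightAt S.ht x j - heightAt S.ht x i ∈ Z ∧
      ∀ l, i < l → l < j → heightAt S.ht x j < heightAt S.ht x l := by
  rw [← wordHeight_zword S.ht x hij.le]
  refine ⟨fun h => ⟨h.2.1, h.2.2.1, fun l hl hl' => ?_⟩,
    fun h => ⟨zword_ne_nil x hij, h.1, h.2.1, fun J hJ hJ' => ?_⟩⟩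
  · have := h.2.2.2 (l - i).toNat (by omega) (by rw [length_zword]; omega)
    rw [drop_zword x _ (by omega), wordHeight_zword _ _ (by omega)] at this
    rw [show i + ((l - i).toNat : ℤ) = l by omega] at this
    omega
  · rw [length_zword] at hJ'
    rw [drop_zword x _ (by omega), wordHeight_zword _ _ (by omega)]
    have := h.2.2 (i + J) (by omega) (by omega)
    omega

theorem zword_mem_nonnegWords {x : ℤ → E} {i j : ℤ} (hij : i ≤ j) :
    zword x i j ∈ S.nonnegWords Z ↔ zword x i j ∈ S.good ∧
      heightAt S.ht x j - heightAt S.ht x i ∈ Z ∧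
      ∀ l, i ≤ l → l ≤ j → heightAt S.ht x i ≤ heightAt S.ht x l := by
  rw [← wordHeight_zword S.ht x hij]
  refine ⟨fun h => ⟨h.1, h.2.1, fun l hl hl' => ?_⟩, fun h => ⟨h.1, h.2.1, fun J => ?_⟩⟩
  · have := h.2.2 (l - i).toNat
    rw [take_zword x _ (by omega), wordHeight_zword _ _ (by omega)] at this
    rw [show i + ((l - i).toNat : ℤ) = l by omega] at this
    omega
  · rcases le_or_gt (i + J) j with hJ | hJ
    · rw [take_zword x _ hJ, wordHeight_zword _ _ (by omega)]
      have := h.2.2 (i + J) (by omega) (by omega)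
      omega
    · rw [List.take_of_length_le (by rw [length_zword]; omega), wordHeight_zword _ _ hij]
      have := h.2.2 j hij le_rfl
      omega

/-- A periodic walk splits into a step around `0` and a closing word of `S.nonnegWords Z`. -/
theorem exists_step_of_mem_periodicWalks (hZ : IsNonnegFace Z) {x : ℤ → E} {n : ℕ}
    (hn : 0 < n) (hx : x ∈ S.periodicWalks Z n) :
    ∃ j j', IsStep (heightAt S.ht x) j j' ∧ j' ≤ j + n ∧ zword x j j' ∈ S.steps Z ∧
      zword x j' (j + n) ∈ S.nonnegWords Z := by
  obtain ⟨hwalk, hgood, hper, hz⟩ := hx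
  have hK := heightAt_add_period S.ht (n := (n : ℤ)) (by omega) hper
  obtain ⟨j, j', hs, hle⟩ := exists_isStep (n := (n : ℤ)) (by omega) (hZ.nonneg _ hz) hK
  obtain ⟨hs1, hs2, hs3, hs4, hs5⟩ := id hs
  have hsum : heightAt S.ht x j' - heightAt S.ht x j +
      (heightAt S.ht x (j + n) - heightAt S.ht x j') ∈ Z := by
    rw [hK]
    convert! hz using 1
    ring
  have hz' := (hZ.add_mem_iff _ _ (by omega) (by have := hs5 (j + n) hle; omega)).1 hsum
  refine ⟨j, j', hs, hle, (zword_mem_steps (by omega)).2 ⟨hgood _ _, hz'.1, hs4⟩,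
    (zword_mem_nonnegWords hle).2 ⟨hgood _ _, hz'.2, fun l hl _ => hs5 l hl⟩⟩

/-- Each choice of a step, a closing word, and a mark `o` on the step, comes from a periodic
walk. -/
theorem exists_mem_periodicWalks (hZ : IsNonnegFace Z) {u v : V} {a b : List E} {n o : ℕ}
    (ha : a ∈ S.steps Z) (hua : IsWalk S.src S.tgt u a v) (hb : b ∈ S.nonnegWords Z)
    (hub : IsWalk S.src S.tgt v b u) (hn : a.length + b.length = n) (ho : o < a.length) :
    ∃ x ∈ S.periodicWalks Z n, IsStep (heightAt S.ht x) (-o) (-o + a.length) ∧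
      zword x (-o) (-o + a.length) = a ∧ zword x (-o + a.length) (-o + n) = b := by
  have hab : (a ++ b).length = n := by rw [List.length_append, hn]
  have hw := append_mem_nonnegWords hZ hua hub (steps_subset hZ ha) hb
  have hwalk : IsWalk S.src S.tgt u (a ++ b) u := isWalk_append.2 ⟨v, hua, hub⟩
  obtain ⟨x, hper, hxw⟩ :=
    exists_periodic_extension (a ++ b) (List.append_ne_nil_of_left_ne_nil ha.1 b) (-o)
  rw [hab] at hper hxw
  -- the words on several consecutive periods
  have hblock : ∀ k : ℤ, ∀ m : ℕ,
      zword x (-o + k * n) (-o + k * n + m * n) ∈ S.nonnegWords Z ∧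
      IsWalk S.src S.tgt u (zword x (-o + k * n) (-o + k * n + m * n)) u := by
    intro k m
    induction m with
    | zero =>
      rw [zword_of_le x (by simp)]
      exact ⟨⟨S.nil_mem, by simpa using hZ.zero_mem, fun J => by simp⟩, rfl⟩
    | succ m ih =>
      have h1 : zword x (-o + k * n + m * n) (-o + k * n + (m + 1 : ℕ) * n) = a ++ b := by
        rw [← hxw, ← zword_eq_of_shift x x ((k + m) * n) (-o) (-o + n)
          (fun i => apply_add_mul_of_periodic hper i _)]
        congr 1
        · ring
        · push_cast
          ring
      rw [← zword_append x (j := -o + k * n + m * n) (le_add_of_nonneg_right (by positivity))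
        (by push_cast; nlinarith), h1]
      exact ⟨append_mem_nonnegWords hZ ih.2 hwalk ih.1 hw, isWalk_append.2 ⟨u, ih.2, hwalk⟩⟩
  have hnpos : 0 < n := by omega
  -- every factor of `x` is a factor of such a word
  have hcover : ∀ i j : ℤ, i ≤ j → ∃ k : ℤ, ∃ m : ℕ,
      -o + k * n ≤ i ∧ j ≤ -o + k * n + m * n := by
    intro i j hij
    refine ⟨-|i|, (|i| + |j| + o).toNat, ?_, ?_⟩
    · have := neg_abs_le i
      have := abs_nonneg i
      have : (1 : ℤ) ≤ n := by omega
      nlinarith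
    · have := le_abs_self j
      have := abs_nonneg j
      have := abs_nonneg i
      have h1 : (1 : ℤ) ≤ n := by omega
      rw [Int.toNat_of_nonneg (by omega)]
      nlinarith
  have hgood : ∀ i j, zword x i j ∈ S.good := by
    intro i j
    rcases le_or_gt i j with hij | hij
    · obtain ⟨k, m, hk, hm⟩ := hcover i j hij
      refine S.factor_mem (zword x (-o + k * n) i) _ (zword x j (-o + k * n + m * n)) ?_
      rw [zword_append x hk hij, zword_append x (hk.trans hij) hm]
      exact (hblock k m).1.1
    · rw [zword_of_le x hij.le]
      exact S.nil_mem
  have hadj : ∀ i, S.tgt (x i) = S.src (x (i + 1)) := by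
    intro i
    obtain ⟨k, m, hk, hm⟩ := hcover i (i + 2) (by omega)
    have h1 := (hblock k m).2
    rw [← zword_append x hk (show i ≤ _ by omega), isWalk_append] at h1
    obtain ⟨p, -, h1⟩ := h1
    rw [zword_eq_cons x (by omega), zword_eq_cons x (by omega)] at h1
    exact h1.2.1.symm
  have hsplit : zword x (-o) (-o + a.length) = a ∧ zword x (-o + a.length) (-o + n) = b := by
    rw [← zword_append x (j := -o + a.length) (by omega) (by omega)] at hxw
    exact List.append_inj hxw (by rw [length_zword]; omega)
  have hzn : wordHeight S.ht (zword x 0 n) ∈ Z := by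
    have h1 := heightAt_add_period S.ht (n := (n : ℤ)) (by omega) hper (-o)
    have h2 := wordHeight_zword S.ht x (show -(o : ℤ) ≤ -o + n by omega)
    rw [hxw] at h2
    rw [show wordHeight S.ht (zword x 0 n) = wordHeight S.ht (a ++ b) by omega]
    exact hw.2.1
  refine ⟨x, ⟨hadj, hgood, hper, hzn⟩, ⟨by omega, by omega, ?_, ?_, ?_⟩, hsplit⟩
  · have := hZ.nonneg _ ha.2.2.1
    rw [← hsplit.1, wordHeight_zword _ _ (by omega)] at this
    omega
  · rw [← hsplit.1] at ha
    rw [zword_mem_steps (by omega)] at ha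
    rw [← hsplit.1] at ho ⊢
    simpa only [hsplit.1] using ha.2.2
  · intro l hl
    have hb' : zword x (-o + a.length) (-o + n) ∈ S.nonnegWords Z := by rwa [hsplit.2]
    rw [zword_mem_nonnegWords (by omega)] at hb'
    rcases le_or_gt l (-o + n) with hl' | hl'
    · exact hb'.2.2 l hl hl'
    · have h1 := hb'.2.2 (-o + n) (by omega) le_rfl
      have h2 := (hblock 1 (l + o).toNat).1
      have h3 : l ≤ -o + 1 * n + (l + o).toNat * n := by
        rw [Int.toNat_of_nonneg (by omega)]
        nlinarith
      rw [zword_mem_nonnegWords (by omega)] at h2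
      have h4 := h2.2.2 l (by omega) h3
      rw [one_mul] at h4
      exact h1.trans h4

/-- The logarithmic derivative of the determinant of the identity matrix minus the generating
matrix of the steps counts periodic walks. -/
theorem derivative_det_walkMatrix_steps [Fintype V] [DecidableEq V] [Finite E]
    (hZ : IsNonnegFace Z) :
    d⁄dX ℚ (1 - walkMatrix S.src S.tgt (S.steps Z)).det =
      -((PowerSeries.mk fun n => (Nat.card (S.periodicWalks Z (n + 1)) : ℚ)) *
        (1 - walkMatrix S.src S.tgt (S.steps Z)).det) := by
  rw [derivative_det_one_sub (one_sub_walkMatrix_steps_mul hZ)]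
  congr 2
  -- a marked step with a closing word
  let Q : V → V → Type _ := fun u v =>
    (Σ a : WalkIn S.src S.tgt (S.steps Z) u v, Fin a.1.length) ×
      WalkIn S.src S.tgt (S.nonnegWords Z) v u
  let size : ∀ u v, Q u v → ℕ := fun u v q => (q.1.1.1.length - 1) + q.2.1.length
  have hfin1 : ∀ u v n, Finite {p : Σ a : WalkIn S.src S.tgt (S.steps Z) u v, Fin a.1.length //
      p.1.1.length - 1 = n} := fun u v => finite_fiber_mark (finite_walkIn _ u v)
  have hfin : ∀ u v n, Finite {q : Q u v // size u v q = n} :=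
    fun u v => finite_fiber_prod (hfin1 u v) (finite_walkIn _ v u)
  have htrace : ((walkMatrix S.src S.tgt (S.steps Z)).map (d⁄dX ℚ) *
      walkMatrix S.src S.tgt (S.nonnegWords Z)).trace =
      genSeries fun q : Σ u, Σ v, Q u v => size q.1 q.2.1 q.2.2 := by
    rw [genSeries_sigma (s := fun u (q : Σ v, Q u v) => size u q.1 q.2)
      fun u => finite_fiber_sigma (hfin u)]
    refine Finset.sum_congr rfl fun u _ => ?_
    rw [genSeries_sigma (hfin u), Matrix.diag_apply, Matrix.mul_apply]
    refine Finset.sum_congr rfl fun v _ => ?_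
    rw [genSeries_prod (hfin1 u v) (finite_walkIn _ v u), ← derivative_genSeries]
    rfl
  rw [htrace]
  ext n
  rw [genSeries, coeff_mk, coeff_mk]
  congr 1
  -- the data that determine a marked step with a closing word
  let code : (Σ u, Σ v, Q u v) → List E × ℕ × List E := fun q =>
    (q.2.2.1.1.1, q.2.2.1.2, q.2.2.2.1)
  have hcode : Function.Injective code := by
    rintro ⟨u, v, ⟨⟨⟨a, ha⟩, o⟩, ⟨b, hb⟩⟩⟩ ⟨u', v', ⟨⟨⟨a', ha'⟩, o'⟩, ⟨b', hb'⟩⟩⟩ h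
    simp only [code, Prod.mk.injEq] at h
    obtain ⟨rfl, ho, rfl⟩ := h
    obtain ⟨rfl, rfl⟩ := ha.2.endpoints_unique ha.1.1 ha'.2
    obtain rfl := Fin.ext ho
    rfl
  symm
  have hex : ∀ x : S.periodicWalks Z (n + 1),
      ∃ q : {q : Σ u, Σ v, Q u v // size q.1 q.2.1 q.2.2 = n}, ∃ j j',
        IsStep (heightAt S.ht x.1) j j' ∧ j' ≤ j + (n + 1 : ℕ) ∧
        code q.1 = (zword x.1 j j', (-j).toNat, zword x.1 j' (j + (n + 1 : ℕ))) := by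
    intro x
    obtain ⟨j, j', hs, hle, ha, hb⟩ := exists_step_of_mem_periodicWalks hZ (Nat.succ_pos n) x.2
    obtain ⟨hs1, hs2, -⟩ := id hs
    have hw1 := isWalk_zword x.2.1 (show j ≤ j' by omega)
    have hw2 := isWalk_zword x.2.1 hle
    rw [x.2.2.2.1] at hw2
    refine ⟨⟨⟨_, _, ⟨⟨⟨_, ha, hw1⟩, ⟨(-j).toNat, ?_⟩⟩, ⟨_, hb, hw2⟩⟩⟩, ?_⟩, j, j', hs, hle, rfl⟩
    · simp only [length_zword]
      omega
    · simp only [size, length_zword]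
      omega
  choose f j j' hs hle hf using hex
  refine Nat.card_eq_of_bijective f ⟨fun x y hxy => ?_, fun q => ?_⟩
  · have h := (hf x).symm.trans ((congrArg (fun q => code q.1) hxy).trans (hf y))
    simp only [Prod.mk.injEq] at h
    obtain ⟨h1, h2, h3⟩ := h
    have hx1 := (hs x).1
    have hx2 := (hs x).2.1
    have hy1 := (hs y).1
    have hy2 := (hs y).2.1
    have hj : j x = j y := by omega
    refine Subtype.ext (eq_of_zword_eq_of_periodic (n := (n + 1 : ℕ)) (c := j x) (by omega)
      x.2.2.2.1 y.2.2.2.1 ?_)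
    rw [← zword_append x.1 (show j x ≤ j' x by omega) (hle x), h1, h3,
      zword_append y.1 (by omega) (hle y), hj]
  · obtain ⟨⟨u, v, ⟨⟨⟨a, ha⟩, o⟩, ⟨b, hb⟩⟩⟩, hq⟩ := q
    have hlen : a.length + b.length = n + 1 := by
      have : a.length - 1 + b.length = n := hq
      have := o.2
      simp only at this
      omega
    obtain ⟨x, hx, hst, h1, h2⟩ := exists_mem_periodicWalks hZ ha.1 ha.2 hb.1 hb.2 hlen o.2
    refine ⟨⟨x, hx⟩, Subtype.ext (hcode ((hf ⟨x, hx⟩).trans ?_))⟩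
    obtain ⟨e1, e2⟩ := (hs ⟨x, hx⟩).unique hst
    rw [e1, e2]
    simp only [code, h1, h2, Prod.mk.injEq, true_and, and_true]
    omega

end HeightSystem

end CountingPeriodicWalks

/-! ### The semigroup of an `R`-graph -/

namespace RGraph

variable {P Em Ep : Type*} (G : RGraph P Em Ep)

/-- The class of a word in the generators. -/
def cls (u : FreeSemigroup (Gen P Em Ep)) : G.S := (u : (conGen G.Rel).Quotient)

theorem cls_mul (u v : FreeSemigroup (Gen P Em Ep)) : G.cls (u * v) = G.cls u * G.cls v := rfl

theorem cls_surjective : Function.Surjective G.cls := Quotient.mk''_surjective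

variable {G}

theorem cls_eq_of_rel {u v : FreeSemigroup (Gen P Em Ep)} (h : G.Rel u v) : G.cls u = G.cls v :=
  (Con.eq _).2 (ConGen.Rel.of _ _ h)

theorem zero_mul' (f : G.S) : 0 * f = 0 := by
  obtain ⟨u, rfl⟩ := G.cls_surjective f
  exact cls_eq_of_rel (.zero_mul u)

theorem mul_zero' (f : G.S) : f * 0 = 0 := by
  obtain ⟨u, rfl⟩ := G.cls_surjective f
  exact cls_eq_of_rel (.mul_zero u)

theorem one_mul_self (p : P) : G.one p * G.one p = G.one p := cls_eq_of_rel (.one_mul_self p)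

theorem one_mul_one_of_ne {p q : P} (h : p ≠ q) : G.one p * G.one q = 0 :=
  cls_eq_of_rel (.one_mul_one p q h)

theorem neg_mul_pos (e : Em) (f : Ep) (h : G.R e f) :
    G.gen (.neg e) * G.gen (.pos f) = G.one (G.sm e) := cls_eq_of_rel (.neg_mul_pos e f h)

theorem neg_mul_pos_of_not (e : Em) (f : Ep) (h : ¬ G.R e f) :
    G.gen (.neg e) * G.gen (.pos f) = 0 := cls_eq_of_rel (.neg_mul_pos_zero e f h)

theorem left_ne_zero {f g : G.S} (h : f * g ≠ 0) : f ≠ 0 := by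
  rintro rfl
  exact h (zero_mul' g)

theorem right_ne_zero {f g : G.S} (h : f * g ≠ 0) : g ≠ 0 := by
  rintro rfl
  exact h (mul_zero' f)

/-- The shape of a word in the generators: the source of its first and the target of its last
letter, the number `height` of its letters in `E⁻` minus the number of its letters in `E⁺`, and the
depth, which is the largest value of `-height` on its prefixes. A letter `zero` has no source and
target. Along the defining relations the shape is constant, except on the class of zero. -/
@[ext] structure Shape (P : Type*) where
  /-- the largest value of `-height` on the prefixes, the empty one included -/
  depth : ℤ
  /-- the number of letters in `E⁻` minus the number of letters in `E⁺` -/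
  height : ℤ
  /-- the source of the first letter -/
  src : Option P
  /-- the target of the last letter -/
  tgt : Option P

instance : Semigroup (Shape P) where
  mul a b := ⟨max a.depth (b.depth - a.height), a.height + b.height, a.src, b.tgt⟩
  mul_assoc a b c := by
    refine Shape.ext ?_ (add_assoc _ _ _) rfl rfl
    change max (max a.depth (b.depth - a.height)) (c.depth - (a.height + b.height)) =
      max a.depth (max b.depth (c.depth - b.height) - a.height)
    omega

theorem Shape.mul_def (a b : Shape P) :
    a * b = ⟨max a.depth (b.depth - a.height), a.height + b.height, a.src, b.tgt⟩ := rfl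

variable (G)

/-- The shape of a generator. -/
def genShape : Gen P Em Ep → Shape P
  | .zero => ⟨0, 0, none, none⟩
  | .one p => ⟨0, 0, some p, some p⟩
  | .neg e => ⟨0, 1, some (G.sm e), some (G.tm e)⟩
  | .pos f => ⟨1, -1, some (G.sp f), some (G.tp f)⟩

/-- The shape of a word in the generators, as a homomorphism. -/
def wordShape : FreeSemigroup (Gen P Em Ep) →ₙ* Shape P := FreeSemigroup.lift G.genShape

theorem wordShape_of (a : Gen P Em Ep) : G.wordShape (FreeSemigroup.of a) = G.genShape a :=
  FreeSemigroup.lift_of _ _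

/-- The congruence that identifies words of the same class, provided that the class is zero or that
the words have the same shape. -/
def shapeCon : Con (FreeSemigroup (Gen P Em Ep)) where
  r u v := G.cls u = G.cls v ∧ (G.cls u = 0 ∨ G.wordShape u = G.wordShape v)
  iseqv :=
    { refl := fun _ => ⟨rfl, Or.inr rfl⟩
      symm := fun ⟨h, h'⟩ => ⟨h.symm, h'.imp (fun h0 => h ▸ h0) Eq.symm⟩
      trans := fun ⟨h, h'⟩ ⟨k, k'⟩ => ⟨h.trans k, by
        rcases h' with h' | h'
        · exact Or.inl h'
        · exact k'.imp (fun h0 => h.trans h0) h'.trans⟩ }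
  mul' := by
    rintro u u' v v' ⟨h, h'⟩ ⟨k, k'⟩
    refine ⟨by rw [cls_mul, cls_mul, h, k], ?_⟩
    rw [cls_mul, map_mul, map_mul]
    rcases h' with h' | h'
    · exact Or.inl (by rw [h', zero_mul'])
    rcases k' with k' | k'
    · exact Or.inl (by rw [k', mul_zero'])
    · exact Or.inr (by rw [h', k'])

theorem conGen_le_shapeCon : conGen G.Rel ≤ G.shapeCon := by
  refine Con.conGen_le.2 fun u v h => ⟨cls_eq_of_rel h, ?_⟩
  cases h with
  | zero_mul w => exact Or.inl (cls_eq_of_rel (.zero_mul w))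
  | mul_zero w => exact Or.inl (cls_eq_of_rel (.mul_zero w))
  | one_mul_one q r h => exact Or.inl (cls_eq_of_rel (.one_mul_one q r h))
  | neg_mul_pos_zero e f h => exact Or.inl (cls_eq_of_rel (.neg_mul_pos_zero e f h))
  | neg_mul_pos e f h =>
    refine Or.inr ?_
    simp [map_mul, wordShape_of, genShape, Shape.mul_def, (G.R_subset e f h).2]
  | _ => exact Or.inr (by simp [map_mul, wordShape_of, genShape, Shape.mul_def])

variable {G}

theorem wordShape_eq {u v : FreeSemigroup (Gen P Em Ep)} (h : G.cls u = G.cls v)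
    (h0 : G.cls u ≠ 0) : G.wordShape u = G.wordShape v :=
  (G.conGen_le_shapeCon ((Con.eq _).1 h)).2.resolve_left h0

/-- The shape of an element of the semigroup is the shape of a word that represents it. It does
not depend on the word, unless the element is zero. -/
noncomputable def shape (f : G.S) : Shape P := G.wordShape (G.cls_surjective f).choose

theorem shape_cls {u : FreeSemigroup (Gen P Em Ep)} (h : G.cls u ≠ 0) :
    shape (G.cls u) = G.wordShape u := by
  have := (G.cls_surjective (G.cls u)).choose_spec
  exact wordShape_eq this fun h0 => h (this.symm.trans h0)

theorem shape_mul {f g : G.S} (h : f * g ≠ 0) : shape (f * g) = shape f * shape g := by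
  obtain ⟨u, rfl⟩ := G.cls_surjective f
  obtain ⟨v, rfl⟩ := G.cls_surjective g
  rw [shape_cls (left_ne_zero h), shape_cls (right_ne_zero h), ← cls_mul, shape_cls h, map_mul]

theorem shape_gen {a : Gen P Em Ep} (h : G.gen a ≠ 0) : shape (G.gen a) = G.genShape a :=
  (shape_cls (u := FreeSemigroup.of a) h).trans (G.wordShape_of a)

theorem exists_one_mul_eq {f : G.S} (h : f ≠ 0) : ∃ p, (shape f).src = some p ∧ G.one p * f = f := by
  obtain ⟨u, rfl⟩ := G.cls_surjective f
  have key : ∀ a, G.gen a ≠ 0 → ∃ p, (G.genShape a).src = some p ∧ G.one p * G.gen a = G.gen a := by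
    rintro (_ | p | e | f) ha
    · exact (ha rfl).elim
    · exact ⟨p, rfl, one_mul_self p⟩
    · exact ⟨G.sm e, rfl, cls_eq_of_rel (.one_mul_neg e)⟩
    · exact ⟨G.sp f, rfl, cls_eq_of_rel (.one_mul_pos f)⟩
  rw [shape_cls h]
  induction u using FreeSemigroup.recOnMul with
  | ih1 a =>
    rw [wordShape_of]
    exact key a h
  | ih2 a u _ _ =>
    rw [cls_mul] at h ⊢
    obtain ⟨p, hp, hp'⟩ := key a (left_ne_zero h)
    refine ⟨p, ?_, ?_⟩
    · rw [map_mul, wordShape_of]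
      exact hp
    · rw [← mul_assoc]
      exact congrArg (· * G.cls u) hp'

theorem exists_mul_one_eq {f : G.S} (h : f ≠ 0) : ∃ p, (shape f).tgt = some p ∧ f * G.one p = f := by
  obtain ⟨u, rfl⟩ := G.cls_surjective f
  rw [shape_cls h]
  induction u using FreeSemigroup.recOnMul with
  | ih1 a =>
    rw [wordShape_of]
    revert h
    rcases a with _ | p | e | f
    · exact fun ha => (ha rfl).elim
    · exact fun _ => ⟨p, rfl, one_mul_self p⟩
    · exact fun _ => ⟨G.tm e, rfl, cls_eq_of_rel (.neg_mul_one e)⟩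
    · exact fun _ => ⟨G.tp f, rfl, cls_eq_of_rel (.pos_mul_one f)⟩
  | ih2 a u _ ih =>
    rw [cls_mul] at h ⊢
    obtain ⟨p, hp, hp'⟩ := ih (right_ne_zero h)
    refine ⟨p, ?_, ?_⟩
    · rw [map_mul]
      exact hp
    · rw [mul_assoc, hp']

theorem tgt_eq_src_of_mul_ne_zero {f g : G.S} (h : f * g ≠ 0) : (shape f).tgt = (shape g).src := by
  obtain ⟨p, hp, hp'⟩ := exists_mul_one_eq (left_ne_zero h)
  obtain ⟨q, hq, hq'⟩ := exists_one_mul_eq (right_ne_zero h)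
  by_contra hne
  rw [hp, hq] at hne
  refine h ?_
  have hpq : p ≠ q := fun h => hne (congrArg some h)
  rw [← hp', ← hq', mul_assoc, ← mul_assoc (G.one p), one_mul_one_of_ne hpq, zero_mul', mul_zero']

theorem one_mul_eq_or (p : P) (f : G.S) : G.one p * f = f ∨ G.one p * f = 0 := by
  by_cases h : f = 0
  · exact Or.inr (by rw [h, mul_zero'])
  obtain ⟨q, -, hq⟩ := exists_one_mul_eq h
  by_cases hpq : p = q
  · exact Or.inl (hpq ▸ hq)
  · exact Or.inr (by rw [← hq, ← mul_assoc, one_mul_one_of_ne hpq, zero_mul'])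

theorem mul_one_eq_or (p : P) (f : G.S) : f * G.one p = f ∨ f * G.one p = 0 := by
  by_cases h : f = 0
  · exact Or.inr (by rw [h, zero_mul'])
  obtain ⟨q, -, hq⟩ := exists_mul_one_eq h
  by_cases hpq : q = p
  · exact Or.inl (hpq ▸ hq)
  · exact Or.inr (by rw [← hq, mul_assoc, one_mul_one_of_ne hpq, mul_zero'])

/-! ### The action of the semigroup on stacks -/

variable (G)

open Classical in
/-- The partial right action of the generators on pairs of a vertex and a stack of edges in `E⁻`:
an edge in `E⁻` is pushed on the stack, an edge in `E⁺` takes an edge that is related to it off the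
stack, and does not change an empty stack. -/
noncomputable def genAct : Gen P Em Ep → P × List Em → Option (P × List Em)
  | .zero, _ => none
  | .one p, x => if x.1 = p then some x else none
  | .neg e, x => if x.1 = G.sm e then some (G.tm e, e :: x.2) else none
  | .pos f, (p, []) => if p = G.sp f then some (G.tp f, []) else none
  | .pos f, (p, e :: l) => if p = G.sp f ∧ G.R e f then some (G.tp f, l) else none

/-- The action of the words in the generators, as a homomorphism. -/
noncomputable def wordAct :
    FreeSemigroup (Gen P Em Ep) →ₙ* (Function.End (Option (P × List Em)))ᵐᵒᵖ :=
  FreeSemigroup.lift fun a => .op fun x => x.bind (G.genAct a)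

theorem wordAct_of (a : Gen P Em Ep) (x : Option (P × List Em)) :
    (G.wordAct (FreeSemigroup.of a)).unop x = x.bind (G.genAct a) := by
  rw [wordAct, FreeSemigroup.lift_of]
  rfl

theorem wordAct_mul (u v : FreeSemigroup (Gen P Em Ep)) (x : Option (P × List Em)) :
    (G.wordAct (u * v)).unop x = (G.wordAct v).unop ((G.wordAct u).unop x) := by
  rw [map_mul]
  rfl

theorem wordAct_none (u : FreeSemigroup (Gen P Em Ep)) : (G.wordAct u).unop none = none := by
  induction u using FreeSemigroup.recOnMul with
  | ih1 a => rw [wordAct_of]; rfl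
  | ih2 a u h1 h2 => rw [wordAct_mul, h1, h2]

theorem conGen_le_ker_wordAct : conGen G.Rel ≤ Con.ker G.wordAct := by
  refine Con.conGen_le.2 fun u v h => ?_
  rw [Con.ker_rel]
  refine MulOpposite.unop_injective (funext fun x => ?_)
  rcases x with _ | ⟨p, l⟩
  · rw [wordAct_none, wordAct_none]
  cases h with
  | zero_mul w =>
    rw [wordAct_mul, wordAct_of]
    exact wordAct_none G w
  | mul_zero w =>
    rw [wordAct_mul, wordAct_of, wordAct_of]
    cases (G.wordAct w).unop (some (p, l)) <;> rfl
  | one_mul_self q =>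
    simp only [wordAct_mul, wordAct_of, Option.bind_some, genAct]
    split_ifs with h <;> simp [genAct, h]
  | one_mul_one q r h =>
    simp only [wordAct_mul, wordAct_of, Option.bind_some, genAct]
    split_ifs with h <;> simp_all [genAct]
  | one_mul_neg e =>
    simp only [wordAct_mul, wordAct_of, Option.bind_some, genAct]
    split_ifs with h <;> simp [genAct, h]
  | neg_mul_one e =>
    simp only [wordAct_mul, wordAct_of, Option.bind_some, genAct]
    split_ifs with h <;> simp [genAct]
  | one_mul_pos f =>
    simp only [wordAct_mul, wordAct_of, Option.bind_some]
    rcases l with _ | ⟨e, l⟩ <;> simp only [genAct] <;> split_ifs <;> simp_all [genAct]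
  | pos_mul_one f =>
    simp only [wordAct_mul, wordAct_of, Option.bind_some]
    rcases l with _ | ⟨e, l⟩ <;> simp only [genAct] <;> split_ifs <;> simp_all [genAct]
  | neg_mul_pos e f h =>
    obtain ⟨h1, h2⟩ := G.R_subset e f h
    simp only [wordAct_mul, wordAct_of, Option.bind_some, genAct]
    split_ifs with h' <;> simp [genAct, h, h1, h2, h']
  | neg_mul_pos_zero e f h =>
    simp only [wordAct_mul, wordAct_of, Option.bind_some, genAct]
    split_ifs with h' <;> simp [genAct, h]

variable {G}

/-- The partial right action of the semigroup on pairs of a vertex and a stack of edges in `E⁻`. -/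
noncomputable def act (f : G.S) : Option (P × List Em) → Option (P × List Em) :=
  Con.liftOn f (fun u => (G.wordAct u).unop) fun _ _ h =>
    congrArg MulOpposite.unop (G.conGen_le_ker_wordAct h)

theorem act_mul (f g : G.S) (x : Option (P × List Em)) : act (f * g) x = act g (act f x) := by
  obtain ⟨u, rfl⟩ := G.cls_surjective f
  obtain ⟨v, rfl⟩ := G.cls_surjective g
  exact G.wordAct_mul u v x

theorem act_gen (a : Gen P Em Ep) (x : P × List Em) : act (G.gen a) (some x) = G.genAct a x :=
  G.wordAct_of a (some x)

theorem act_zero (x : P × List Em) : act (0 : G.S) (some x) = none := G.wordAct_of .zero (some x)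

theorem one_ne_zero' (p : P) : G.one p ≠ 0 := by
  intro h
  have h1 : act (G.one p) (some (p, [])) = some (p, []) := by
    rw [one, act_gen]
    simp [genAct]
  rw [h, act_zero] at h1
  exact Option.some_ne_none _ h1.symm

/-- The elements that act on all stacks on the vertex that is their source. -/
def Pushes (f : G.S) : Prop :=
  ∃ p q, (shape f).src = some p ∧ (shape f).tgt = some q ∧
    ∀ l, ∃ l', act f (some (p, l)) = some (q, l')

/-- The elements that act on the empty stack on the vertex that is their source and do not change
it. -/
def Pops (f : G.S) : Prop :=
  ∃ p q, (shape f).src = some p ∧ (shape f).tgt = some q ∧ act f (some (p, [])) = some (q, [])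

theorem Pushes.mul {f g : G.S} (hf : Pushes f) (hg : Pushes g)
    (h : (shape f).tgt = (shape g).src) : f * g ≠ 0 ∧ Pushes (f * g) := by
  obtain ⟨p, q, hp, hq, hf⟩ := hf
  obtain ⟨q', r, hq', hr, hg⟩ := hg
  obtain rfl : q = q' := Option.some_injective _ (hq.symm.trans (h.trans hq'))
  have key : ∀ l, ∃ l', act (f * g) (some (p, l)) = some (r, l') := fun l => by
    obtain ⟨l', hl'⟩ := hf l
    obtain ⟨l'', hl''⟩ := hg l'
    exact ⟨l'', by rw [act_mul, hl', hl'']⟩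
  have hne : f * g ≠ 0 := fun h0 => by
    obtain ⟨l', hl'⟩ := key []
    rw [h0, act_zero] at hl'
    exact Option.some_ne_none _ hl'.symm
  refine ⟨hne, p, r, ?_, ?_, key⟩ <;> rw [shape_mul hne] <;> assumption

theorem Pops.mul {f g : G.S} (hf : Pops f) (hg : Pops g)
    (h : (shape f).tgt = (shape g).src) : f * g ≠ 0 ∧ Pops (f * g) := by
  obtain ⟨p, q, hp, hq, hf⟩ := hf
  obtain ⟨q', r, hq', hr, hg⟩ := hg
  obtain rfl : q = q' := Option.some_injective _ (hq.symm.trans (h.trans hq'))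
  have key : act (f * g) (some (p, [])) = some (r, []) := by rw [act_mul, hf, hg]
  have hne : f * g ≠ 0 := fun h0 => by
    rw [h0, act_zero] at key
    exact Option.some_ne_none _ key.symm
  refine ⟨hne, p, r, ?_, ?_, key⟩ <;> rw [shape_mul hne] <;> assumption

theorem pushes_one (p : P) : Pushes (G.one p) := by
  have h : shape (G.one p) = G.genShape (.one p) := shape_gen (one_ne_zero' p)
  refine ⟨p, p, by rw [h]; rfl, by rw [h]; rfl, fun l => ⟨l, ?_⟩⟩
  rw [one, act_gen]
  simp [genAct]

theorem pops_one (p : P) : Pops (G.one p) := by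
  have h : shape (G.one p) = G.genShape (.one p) := shape_gen (one_ne_zero' p)
  refine ⟨p, p, by rw [h]; rfl, by rw [h]; rfl, ?_⟩
  rw [one, act_gen]
  simp [genAct]

theorem Sneg_spec {f : G.S} (hf : f ∈ G.Sneg) :
    Pushes f ∧ (shape f).depth = 0 ∧ 0 < (shape f).height := by
  obtain ⟨h0, hf⟩ := hf
  induction hf using Subsemigroup.closure_induction with
  | mem f hf =>
    obtain ⟨e, rfl⟩ := hf
    rw [Pushes, shape_gen h0]
    refine ⟨⟨G.sm e, G.tm e, rfl, rfl, fun l => ⟨e :: l, ?_⟩⟩, rfl, Int.one_pos⟩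
    rw [act_gen]
    simp [genAct]
  | mul f g _ _ ihf ihg =>
    obtain ⟨hf1, hf2, hf3⟩ := ihf (left_ne_zero h0)
    obtain ⟨hg1, hg2, hg3⟩ := ihg (right_ne_zero h0)
    refine ⟨(hf1.mul hg1 (tgt_eq_src_of_mul_ne_zero h0)).2, ?_⟩
    rw [shape_mul h0, Shape.mul_def]
    simp only
    omega

theorem Spos_spec {f : G.S} (hf : f ∈ G.Spos) :
    Pops f ∧ (shape f).depth = -(shape f).height ∧ (shape f).height < 0 := by
  obtain ⟨h0, hf⟩ := hf
  induction hf using Subsemigroup.closure_induction with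
  | mem f hf =>
    obtain ⟨e, rfl⟩ := hf
    rw [Pops, shape_gen h0]
    refine ⟨⟨G.sp e, G.tp e, rfl, rfl, ?_⟩, rfl, by simp [genShape]⟩
    rw [act_gen]
    simp [genAct]
  | mul f g _ _ ihf ihg =>
    obtain ⟨hf1, hf2, hf3⟩ := ihf (left_ne_zero h0)
    obtain ⟨hg1, hg2, hg3⟩ := ihg (right_ne_zero h0)
    refine ⟨(hf1.mul hg1 (tgt_eq_src_of_mul_ne_zero h0)).2, ?_⟩
    rw [shape_mul h0, Shape.mul_def]
    simp only
    omega

theorem ones_spec {f : G.S} (hf : f ∈ G.ones) :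
    f ≠ 0 ∧ (shape f).depth = 0 ∧ (shape f).height = 0 := by
  obtain ⟨p, rfl⟩ := hf
  have h : shape (G.one p) = G.genShape (.one p) := shape_gen (one_ne_zero' p)
  rw [h]
  exact ⟨one_ne_zero' p, rfl, rfl⟩

/-! ### Normal forms -/

variable (G) in
/-- The subsemigroup generated by `E⁻`. -/
abbrev negClosure : Subsemigroup G.S :=
  Subsemigroup.closure (Set.range fun e : Em => G.gen (.neg e))

variable (G) in
/-- The subsemigroup generated by `E⁺`. -/
abbrev posClosure : Subsemigroup G.S :=
  Subsemigroup.closure (Set.range fun e : Ep => G.gen (.pos e))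

/-- `f` is zero, or an idempotent `1_p`, or the product of a word in `E⁺` and a word in `E⁻`, one
of which may be absent. -/
def IsNormal (f : G.S) : Prop :=
  f = 0 ∨ f ∈ G.ones ∨ f ∈ G.negClosure ∨ f ∈ G.posClosure ∨
    ∃ a ∈ G.posClosure, ∃ b ∈ G.negClosure, f = a * b

theorem IsNormal.one_mul {f : G.S} (p : P) (h : IsNormal f) : IsNormal (G.one p * f) := by
  rcases one_mul_eq_or p f with h' | h'
  · rwa [h']
  · exact Or.inl h'

theorem exists_pos_mul {f : G.S} (h : f ∈ G.posClosure) :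
    ∃ g, f = G.gen (.pos g) ∨ ∃ f' ∈ G.posClosure, f = G.gen (.pos g) * f' := by
  induction h using Subsemigroup.closure_induction with
  | mem f hf =>
    obtain ⟨g, rfl⟩ := hf
    exact ⟨g, Or.inl rfl⟩
  | mul f f' _ hf' ih _ =>
    obtain ⟨g, rfl | ⟨f'', hf'', rfl⟩⟩ := ih
    · exact ⟨g, Or.inr ⟨f', hf', rfl⟩⟩
    · exact ⟨g, Or.inr ⟨f'' * f', mul_mem hf'' hf', mul_assoc _ _ _⟩⟩

theorem isNormal_neg_mul_pos_mul (e : Em) (g : Ep) {f : G.S} (h : IsNormal f) :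
    IsNormal (G.gen (.neg e) * (G.gen (.pos g) * f)) := by
  rw [← mul_assoc]
  by_cases hR : G.R e g
  · rw [neg_mul_pos e g hR]
    exact h.one_mul _
  · rw [neg_mul_pos_of_not e g hR, zero_mul']
    exact Or.inl rfl

theorem isNormal_neg_mul_pos (e : Em) (g : Ep) :
    IsNormal (G.gen (.neg e) * G.gen (.pos g)) := by
  by_cases hR : G.R e g
  · rw [neg_mul_pos e g hR]
    exact Or.inr (Or.inl ⟨_, rfl⟩)
  · rw [neg_mul_pos_of_not e g hR]
    exact Or.inl rfl

theorem IsNormal.gen_mul {f : G.S} (a : Gen P Em Ep) (h : IsNormal f) :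
    IsNormal (G.gen a * f) := by
  rcases a with _ | p | e | g
  · exact Or.inl (zero_mul' f)
  · exact h.one_mul p
  · have he : G.gen (.neg e) ∈ G.negClosure := Subsemigroup.subset_closure ⟨e, rfl⟩
    rcases h with rfl | ⟨q, rfl⟩ | h | h | ⟨a, ha, b, hb, rfl⟩
    · exact Or.inl (mul_zero' _)
    · rcases mul_one_eq_or q (G.gen (.neg e)) with h | h <;> rw [h]
      · exact Or.inr (Or.inr (Or.inl he))
      · exact Or.inl rfl
    · exact Or.inr (Or.inr (Or.inl (mul_mem he h)))
    · obtain ⟨g, rfl | ⟨f', hf', rfl⟩⟩ := exists_pos_mul h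
      · exact isNormal_neg_mul_pos e g
      · exact isNormal_neg_mul_pos_mul e g (Or.inr (Or.inr (Or.inr (Or.inl hf'))))
    · obtain ⟨g, rfl | ⟨f', hf', rfl⟩⟩ := exists_pos_mul ha
      · exact isNormal_neg_mul_pos_mul e g (Or.inr (Or.inr (Or.inl hb)))
      · rw [mul_assoc]
        exact isNormal_neg_mul_pos_mul e g
          (Or.inr (Or.inr (Or.inr (Or.inr ⟨f', hf', b, hb, rfl⟩))))
  · have hg : G.gen (.pos g) ∈ G.posClosure := Subsemigroup.subset_closure ⟨g, rfl⟩
    rcases h with rfl | ⟨q, rfl⟩ | h | h | ⟨a, ha, b, hb, rfl⟩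
    · exact Or.inl (mul_zero' _)
    · rcases mul_one_eq_or q (G.gen (.pos g)) with h | h <;> rw [h]
      · exact Or.inr (Or.inr (Or.inr (Or.inl hg)))
      · exact Or.inl rfl
    · exact Or.inr (Or.inr (Or.inr (Or.inr ⟨_, hg, f, h, rfl⟩)))
    · exact Or.inr (Or.inr (Or.inr (Or.inl (mul_mem hg h))))
    · exact Or.inr (Or.inr (Or.inr (Or.inr ⟨_, mul_mem hg ha, b, hb, (mul_assoc _ _ _).symm⟩)))

theorem isNormal (f : G.S) : IsNormal f := by
  obtain ⟨u, rfl⟩ := G.cls_surjective f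
  induction u using FreeSemigroup.recOnMul with
  | ih1 a =>
    rcases a with _ | p | e | g
    · exact Or.inl rfl
    · exact Or.inr (Or.inl ⟨p, rfl⟩)
    · exact Or.inr (Or.inr (Or.inl (Subsemigroup.subset_closure ⟨e, rfl⟩)))
    · exact Or.inr (Or.inr (Or.inr (Or.inl (Subsemigroup.subset_closure ⟨g, rfl⟩))))
  | ih2 a u _ ih => exact ih.gen_mul a

/-- The non-zero elements are distinguished by depth and height into the idempotents `1_p`, `S⁻`,
`S⁺`, and products of an element of `S⁺` and an element of `S⁻`. -/
theorem classification {f : G.S} (h : f ≠ 0) :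
    f ∈ G.ones ∨ f ∈ G.Sneg ∨ f ∈ G.Spos ∨
      (0 < (shape f).depth ∧ 0 < (shape f).depth + (shape f).height) := by
  rcases isNormal f with h' | h' | h' | h' | ⟨a, ha, b, hb, rfl⟩
  · exact (h h').elim
  · exact Or.inl h'
  · exact Or.inr (Or.inl ⟨h, h'⟩)
  · exact Or.inr (Or.inr (Or.inl ⟨h, h'⟩))
  · obtain ⟨-, ha1, ha2⟩ := Spos_spec (f := a) ⟨left_ne_zero h, ha⟩
    obtain ⟨-, hb1, hb2⟩ := Sneg_spec (f := b) ⟨right_ne_zero h, hb⟩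
    refine Or.inr (Or.inr (Or.inr ?_))
    rw [shape_mul h, Shape.mul_def]
    simp only
    omega

theorem mem_ones_iff {f : G.S} :
    f ∈ G.ones ↔ f ≠ 0 ∧ (shape f).depth ≤ 0 ∧ (shape f).height = 0 := by
  refine ⟨fun h => ⟨(ones_spec h).1, (ones_spec h).2.1.le, (ones_spec h).2.2⟩,
    fun ⟨h0, h1, h2⟩ => ?_⟩
  rcases classification h0 with h | h | h | h
  · exact h
  · have := Sneg_spec h; omega
  · have := Spos_spec h; omega
  · omega

theorem mem_Sneg_iff {f : G.S} :
    f ∈ G.Sneg ↔ f ≠ 0 ∧ (shape f).depth ≤ 0 ∧ 0 < (shape f).height := by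
  refine ⟨fun h => ⟨h.1, (Sneg_spec h).2.1.le, (Sneg_spec h).2.2⟩, fun ⟨h0, h1, h2⟩ => ?_⟩
  rcases classification h0 with h | h | h | h
  · have := ones_spec h; omega
  · exact h
  · have := Spos_spec h; omega
  · omega

theorem mem_Spos_iff {f : G.S} :
    f ∈ G.Spos ↔ f ≠ 0 ∧ (shape f).depth + (shape f).height ≤ 0 ∧ (shape f).height < 0 := by
  refine ⟨fun h => ⟨h.1, by have := (Spos_spec h).2.1; omega, (Spos_spec h).2.2⟩,
    fun ⟨h0, h1, h2⟩ => ?_⟩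
  rcases classification h0 with h | h | h | h
  · have := ones_spec h; omega
  · have := Sneg_spec h; omega
  · exact h
  · omega

theorem mem_ones_iff' {f : G.S} :
    f ∈ G.ones ↔ f ≠ 0 ∧ (shape f).depth + (shape f).height ≤ 0 ∧ (shape f).height = 0 := by
  rw [mem_ones_iff]
  refine and_congr_right fun _ => ⟨fun h => ?_, fun h => ?_⟩ <;> omega

end RGraph

/-! ### Words followed by walks in a subgraph, and reversal -/

section WalkMatrices

open PowerSeries

variable {V E : Type*} {s t : E → V}

theorem genSeries_of_const {α : Type*} [Finite α] (k : ℕ) :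
    genSeries (fun _ : α => k) = (Nat.card α : ℚ⟦X⟧) * X ^ k := by
  ext n
  rw [genSeries, coeff_mk, ← map_natCast (C (R := ℚ)), coeff_C_mul, coeff_X_pow]
  split_ifs with h
  · rw [mul_one, Nat.card_congr (Equiv.subtypeUnivEquiv fun _ => h.symm)]
  · have : IsEmpty {_a : α // k = n} := ⟨fun a => h a.2.symm⟩
    simp

theorem constantCoeff_walkMatrix {A : Set (List E)} (hA : ∀ w ∈ A, w ≠ []) (u v : V) :
    constantCoeff (walkMatrix s t A u v) = 0 := by
  rw [walkMatrix, Matrix.of_apply, ← coeff_zero_eq_constantCoeff_apply, genSeries, coeff_mk]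
  have : IsEmpty {w : WalkIn s t A u v // w.1.length = 0} :=
    ⟨fun w => hA _ w.1.2.1 (List.length_eq_zero_iff.1 w.2)⟩
  rw [Nat.card_of_isEmpty, Nat.cast_zero]

/-- The words of length one with letter in `Λ`. -/
def letterWords (Λ : Set E) : Set (List E) := {w | ∃ a ∈ Λ, w = [a]}

/-- The words with all letters in `Λ`. -/
def wordsOver (Λ : Set E) : Set (List E) := {w | ∀ a ∈ w, a ∈ Λ}

theorem one_sub_walkMatrix_letterWords_mul [Fintype V] [DecidableEq V] [Finite E] (Λ : Set E) :
    (1 - walkMatrix s t (letterWords Λ)) * walkMatrix s t (wordsOver Λ) = 1 := by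
  have hnil : ([] : List E) ∈ wordsOver Λ := fun a ha => by simp at ha
  have h1 : wordsOver Λ = {[]} ∪ (wordsOver Λ \ {[]}) := by
    rw [Set.union_sdiff_self, Set.union_eq_self_of_subset_left (by simpa using hnil)]
  have h2 : walkMatrix s t (wordsOver Λ \ {[]}) =
      walkMatrix s t (letterWords Λ) * walkMatrix s t (wordsOver Λ) := by
    refine walkMatrix_mul ?_ ?_ ?_
    · rintro u v w _ b - - ⟨a, ha, rfl⟩ hb
      refine ⟨fun c hc => ?_, by simp⟩
      rcases List.mem_append.1 hc with hc | hc
      · rw [List.mem_singleton.1 hc]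
        exact ha
      · exact hb c hc
    · rintro u v c - ⟨hc, hne⟩
      obtain ⟨a, w, rfl⟩ := List.exists_cons_of_ne_nil hne
      exact ⟨[a], ⟨a, hc a List.mem_cons_self, rfl⟩, w, fun b hb => hc b (List.mem_cons_of_mem a hb),
        rfl⟩
    · rintro _ ⟨a, -, rfl⟩ b - _ ⟨a', -, rfl⟩ b' - h
      simp only [List.singleton_append, List.cons.injEq] at h
      rw [h.1]
  have h3 : walkMatrix s t (wordsOver Λ) = 1 +
      walkMatrix s t (letterWords Λ) * walkMatrix s t (wordsOver Λ) := by
    rw [← h2, ← walkMatrix_singleton_nil (s := s) (t := t),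
      ← walkMatrix_union Set.disjoint_sdiff_right, ← h1]
  rw [sub_mul, one_mul]
  nth_rewrite 1 [h3]
  rw [add_sub_cancel_right]

/-- If `K` is a set of words of length at least two, to which walks with edges in `Λ` can be
appended unambiguously, then the determinant for the letters in `Λ` together with the words in `K`
is the product of the determinant for the letters and the determinant for the prolonged words. -/
theorem det_one_sub_walkMatrix_union [Fintype V] [DecidableEq V] [Finite E] {Λ : Set E}
    {K C : Set (List E)} (hK : ∀ w ∈ K, 1 < w.length)
    (hmem : ∀ u v w a b, IsWalk s t u a v → IsWalk s t v b w → a ∈ K → b ∈ wordsOver Λ →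
      a ++ b ∈ C)
    (hex : ∀ u v c, IsWalk s t u c v → c ∈ C → ∃ a ∈ K, ∃ b ∈ wordsOver Λ, a ++ b = c)
    (huniq : ∀ a ∈ K, ∀ b ∈ wordsOver Λ, ∀ a' ∈ K, ∀ b' ∈ wordsOver Λ,
      a ++ b = a' ++ b' → a = a') :
    (1 - walkMatrix s t (letterWords Λ ∪ K)).det =
      (1 - walkMatrix s t (letterWords Λ)).det * (1 - walkMatrix s t C).det := by
  have hdisj : Disjoint (letterWords Λ) K := by
    refine Set.disjoint_left.2 ?_
    rintro _ ⟨a, -, rfl⟩ ha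
    exact absurd (hK _ ha) (by simp)
  have h1 := mul_eq_one_comm.1 (one_sub_walkMatrix_letterWords_mul (s := s) (t := t) Λ)
  rw [walkMatrix_union hdisj, walkMatrix_mul hmem hex huniq, mul_comm, ← Matrix.det_mul, sub_mul,
    one_mul, mul_assoc, h1, mul_one, sub_sub]

/-- Counting walks by their vertices and by their edges leads to the same determinant. -/
theorem detOneSub_edgeMatrix [Fintype V] [DecidableEq V] [Finite E] {St : Type*} [Fintype St]
    [DecidableEq St] (f : St → E) (hf : Function.Injective f) :
    detOneSub (Matrix.of fun a b : St => if t (f a) = s (f b) then (1 : ℚ) else 0) =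
      (1 - walkMatrix s t (letterWords (Set.range f))).det := by
  have h1 : (X : ℚ⟦X⟧) • (Matrix.of fun a b : St => if t (f a) = s (f b) then (1 : ℚ) else 0).map
      (C (R := ℚ)) = (Matrix.of fun (a : St) (v : V) => if t (f a) = v then (X : ℚ⟦X⟧) else 0) *
        Matrix.of fun (v : V) (b : St) => if v = s (f b) then (1 : ℚ⟦X⟧) else 0 := by
    ext a b : 1
    simp only [Matrix.smul_apply, Matrix.map_apply, Matrix.of_apply, Matrix.mul_apply, smul_eq_mul]
    simp only [ite_mul, zero_mul, Finset.sum_ite_eq, Finset.mem_univ, if_true]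
    split_ifs <;> simp
  rw [detOneSub, h1, Matrix.det_one_sub_mul_comm]
  congr 2
  ext u v : 1
  rw [Matrix.mul_apply]
  simp only [Matrix.of_apply, ite_mul, one_mul, zero_mul]
  have e : {a : St // u = s (f a) ∧ t (f a) = v} ≃ WalkIn s t (letterWords (Set.range f)) u v := by
    refine Equiv.ofBijective (fun a => ⟨[f a.1], ⟨_, ⟨_, rfl⟩, rfl⟩, a.2.1.symm, a.2.2⟩) ⟨?_, ?_⟩
    · intro a b h
      have h : [f a.1] = [f b.1] := congrArg
        (fun l : WalkIn s t (letterWords (Set.range f)) u v => l.1) h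
      exact Subtype.ext (hf (List.singleton_injective h))
    · rintro ⟨w, ⟨_, ⟨a, rfl⟩, rfl⟩, h1, h2⟩
      exact ⟨⟨a, h1.symm, h2⟩, rfl⟩
  have h2 : walkMatrix s t (letterWords (Set.range f)) u v =
      genSeries fun _ : {a : St // u = s (f a) ∧ t (f a) = v} => 1 := by
    refine (genSeries_congr e fun a => ?_).symm
    obtain ⟨b, -, hb⟩ := (e a).2.1
    rw [hb]
    rfl
  rw [h2, genSeries_of_const, Nat.card_eq_fintype_card, Fintype.card_subtype, pow_one,
    Finset.card_filter]
  push_cast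
  rw [Finset.sum_mul]
  refine Finset.sum_congr rfl fun a _ => ?_
  by_cases h1 : u = s (f a) <;> by_cases h2 : t (f a) = v <;> simp [h1, h2]

theorem isWalk_reverse {u v : V} {w : List E} :
    IsWalk s t u w.reverse v ↔ IsWalk t s v w u := by
  induction w generalizing v with
  | nil => exact eq_comm
  | cons a w ih =>
    rw [List.reverse_cons, isWalk_append]
    simp only [ih, IsWalk]
    constructor
    · rintro ⟨m, h, rfl, rfl⟩
      exact ⟨rfl, h⟩
    · rintro ⟨rfl, h⟩
      exact ⟨_, h, rfl, rfl⟩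

theorem walkMatrix_reverse (A : Set (List E)) :
    walkMatrix t s A = (walkMatrix s t {w | w.reverse ∈ A}).transpose := by
  ext u v : 1
  refine (genSeries_congr (Equiv.ofBijective
    (fun w : WalkIn s t {w | w.reverse ∈ A} v u =>
      (⟨w.1.reverse, w.2.1, isWalk_reverse.2 w.2.2⟩ : WalkIn t s A u v)) ⟨?_, ?_⟩) ?_).symm
  · intro w w' h
    exact Subtype.ext (List.reverse_injective (congrArg (fun l : WalkIn t s A u v => l.1) h))
  · rintro ⟨w, hw, hw'⟩
    refine ⟨⟨w.reverse, ?_, isWalk_reverse.2 hw'⟩, Subtype.ext (List.reverse_reverse w)⟩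
    rw [Set.mem_ofPred_eq, List.reverse_reverse]
    exact hw
  · intro w
    exact List.length_reverse

theorem det_one_sub_walkMatrix_reverse [Fintype V] [DecidableEq V] (A : Set (List E)) :
    (1 - walkMatrix t s A).det = (1 - walkMatrix s t {w | w.reverse ∈ A}).det := by
  rw [walkMatrix_reverse, ← Matrix.det_transpose, Matrix.transpose_sub, Matrix.transpose_transpose,
    Matrix.transpose_one]

theorem wordHeight_reverse (ht : E → ℤ) (w : List E) :
    wordHeight ht w.reverse = wordHeight ht w := by
  rw [wordHeight, List.map_reverse, List.sum_reverse, wordHeight]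

theorem wordHeight_neg (ht : E → ℤ) (w : List E) :
    wordHeight (fun a => -ht a) w = -wordHeight ht w := by
  induction w with
  | nil => rfl
  | cons a w ih =>
    rw [wordHeight_cons, wordHeight_cons, ih]
    ring

theorem zword_reverse {x y : ℤ → E} (h : ∀ i, y i = x (-i)) (i j : ℤ) :
    (zword y i j).reverse = zword x (1 - j) (1 - i) := by
  refine List.ext_getElem ?_ fun n h1 h2 => ?_
  · rw [List.length_reverse, length_zword, length_zword]
    omega
  · rw [List.getElem_reverse, getElem_zword, getElem_zword, h]
    congr 1
    rw [List.length_reverse, length_zword] at h1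
    rw [length_zword]
    omega

end WalkMatrices

/-! ### Labels and heights of words -/

namespace LabelledGraph

open RGraph

variable {P Em Ep V E : Type*} {G : RGraph P Em Ep} (L : LabelledGraph G V E)

theorem isPath_iff {u v : V} {w : List E} : L.IsPath u w v ↔ IsWalk L.src L.tgt u w v := by
  induction w generalizing u with
  | nil => rfl
  | cons a w ih => exact and_congr_right fun _ => ih

theorem label_append (u v : List E) : L.label (u ++ v) = L.label u * L.label v := by
  simp [label]

theorem label_singleton (a : E) : L.label [a] = (L.lab a : WithOne G.S) := by simp [label]

theorem label_cons (a : E) (w : List E) :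
    L.label (a :: w) = (L.lab a : WithOne G.S) * L.label w := by simp [label]

theorem exists_label_eq {w : List E} (hw : w ≠ []) : ∃ f : G.S, L.label w = (f : WithOne G.S) := by
  induction w with
  | nil => exact (hw rfl).elim
  | cons a w ih =>
    rcases eq_or_ne w [] with rfl | h
    · exact ⟨_, L.label_singleton a⟩
    · obtain ⟨f, hf⟩ := ih h
      exact ⟨L.lab a * f, by rw [label_cons, hf, WithOne.coe_mul]⟩

/-- The words with non-zero label. The empty word is one of them. -/
def nonzeroWords : Set (List E) := {w | L.label w ≠ ((0 : G.S) : WithOne G.S)}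

theorem nil_mem_nonzeroWords : [] ∈ L.nonzeroWords := (WithOne.coe_ne_one).symm

theorem factor_mem_nonzeroWords (u v w : List E) (h : u ++ v ++ w ∈ L.nonzeroWords) :
    v ∈ L.nonzeroWords := by
  intro h0
  refine h ?_
  have h1 : ∀ z : WithOne G.S, z * ((0 : G.S) : WithOne G.S) = ((0 : G.S) : WithOne G.S) := by
    intro z
    cases z with
    | one => rw [one_mul]
    | coe z => rw [← WithOne.coe_mul, mul_zero']
  have h2 : ∀ z : WithOne G.S, ((0 : G.S) : WithOne G.S) * z = ((0 : G.S) : WithOne G.S) := by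
    intro z
    cases z with
    | one => rw [mul_one]
    | coe z => rw [← WithOne.coe_mul, zero_mul']
  rw [label_append, label_append, h0, h1, h2]

theorem label_induction {motive : List E → G.S → Prop}
    (single : ∀ a, L.lab a ≠ 0 → motive [a] (L.lab a))
    (cons : ∀ a w (f : G.S), w ≠ [] → L.label w = (f : WithOne G.S) → L.lab a * f ≠ 0 → motive w f →
      motive (a :: w) (L.lab a * f)) :
    ∀ w (f : G.S), w ≠ [] → L.label w = (f : WithOne G.S) → f ≠ 0 → motive w f := by
  intro w
  induction w with
  | nil => exact fun f h => (h rfl).elim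
  | cons a w ih =>
    intro f _ hf h0
    rcases eq_or_ne w [] with rfl | h
    · rw [label_singleton, WithOne.coe_inj] at hf
      subst hf
      exact single a h0
    · obtain ⟨g, hg⟩ := L.exists_label_eq h
      rw [label_cons, hg, ← WithOne.coe_mul, WithOne.coe_inj] at hf
      subst hf
      exact cons a w g h hg h0 (ih g h hg (right_ne_zero h0))

/-- The height of an edge is the height of its label. -/
noncomputable def ht (a : E) : ℤ := (shape (L.lab a)).height

variable {L}

theorem depth_lab (hL : L.IsPresentation) (a : E) :
    (shape (L.lab a)).depth = max 0 (-L.ht a) := by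
  rw [ht]
  rcases hL.g1 a with (h | h) | h
  · have := Sneg_spec h; omega
  · have := ones_spec h; omega
  · have := Spos_spec h; omega

theorem height_label {w : List E} {f : G.S} (hw : w ≠ []) (hf : L.label w = (f : WithOne G.S))
    (h0 : f ≠ 0) : (shape f).height = wordHeight L.ht w := by
  refine L.label_induction (motive := fun w f => (shape f).height = wordHeight L.ht w) ?_ ?_
    w f hw hf h0
  · intro a _
    simp [ht]
  · intro a w f _ _ h0 ih
    rw [shape_mul h0, Shape.mul_def, wordHeight_cons, ← ih, ht]

theorem depth_label_le_iff (hL : L.IsPresentation) {w : List E} {f : G.S} (hw : w ≠ [])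
    (hf : L.label w = (f : WithOne G.S)) (h0 : f ≠ 0) :
    (shape f).depth ≤ 0 ↔ ∀ J, 0 ≤ wordHeight L.ht (w.take J) := by
  have key := L.label_induction (motive := fun w f => ∀ c, 0 ≤ c →
    ((shape f).depth ≤ c ↔ ∀ J, -c ≤ wordHeight L.ht (w.take J))) ?_ ?_ w f hw hf h0 0 le_rfl
  · simpa using key
  · intro a _ c hc
    rw [depth_lab hL]
    refine ⟨fun h J => ?_, fun h => ?_⟩
    · rcases J with _ | J
      · simp; omega
      · simp; omega
    · have := h 1
      simp at this
      omega
  · intro a w f _ _ h0 ih c hc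
    rw [shape_mul h0, Shape.mul_def]
    simp only
    rw [depth_lab hL, ← ht]
    refine ⟨fun h J => ?_, fun h => ?_⟩
    · rcases J with _ | J
      · simp; omega
      · have := (ih (c + L.ht a) (by omega)).1 (by omega) J
        rw [List.take_succ_cons, wordHeight_cons]
        omega
    · have h1 := h 1
      simp at h1
      have := (ih (c + L.ht a) (by omega)).2 fun J => by
        have := h (J + 1)
        rw [List.take_succ_cons, wordHeight_cons] at this
        omega
      omega

theorem depth_add_height_label_le_iff (hL : L.IsPresentation) {w : List E} {f : G.S} (hw : w ≠ [])
    (hf : L.label w = (f : WithOne G.S)) (h0 : f ≠ 0) :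
    (shape f).depth + (shape f).height ≤ 0 ↔ ∀ J, wordHeight L.ht (w.drop J) ≤ 0 := by
  refine L.label_induction (motive := fun w f => (shape f).depth + (shape f).height ≤ 0 ↔
    ∀ J, wordHeight L.ht (w.drop J) ≤ 0) ?_ ?_ w f hw hf h0
  · intro a _
    rw [depth_lab hL, ← ht]
    refine ⟨fun h J => ?_, fun h => ?_⟩
    · rcases J with _ | J
      · simp; omega
      · simp
    · have := h 0
      simp at this
      omega
  · intro a w f hw hf h0 ih
    rw [shape_mul h0, Shape.mul_def]
    simp only
    have hh := height_label hw hf (right_ne_zero h0)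
    rw [depth_lab hL, ← ht]
    refine ⟨fun h J => ?_, fun h => ?_⟩
    · rcases J with _ | J
      · rw [List.drop_zero, wordHeight_cons, ← hh]
        omega
      · rw [List.drop_succ_cons]
        exact ih.1 (by omega) J
    · have h1 := h 0
      have h2 := h 1
      rw [List.drop_zero, wordHeight_cons, ← hh] at h1
      rw [List.drop_succ_cons, List.drop_zero, ← hh] at h2
      have := ih.2 fun J => h (J + 1)
      omega

theorem labelIn_iff {w : List E} (hw : w ≠ []) {T : Set G.S} {p : G.S → Prop}
    (hT : ∀ f, f ∈ T ↔ f ≠ 0 ∧ p f) {q : Prop}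
    (hq : ∀ f : G.S, L.label w = (f : WithOne G.S) → f ≠ 0 → (p f ↔ q)) :
    L.LabelIn w T ↔ w ∈ L.nonzeroWords ∧ q := by
  constructor
  · rintro ⟨f, hf, hf'⟩
    obtain ⟨h0, h⟩ := (hT f).1 hf
    refine ⟨?_, (hq f hf' h0).1 h⟩
    rw [nonzeroWords, Set.mem_ofPred_eq, hf']
    exact fun h => h0 (WithOne.coe_inj.1 h)
  · rintro ⟨hne, h⟩
    obtain ⟨f, hf⟩ := L.exists_label_eq hw
    have h0 : f ≠ 0 := by
      rintro rfl
      exact hne hf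
    exact ⟨f, (hT f).2 ⟨h0, (hq f hf h0).2 h⟩, hf⟩

theorem labelIn_ones_iff (hL : L.IsPresentation) {w : List E} (hw : w ≠ []) :
    L.LabelIn w G.ones ↔ w ∈ L.nonzeroWords ∧ (∀ J, 0 ≤ wordHeight L.ht (w.take J)) ∧
      wordHeight L.ht w = 0 :=
  labelIn_iff hw (fun _ => mem_ones_iff) fun _ hf h0 =>
    and_congr (depth_label_le_iff hL hw hf h0) (by rw [height_label hw hf h0])

theorem labelIn_ones_iff' (hL : L.IsPresentation) {w : List E} (hw : w ≠ []) :
    L.LabelIn w G.ones ↔ w ∈ L.nonzeroWords ∧ (∀ J, wordHeight L.ht (w.drop J) ≤ 0) ∧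
      wordHeight L.ht w = 0 :=
  labelIn_iff hw (fun _ => mem_ones_iff') fun _ hf h0 =>
    and_congr (depth_add_height_label_le_iff hL hw hf h0) (by rw [height_label hw hf h0])

theorem labelIn_Sneg_iff (hL : L.IsPresentation) {w : List E} (hw : w ≠ []) :
    L.LabelIn w G.Sneg ↔ w ∈ L.nonzeroWords ∧ (∀ J, 0 ≤ wordHeight L.ht (w.take J)) ∧
      0 < wordHeight L.ht w :=
  labelIn_iff hw (fun _ => mem_Sneg_iff) fun _ hf h0 =>
    and_congr (depth_label_le_iff hL hw hf h0) (by rw [height_label hw hf h0])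

theorem labelIn_Spos_iff (hL : L.IsPresentation) {w : List E} (hw : w ≠ []) :
    L.LabelIn w G.Spos ↔ w ∈ L.nonzeroWords ∧ (∀ J, wordHeight L.ht (w.drop J) ≤ 0) ∧
      wordHeight L.ht w < 0 :=
  labelIn_iff hw (fun _ => mem_Spos_iff) fun _ hf h0 =>
    and_congr (depth_add_height_label_le_iff hL hw hf h0) (by rw [height_label hw hf h0])

theorem labelIn_union {w : List E} {T T' : Set G.S} :
    L.LabelIn w (T ∪ T') ↔ L.LabelIn w T ∨ L.LabelIn w T' := by
  simp only [LabelIn, Set.mem_union, or_and_right, exists_or]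

theorem labelIn_Sneg_union_ones_iff (hL : L.IsPresentation) {w : List E} (hw : w ≠ []) :
    L.LabelIn w (G.Sneg ∪ G.ones) ↔ w ∈ L.nonzeroWords ∧
      ∀ J, 0 ≤ wordHeight L.ht (w.take J) := by
  rw [labelIn_union, labelIn_Sneg_iff hL hw, labelIn_ones_iff hL hw]
  refine ⟨fun h => h.elim (fun h => ⟨h.1, h.2.1⟩) fun h => ⟨h.1, h.2.1⟩, fun h => ?_⟩
  have := h.2 w.length
  rw [List.take_length] at this
  rcases this.lt_or_eq with h' | h'
  · exact Or.inl ⟨h.1, h.2, h'⟩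
  · exact Or.inr ⟨h.1, h.2, h'.symm⟩

theorem labelIn_ones_union_Spos_iff (hL : L.IsPresentation) {w : List E} (hw : w ≠ []) :
    L.LabelIn w (G.ones ∪ G.Spos) ↔ w ∈ L.nonzeroWords ∧
      ∀ J, wordHeight L.ht (w.drop J) ≤ 0 := by
  rw [labelIn_union, labelIn_Spos_iff hL hw, labelIn_ones_iff' hL hw]
  refine ⟨fun h => h.elim (fun h => ⟨h.1, h.2.1⟩) fun h => ⟨h.1, h.2.1⟩, fun h => ?_⟩
  have := h.2 0
  rw [List.drop_zero] at this
  rcases this.lt_or_eq with h' | h'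
  · exact Or.inr ⟨h.1, h.2, h'⟩
  · exact Or.inl ⟨h.1, h.2, h'⟩

theorem lab_mem_Sneg_union_ones_iff (hL : L.IsPresentation) (a : E) :
    L.lab a ∈ G.Sneg ∪ G.ones ↔ 0 ≤ L.ht a := by
  rw [ht]
  refine ⟨fun h => ?_, fun h => (hL.g1 a).resolve_right fun h' => ?_⟩
  · rcases h with h | h
    · exact (Sneg_spec h).2.2.le
    · exact (ones_spec h).2.2.ge
  · have := Spos_spec h'; omega

theorem lab_mem_ones_union_Spos_iff (hL : L.IsPresentation) (a : E) :
    L.lab a ∈ G.ones ∪ G.Spos ↔ L.ht a ≤ 0 := by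
  rw [ht]
  refine ⟨fun h => ?_, fun h => ?_⟩
  · rcases h with h | h
    · exact (ones_spec h).2.2.le
    · exact (Spos_spec h).2.2.le
  · rcases hL.g1 a with (h' | h') | h'
    · have := Sneg_spec h'; omega
    · exact Or.inl h'
    · exact Or.inr h'

theorem lab_ne_zero (hL : L.IsPresentation) (a : E) : L.lab a ≠ 0 := by
  rcases hL.g1 a with (h | h) | h
  · exact h.1
  · exact (ones_spec h).1
  · exact h.1

theorem singleton_mem_nonzeroWords (hL : L.IsPresentation) (a : E) : [a] ∈ L.nonzeroWords := by
  rw [nonzeroWords, Set.mem_ofPred_eq, label_singleton]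
  exact fun h => lab_ne_zero hL a (WithOne.coe_inj.1 h)

/-- The vertex `p` of the `R`-graph with `U ∈ L.vertexSet p`. -/
noncomputable def vertex (hL : L.IsPresentation) (U : V) : P := (hL.g3 U).choose

theorem mem_vertexSet_vertex (hL : L.IsPresentation) (U : V) : U ∈ L.vertexSet (vertex hL U) :=
  (hL.g3 U).choose_spec.1

theorem shape_lab (hL : L.IsPresentation) (a : E) :
    (shape (L.lab a)).src = some (vertex hL (L.src a)) ∧
      (shape (L.lab a)).tgt = some (vertex hL (L.tgt a)) := by
  have h1 := hL.g4_leave _ a (mem_vertexSet_vertex hL _)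
  have h2 := hL.g4_enter _ a (mem_vertexSet_vertex hL _)
  have h3 := tgt_eq_src_of_mul_ne_zero h1
  have h4 := tgt_eq_src_of_mul_ne_zero h2
  rw [← h3, h4]
  have h5 : ∀ p, shape (G.one p) = G.genShape (.one p) := fun p => shape_gen (one_ne_zero' p)
  rw [h5, h5]
  exact ⟨rfl, rfl⟩

theorem shape_label_of_isWalk (hL : L.IsPresentation) {w : List E} {f : G.S} (hw : w ≠ [])
    (hf : L.label w = (f : WithOne G.S)) (h0 : f ≠ 0) {U W : V}
    (h : IsWalk L.src L.tgt U w W) :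
    (shape f).src = some (vertex hL U) ∧ (shape f).tgt = some (vertex hL W) := by
  refine L.label_induction (motive := fun w f => ∀ U, IsWalk L.src L.tgt U w W →
    (shape f).src = some (vertex hL U) ∧ (shape f).tgt = some (vertex hL W)) ?_ ?_ w f hw hf h0 U h
  · rintro a _ U ⟨rfl, h⟩
    obtain rfl : L.tgt a = W := h
    exact shape_lab hL a
  · rintro a w f _ _ h0 ih U ⟨rfl, h⟩
    rw [shape_mul h0]
    exact ⟨(shape_lab hL a).1, (ih _ h).2⟩

/-- If all elements of `T` have a property `p` for which products of elements with matching target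
and source are not zero, then words with labels in `T` that form a walk have a non-zero product. -/
theorem append_mem_nonzeroWords (hL : L.IsPresentation) {T : Set G.S} {p : G.S → Prop}
    (hT : ∀ f ∈ T, f ≠ 0 ∧ p f)
    (hp : ∀ f g, p f → p g → (shape f).tgt = (shape g).src → f * g ≠ 0) {U W Y : V}
    {u v : List E} (hu : IsWalk L.src L.tgt U u W) (hv : IsWalk L.src L.tgt W v Y)
    (hu0 : u ≠ []) (hv0 : v ≠ []) (hu' : L.LabelIn u T) (hv' : L.LabelIn v T) :
    u ++ v ∈ L.nonzeroWords := by
  obtain ⟨f, hf, hfu⟩ := hu'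
  obtain ⟨g, hg, hgv⟩ := hv'
  obtain ⟨hf0, hf⟩ := hT f hf
  obtain ⟨hg0, hg⟩ := hT g hg
  have h := hp f g hf hg ((shape_label_of_isWalk hL hu0 hfu hf0 hu).2.trans
    (shape_label_of_isWalk hL hv0 hgv hg0 hv).1.symm)
  rw [nonzeroWords, Set.mem_ofPred_eq, label_append, hfu, hgv, ← WithOne.coe_mul]
  exact fun h' => h (WithOne.coe_inj.1 h')

theorem append_mem_nonzeroWords_of_take (hL : L.IsPresentation) {U W Y : V} {u v : List E}
    (hu : IsWalk L.src L.tgt U u W) (hv : IsWalk L.src L.tgt W v Y)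
    (hu' : u ∈ L.nonzeroWords) (hv' : v ∈ L.nonzeroWords)
    (hut : ∀ J, 0 ≤ wordHeight L.ht (u.take J)) (hvt : ∀ J, 0 ≤ wordHeight L.ht (v.take J)) :
    u ++ v ∈ L.nonzeroWords := by
  rcases eq_or_ne u [] with rfl | hu0
  · exact hv'
  rcases eq_or_ne v [] with rfl | hv0
  · rwa [List.append_nil]
  refine append_mem_nonzeroWords hL (T := G.Sneg ∪ G.ones) (p := Pushes) ?_
    (fun f g hf hg h => (hf.mul hg h).1) hu hv hu0 hv0
    ((labelIn_Sneg_union_ones_iff hL hu0).2 ⟨hu', hut⟩)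
    ((labelIn_Sneg_union_ones_iff hL hv0).2 ⟨hv', hvt⟩)
  rintro f (h | ⟨p, rfl⟩)
  · exact ⟨h.1, (Sneg_spec h).1⟩
  · exact ⟨one_ne_zero' p, pushes_one p⟩

theorem append_mem_nonzeroWords_of_drop (hL : L.IsPresentation) {U W Y : V} {u v : List E}
    (hu : IsWalk L.src L.tgt U u W) (hv : IsWalk L.src L.tgt W v Y)
    (hu' : u ∈ L.nonzeroWords) (hv' : v ∈ L.nonzeroWords)
    (hut : ∀ J, wordHeight L.ht (u.drop J) ≤ 0) (hvt : ∀ J, wordHeight L.ht (v.drop J) ≤ 0) :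
    u ++ v ∈ L.nonzeroWords := by
  rcases eq_or_ne u [] with rfl | hu0
  · exact hv'
  rcases eq_or_ne v [] with rfl | hv0
  · rwa [List.append_nil]
  refine append_mem_nonzeroWords hL (T := G.ones ∪ G.Spos) (p := Pops) ?_
    (fun f g hf hg h => (hf.mul hg h).1) hu hv hu0 hv0
    ((labelIn_ones_union_Spos_iff hL hu0).2 ⟨hu', hut⟩)
    ((labelIn_ones_union_Spos_iff hL hv0).2 ⟨hv', hvt⟩)
  rintro f (⟨p, rfl⟩ | h)
  · exact ⟨one_ne_zero' p, pops_one p⟩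
  · exact ⟨h.1, (Spos_spec h).1⟩

/-- The height system of a presentation. -/
noncomputable def negSystem (hL : L.IsPresentation) : HeightSystem V E where
  src := L.src
  tgt := L.tgt
  ht := L.ht
  good := L.nonzeroWords
  nil_mem := L.nil_mem_nonzeroWords
  factor_mem := L.factor_mem_nonzeroWords
  append_mem _ _ _ _ _ hu hv hu' hv' hut hvt :=
    append_mem_nonzeroWords_of_take hL hu hv hu' hv' hut hvt

/-- The height system of a presentation with the direction of time reversed: words are read
backwards, and heights change their sign. -/
noncomputable def posSystem (hL : L.IsPresentation) : HeightSystem V E where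
  src := L.tgt
  tgt := L.src
  ht a := -L.ht a
  good := {w | w.reverse ∈ L.nonzeroWords}
  nil_mem := L.nil_mem_nonzeroWords
  factor_mem u v w h := by
    refine L.factor_mem_nonzeroWords w.reverse v.reverse u.reverse ?_
    simpa using h
  append_mem p q r u v hu hv hu' hv' hut hvt := by
    have key : ∀ {w : List E}, (∀ J, 0 ≤ wordHeight (fun a => -L.ht a) (w.take J)) →
        ∀ J, wordHeight L.ht (w.reverse.drop J) ≤ 0 := by
      intro w h J
      rw [List.drop_reverse, wordHeight_reverse]
      have := h (w.length - J)
      rw [wordHeight_neg] at this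
      omega
    rw [Set.mem_ofPred_eq, List.reverse_append]
    exact append_mem_nonzeroWords_of_drop hL (isWalk_reverse.2 hv) (isWalk_reverse.2 hu) hv' hu'
      (key hvt) (key hut)

end LabelledGraph

/-! ### The codes in terms of heights -/

namespace LabelledGraph

open RGraph

variable {P Em Ep V E : Type*} {G : RGraph P Em Ep} {L : LabelledGraph G V E}

theorem admissible_iff {w : List E} : L.Admissible w ↔
    w ≠ [] ∧ (∃ U W, IsWalk L.src L.tgt U w W) ∧ w ∈ L.nonzeroWords := by
  simp only [Admissible, isPath_iff]
  rfl

theorem take_mem_nonzeroWords {w : List E} (h : w ∈ L.nonzeroWords) (J : ℕ) :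
    w.take J ∈ L.nonzeroWords :=
  L.factor_mem_nonzeroWords [] _ (w.drop J) (by rwa [List.nil_append, List.take_append_drop])

theorem drop_mem_nonzeroWords {w : List E} (h : w ∈ L.nonzeroWords) (J : ℕ) :
    w.drop J ∈ L.nonzeroWords :=
  L.factor_mem_nonzeroWords (w.take J) _ [] (by rwa [List.append_nil, List.take_append_drop])

theorem take_ne_nil {w : List E} {J : ℕ} (h1 : 1 ≤ J) (h2 : J < w.length) : w.take J ≠ [] := by
  rw [← List.length_pos_iff, List.length_take]
  omega

theorem drop_ne_nil {w : List E} {J : ℕ} (h2 : J < w.length) : w.drop J ≠ [] := by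
  rw [← List.length_pos_iff, List.length_drop]
  omega

theorem mem_coreNeg_iff (hL : L.IsPresentation) {w : List E} :
    w ∈ L.coreNeg ↔ (∃ U W, IsWalk L.src L.tgt U w W) ∧ 1 < w.length ∧ w ∈ L.nonzeroWords ∧
      0 ≤ wordHeight L.ht w ∧ ∀ J, 1 ≤ J → J < w.length → wordHeight L.ht (w.drop J) < 0 := by
  constructor
  · rintro ⟨h1, h2, h3, h4⟩
    rw [admissible_iff] at h1
    refine ⟨h1.2.1, h2, h1.2.2, ?_, fun J hJ hJ' => ?_⟩
    · have := ((labelIn_Sneg_union_ones_iff hL h1.1).1 h3).2 w.length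
      rwa [List.take_length] at this
    · exact ((labelIn_Spos_iff hL (drop_ne_nil hJ')).1 (h4 J hJ hJ')).2.2
  · rintro ⟨h1, h2, h3, h4, h5⟩
    have hne : w ≠ [] := by
      rintro rfl
      simp at h2
    refine ⟨admissible_iff.2 ⟨hne, h1, h3⟩, h2,
      (labelIn_Sneg_union_ones_iff hL hne).2 ⟨h3, fun J => ?_⟩, fun J hJ hJ' =>
      (labelIn_Spos_iff hL (drop_ne_nil hJ')).2 ⟨drop_mem_nonzeroWords h3 J, fun J' => ?_,
        h5 J hJ hJ'⟩⟩
    · have hs := wordHeight_take_add_drop L.ht w J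
      rcases Nat.eq_zero_or_pos J with rfl | hJ
      · simp
      rcases le_or_gt w.length J with hJ' | hJ'
      · rwa [List.take_of_length_le hJ']
      · have := h5 J hJ hJ'
        omega
    · rw [List.drop_drop]
      rcases le_or_gt w.length (J + J') with hJ2 | hJ2
      · rw [List.drop_of_length_le hJ2, wordHeight_nil]
      · exact (h5 _ (by omega) hJ2).le

theorem mem_corePos_iff (hL : L.IsPresentation) {w : List E} :
    w ∈ L.corePos ↔ (∃ U W, IsWalk L.src L.tgt U w W) ∧ 1 < w.length ∧ w ∈ L.nonzeroWords ∧
      wordHeight L.ht w ≤ 0 ∧ ∀ J, 1 ≤ J → J < w.length → 0 < wordHeight L.ht (w.take J) := by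
  constructor
  · rintro ⟨h1, h2, h3, h4⟩
    rw [admissible_iff] at h1
    refine ⟨h1.2.1, h2, h1.2.2, ?_, fun J hJ hJ' => ?_⟩
    · exact ((labelIn_ones_union_Spos_iff hL h1.1).1 h3).2 0
    · exact ((labelIn_Sneg_iff hL (take_ne_nil hJ hJ')).1 (h4 J hJ hJ')).2.2
  · rintro ⟨h1, h2, h3, h4, h5⟩
    have hne : w ≠ [] := by
      rintro rfl
      simp at h2
    refine ⟨admissible_iff.2 ⟨hne, h1, h3⟩, h2,
      (labelIn_ones_union_Spos_iff hL hne).2 ⟨h3, fun J => ?_⟩, fun J hJ hJ' =>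
      (labelIn_Sneg_iff hL (take_ne_nil hJ hJ')).2 ⟨take_mem_nonzeroWords h3 J, fun J' => ?_,
        h5 J hJ hJ'⟩⟩
    · have hs := wordHeight_take_add_drop L.ht w J
      rcases Nat.eq_zero_or_pos J with rfl | hJ
      · simpa using h4
      rcases le_or_gt w.length J with hJ' | hJ'
      · rw [List.drop_of_length_le hJ', wordHeight_nil]
      · have := h5 J hJ hJ'
        omega
    · rw [List.take_take]
      rcases Nat.eq_zero_or_pos J' with rfl | hJ2
      · simp
      · exact (h5 _ (by omega) (by omega)).le

theorem mem_words0_iff (hL : L.IsPresentation) {w : List E} :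
    w ∈ L.words0 ↔ (∃ U W, IsWalk L.src L.tgt U w W) ∧ w ≠ [] ∧ w ∈ L.nonzeroWords ∧
      wordHeight L.ht w = 0 ∧ ∀ J, 1 ≤ J → J < w.length → 0 < wordHeight L.ht (w.take J) := by
  constructor
  · rintro ⟨h1, h2, h3⟩
    rw [admissible_iff] at h1
    obtain ⟨h4, h5, h6⟩ := (labelIn_ones_iff hL h1.1).1 h2
    refine ⟨h1.2.1, h1.1, h4, h6, fun J hJ hJ' => ?_⟩
    refine (h5 J).lt_of_ne fun h0 => h3 J hJ hJ' ?_
    refine (labelIn_ones_iff hL (take_ne_nil hJ hJ')).2 ⟨take_mem_nonzeroWords h4 J, fun J' => ?_,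
      h0.symm⟩
    rw [List.take_take]
    exact h5 _
  · rintro ⟨h1, h2, h3, h4, h5⟩
    refine ⟨admissible_iff.2 ⟨h2, h1, h3⟩, (labelIn_ones_iff hL h2).2 ⟨h3, fun J => ?_, h4⟩,
      fun J hJ hJ' h => ?_⟩
    · rcases Nat.eq_zero_or_pos J with rfl | hJ
      · simp
      rcases le_or_gt w.length J with hJ' | hJ'
      · rw [List.take_of_length_le hJ', h4]
      · exact (h5 J hJ hJ').le
    · have := ((labelIn_ones_iff hL (take_ne_nil hJ hJ')).1 h).2.2
      have := h5 J hJ hJ'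
      omega

theorem mem_negWords_union_nil_iff (hL : L.IsPresentation) {w : List E} :
    (w = [] ∨ w ∈ L.negWords) ↔ (w = [] ∨ ∃ U W, IsWalk L.src L.tgt U w W) ∧
      w ∈ wordsOver {a | 0 ≤ L.ht a} := by
  have h : (∀ a ∈ w, L.lab a ∈ G.Sneg ∪ G.ones) ↔ w ∈ wordsOver {a | 0 ≤ L.ht a} :=
    forall₂_congr fun a _ => lab_mem_Sneg_union_ones_iff hL a
  rw [← h]
  rcases eq_or_ne w [] with rfl | hw
  · simp
  · simp [hw, negWords, isPath_iff]

theorem mem_posWords_union_nil_iff (hL : L.IsPresentation) {w : List E} :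
    (w = [] ∨ w ∈ L.posWords) ↔ (w = [] ∨ ∃ U W, IsWalk L.src L.tgt U w W) ∧
      w ∈ wordsOver {a | L.ht a ≤ 0} := by
  have h : (∀ a ∈ w, L.lab a ∈ G.ones ∪ G.Spos) ↔ w ∈ wordsOver {a | L.ht a ≤ 0} :=
    forall₂_congr fun a _ => lab_mem_ones_union_Spos_iff hL a
  rw [← h]
  rcases eq_or_ne w [] with rfl | hw
  · simp
  · simp [hw, posWords, isPath_iff]

theorem prolonged_iff {K N : Set (List E)} {Λ : Set E}
    (hwalk : ∀ c ∈ K, ∃ U W, IsWalk L.src L.tgt U c W)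
    (hN : ∀ w, (w = [] ∨ w ∈ N) ↔ (w = [] ∨ ∃ U W, IsWalk L.src L.tgt U w W) ∧ w ∈ wordsOver Λ)
    {w : List E} :
    w ∈ K ∪ {w | (∃ U W, L.IsPath U w W) ∧ ∃ c ∈ K, ∃ d ∈ N, w = c ++ d} ↔
      (∃ U W, IsWalk L.src L.tgt U w W) ∧ ∃ c ∈ K, ∃ d ∈ wordsOver Λ, c ++ d = w := by
  simp only [isPath_iff]
  constructor
  · rintro (hw | ⟨hw, c, hc, d, hd, rfl⟩)
    · exact ⟨hwalk w hw, w, hw, [], ((hN []).1 (Or.inl rfl)).2, List.append_nil w⟩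
    · exact ⟨hw, c, hc, d, ((hN d).1 (Or.inr hd)).2, rfl⟩
  · rintro ⟨hw, c, hc, d, hd, rfl⟩
    have hd' : d = [] ∨ ∃ U W, IsWalk L.src L.tgt U d W := by
      obtain ⟨U, W, hw⟩ := hw
      obtain ⟨M, -, hM⟩ := isWalk_append.1 hw
      exact Or.inr ⟨M, W, hM⟩
    rcases (hN d).2 ⟨hd', hd⟩ with rfl | hd
    · rw [List.append_nil]
      exact Or.inl hc
    · exact Or.inr ⟨hw, c, hc, d, hd, rfl⟩

theorem mem_wordsNeg_iff (hL : L.IsPresentation) {w : List E} :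
    w ∈ L.wordsNeg ↔ (∃ U W, IsWalk L.src L.tgt U w W) ∧
      ∃ c ∈ L.coreNeg, ∃ d ∈ wordsOver {a | 0 ≤ L.ht a}, c ++ d = w :=
  prolonged_iff (fun _ hc => (admissible_iff.1 hc.1).2.1)
    fun _ => mem_negWords_union_nil_iff hL

theorem mem_wordsPos_iff (hL : L.IsPresentation) {w : List E} :
    w ∈ L.wordsPos ↔ (∃ U W, IsWalk L.src L.tgt U w W) ∧
      ∃ c ∈ L.corePos, ∃ d ∈ wordsOver {a | L.ht a ≤ 0}, c ++ d = w :=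
  prolonged_iff (fun _ hc => (admissible_iff.1 hc.1).2.1)
    fun _ => mem_posWords_union_nil_iff hL

end LabelledGraph

/-! ### Circularity -/

section IntegerSequences

theorem sub_le_sub_of_lt_succ {I : ℤ → ℤ} (hI : ∀ k, I k < I (k + 1)) {k l : ℤ} (h : k ≤ l) :
    l - k ≤ I l - I k := by
  induction l, h using Int.leInduction with
  | base => simp
  | succ l _ ih =>
    have := hI l
    omega

theorem exists_mem_block {I : ℤ → ℤ} (hI : ∀ k, I k < I (k + 1)) (m : ℤ) :
    ∃ k, I k ≤ m ∧ m < I (k + 1) := by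
  have hbdd : ∀ k, I k ≤ m → k ≤ max 0 (m - I 0) := by
    intro k hk
    rcases le_or_gt 0 k with h | h
    · have := sub_le_sub_of_lt_succ hI h
      omega
    · omega
  have hex : I (min 0 (m - I 0)) ≤ m := by
    have := sub_le_sub_of_lt_succ hI (min_le_left 0 (m - I 0))
    omega
  obtain ⟨k, hk, hmax⟩ := Int.exists_greatest_of_bdd (P := fun k => I k ≤ m) ⟨_, hbdd⟩ ⟨_, hex⟩
  refine ⟨k, hk, ?_⟩
  by_contra h
  have := hmax (k + 1) (by omega)
  omega

/-- An increasing sequence with `I 0 ≤ 0 < I 1` is determined by its set of values. -/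
theorem eq_of_lt_succ_of_values {I J : ℤ → ℤ} (hI : ∀ k, I k < I (k + 1))
    (hJ : ∀ k, J k < J (k + 1)) (hI0 : I 0 ≤ 0) (hI1 : 0 < I 1) (hJ0 : J 0 ≤ 0) (hJ1 : 0 < J 1)
    (hIJ : ∀ k, ∃ l, J l = I k) (hJI : ∀ k, ∃ l, I l = J k) : I = J := by
  have hlt : ∀ {I : ℤ → ℤ}, (∀ k, I k < I (k + 1)) → ∀ {k l}, I k < I l → k < l := by
    intro I hI k l h
    by_contra hle
    have := sub_le_sub_of_lt_succ hI (show l ≤ k by omega)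
    omega
  have hmono : ∀ {I : ℤ → ℤ}, (∀ k, I k < I (k + 1)) → ∀ {k l}, k ≤ l → I k ≤ I l := by
    intro I hI k l h
    have := sub_le_sub_of_lt_succ hI h
    omega
  have hzero : ∀ {I J : ℤ → ℤ}, (∀ k, I k < I (k + 1)) → (∀ k, J k < J (k + 1)) → I 0 ≤ 0 →
      0 < J 1 → (∀ k, ∃ l, J l = I k) → I 0 ≤ J 0 := by
    intro I J _ hJ hI0 hJ1 hIJ
    obtain ⟨l, hl⟩ := hIJ 0
    have := hlt hJ (show J l < J 1 by omega)
    have := hmono hJ (show l ≤ 0 by omega)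
    omega
  have hsucc : ∀ {I J : ℤ → ℤ}, (∀ k, I k < I (k + 1)) → (∀ k, J k < J (k + 1)) →
      (∀ k, ∃ l, J l = I k) → ∀ k, I k = J k → J (k + 1) ≤ I (k + 1) := by
    intro I J hI hJ hIJ k hk
    obtain ⟨l, hl⟩ := hIJ (k + 1)
    have := hI k
    have := hlt hJ (show J k < J l by omega)
    have := hmono hJ (show k + 1 ≤ l by omega)
    omega
  have hpred : ∀ {I J : ℤ → ℤ}, (∀ k, I k < I (k + 1)) → (∀ k, J k < J (k + 1)) →
      (∀ k, ∃ l, J l = I k) → ∀ k, I k = J k → I (k - 1) ≤ J (k - 1) := by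
    intro I J hI hJ hIJ k hk
    obtain ⟨l, hl⟩ := hIJ (k - 1)
    have := hI (k - 1)
    rw [sub_add_cancel] at this
    have := hlt hJ (show J l < J k by omega)
    have := hmono hJ (show l ≤ k - 1 by omega)
    omega
  funext k
  induction k using Int.induction_on with
  | zero => exact le_antisymm (hzero hI hJ hI0 hJ1 hIJ) (hzero hJ hI hJ0 hI1 hJI)
  | succ k ih => exact le_antisymm (hsucc hJ hI hJI _ ih.symm) (hsucc hI hJ hIJ _ ih)
  | pred k ih => exact le_antisymm (hpred hI hJ hIJ _ ih) (hpred hJ hI hJI _ ih.symm)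

/-- If `h` does not decrease from one term of the sequence `I` to the next, and not below its value
at the left end in between, then all terms of the sequence are right minima of `h`. -/
theorem le_of_forall_block {h I : ℤ → ℤ} (hI : ∀ k, I k < I (k + 1))
    (hb : ∀ k l, I k ≤ l → l ≤ I (k + 1) → h (I k) ≤ h l) (k l : ℤ) (hl : I k ≤ l) :
    h (I k) ≤ h l := by
  obtain ⟨m, hm1, hm2⟩ := exists_mem_block hI l
  have hkm : k ≤ m := by
    by_contra hc
    have := sub_le_sub_of_lt_succ hI (show m + 1 ≤ k by omega)
    omega
  have key : ∀ m, k ≤ m → h (I k) ≤ h (I m) := by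
    intro m hm
    induction m, hm using Int.leInduction with
    | base => exact le_rfl
    | succ m _ ih => exact ih.trans (hb m _ (hI m).le le_rfl)
  exact (key m hkm).trans (hb m l hm1 hm2.le)

theorem le_of_forall_block' {h I : ℤ → ℤ} (hI : ∀ k, I k < I (k + 1))
    (hb : ∀ k l, I k ≤ l → l ≤ I (k + 1) → h (I (k + 1)) ≤ h l) (k l : ℤ) (hl : l ≤ I k) :
    h (I k) ≤ h l := by
  have := le_of_forall_block (h := fun i => h (-i)) (I := fun k => -I (-k))
    (fun k => by
      have := hI (-(k + 1))
      rw [show -(k + 1) + 1 = -k by ring] at this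
      omega)
    (fun k l h1 h2 => by
      have := hb (-(k + 1)) (-l) (by omega) (by
        rw [show -(k + 1) + 1 = -k by ring]
        omega)
      rw [show -(k + 1) + 1 = -k by ring] at this
      simpa using this) (-k) (-l) (by
        rw [neg_neg]
        omega)
  simpa using this

end IntegerSequences

/-- A Markov code is circular if the cutting points of parsings have a description in terms of the
parsed sequence only. -/
theorem MarkovCode.isCircular_of_cuts {A V : Type*} {C : MarkovCode A V} (D : (ℤ → A) → ℤ → Prop)
    (hcut : ∀ x I, C.IsParsing x I → ∀ k, D x (I k) ∧ ∀ m, I k < m → m < I (k + 1) → ¬ D x m) :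
    C.IsCircular := by
  intro x _ _ I J hI hJ
  have key : ∀ {I J : ℤ → ℤ}, C.IsParsing x I → C.IsParsing x J → ∀ k, ∃ l, J l = I k := by
    intro I J hI hJ k
    obtain ⟨l, hl1, hl2⟩ := exists_mem_block hJ.2.2.1 (I k)
    rcases hl1.eq_or_lt with h | h
    · exact ⟨l, h⟩
    · exact ((hcut x J hJ l).2 (I k) h hl2 (hcut x I hI k).1).elim
  exact eq_of_lt_succ_of_values hI.2.2.1 hJ.2.2.1 hI.1 hI.2.1 hJ.1 hJ.2.1 (key hI hJ) (key hJ hI)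

namespace LabelledGraph

open RGraph

variable {P Em Ep V E : Type*} {G : RGraph P Em Ep} {L : LabelledGraph G V E}

/-- The cutting points are the points at which the height is minimal. -/
theorem isCircular_code0 (hL : L.IsPresentation) : L.code0.IsCircular := by
  refine MarkovCode.isCircular_of_cuts
    (fun x m => ∀ l, heightAt L.ht x m ≤ heightAt L.ht x l) ?_
  rintro x I ⟨_, _, hI, hw, _⟩ k
  have hb : ∀ k, heightAt L.ht x (I (k + 1)) = heightAt L.ht x (I k) ∧
      ∀ l, I k < l → l < I (k + 1) → heightAt L.ht x (I k) < heightAt L.ht x l := by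
    intro k
    obtain ⟨-, -, -, h1, h2⟩ := (mem_words0_iff hL).1 (hw k)
    rw [wordHeight_zword _ _ (hI k).le] at h1
    refine ⟨by omega, fun l hl hl' => ?_⟩
    have := h2 (l - I k).toNat (by omega) (by rw [length_zword]; omega)
    rw [take_zword x _ (by omega), wordHeight_zword _ _ (by omega),
      show I k + ((l - I k).toNat : ℤ) = l by omega] at this
    omega
  have hb' : ∀ k l, I k ≤ l → l ≤ I (k + 1) → heightAt L.ht x (I k) ≤ heightAt L.ht x l := by
    intro k l h1 h2
    rcases h1.eq_or_lt with rfl | h1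
    · exact le_rfl
    rcases h2.eq_or_lt with rfl | h2
    · exact (hb k).1.ge
    · exact ((hb k).2 l h1 h2).le
  refine ⟨fun l => ?_, fun m h1 h2 h => ?_⟩
  · rcases le_or_gt (I k) l with h | h
    · exact le_of_forall_block hI hb' k l h
    · refine le_of_forall_block' hI (fun k l h1 h2 => ?_) k l h.le
      rw [(hb k).1]
      exact hb' k l h1 h2
  · have := (hb k).2 m h1 h2
    have := h (I k)
    omega

theorem exists_split_of_zword_eq_append {x : ℤ → E} {i j : ℤ} (hij : i ≤ j) {c d : List E}
    (h : c ++ d = zword x i j) : ∃ e, i ≤ e ∧ e ≤ j ∧ e = i + c.length ∧ zword x i e = c ∧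
      zword x e j = d := by
  have hlen := congrArg List.length h
  rw [List.length_append, length_zword] at hlen
  refine ⟨i + c.length, by omega, by omega, rfl, ?_, ?_⟩
  · rw [← take_zword x _ (j := j) (by omega), ← h, List.take_left]
  · rw [← drop_zword x _ (j := j) (by omega), ← h, List.drop_left]

theorem mem_of_zword_mem_wordsOver {x : ℤ → E} {i j l : ℤ} {Λ : Set E}
    (h : zword x i j ∈ wordsOver Λ) (h1 : i ≤ l) (h2 : l < j) : x l ∈ Λ := by
  refine h _ ?_
  have hl : (l - i).toNat < (zword x i j).length := by rw [length_zword]; omega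
  have := List.getElem_mem hl
  rwa [getElem_zword, show i + ((l - i).toNat : ℤ) = l by omega] at this

/-- The cutting points are the right minima `m` of the height for which `m + 1` is not a right
minimum. -/
theorem isCircular_codeNeg (hL : L.IsPresentation) : L.codeNeg.IsCircular := by
  refine MarkovCode.isCircular_of_cuts
    (fun x m => (∀ l, m ≤ l → heightAt L.ht x m ≤ heightAt L.ht x l) ∧
      ¬ ∀ l, m + 1 ≤ l → heightAt L.ht x (m + 1) ≤ heightAt L.ht x l) ?_
  rintro x I ⟨_, _, hI, hw, _⟩ k
  -- `e` is the end of the core of the code word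
  have hb : ∀ k, ∃ e, I k + 1 < e ∧ e ≤ I (k + 1) ∧ heightAt L.ht x (I k) ≤ heightAt L.ht x e ∧
      (∀ l, I k < l → l < e → heightAt L.ht x e < heightAt L.ht x l) ∧
      ∀ l l', e ≤ l → l ≤ l' → l' ≤ I (k + 1) → heightAt L.ht x l ≤ heightAt L.ht x l' := by
    intro k
    obtain ⟨-, c, hc, d, hd, hcd⟩ := (mem_wordsNeg_iff hL).1 (hw k)
    obtain ⟨e, he1, he2, he3, rfl, rfl⟩ := exists_split_of_zword_eq_append (hI k).le hcd
    obtain ⟨-, h1, -, h2, h3⟩ := (mem_coreNeg_iff hL).1 hc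
    rw [wordHeight_zword _ _ he1] at h2
    rw [length_zword] at h1
    refine ⟨e, by omega, he2, by omega, fun l hl hl' => ?_, fun l l' hl hll' hl' => ?_⟩
    · have := h3 (l - I k).toNat (by omega) (by rw [length_zword]; omega)
      rw [drop_zword x _ (by omega), wordHeight_zword _ _ (by omega),
        show I k + ((l - I k).toNat : ℤ) = l by omega] at this
      omega
    · induction l', hll' using Int.leInduction with
      | base => exact le_rfl
      | succ l' hll' ih =>
        have h0 : x l' ∈ {a | 0 ≤ L.ht a} := mem_of_zword_mem_wordsOver hd (by omega) (by omega)
        rw [Set.mem_ofPred_eq] at h0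
        have := ih (by omega)
        rw [heightAt_succ]
        omega
  have hmin := le_of_forall_block (h := heightAt L.ht x) hI fun k l h1 h2 => by
    obtain ⟨e, he1, he2, he3, he4, he5⟩ := hb k
    rcases h1.eq_or_lt with rfl | h1
    · exact le_rfl
    rcases lt_or_ge l e with hl | hl
    · exact he3.trans (he4 l h1 hl).le
    · exact he3.trans (he5 e l le_rfl hl h2)
  obtain ⟨e, he1, he2, he3, he4, he5⟩ := hb k
  refine ⟨⟨hmin k, fun h => ?_⟩, fun m h1 h2 h => ?_⟩
  · have := h e (by omega)
    have := he4 (I k + 1) (by omega) he1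
    omega
  · rcases lt_or_ge m e with hm | hm
    · have := he4 m h1 hm
      have := h.1 e hm.le
      omega
    · refine h.2 fun l hl => ?_
      rcases le_or_gt l (I (k + 1)) with hl' | hl'
      · exact he5 _ _ (by omega) hl hl'
      · exact (he5 _ _ (by omega) (by omega) le_rfl).trans (hmin (k + 1) l hl'.le)

/-- The cutting points are the left minima `m` of the height for which `m + 1` is not a left
minimum. -/
theorem isCircular_codePos (hL : L.IsPresentation) : L.codePos.IsCircular := by
  refine MarkovCode.isCircular_of_cuts
    (fun x m => (∀ l, l ≤ m → heightAt L.ht x m ≤ heightAt L.ht x l) ∧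
      ¬ ∀ l, l ≤ m + 1 → heightAt L.ht x (m + 1) ≤ heightAt L.ht x l) ?_
  rintro x I ⟨_, _, hI, hw, _⟩ k
  have hb : ∀ k, ∃ e, I k + 1 < e ∧ e ≤ I (k + 1) ∧ heightAt L.ht x e ≤ heightAt L.ht x (I k) ∧
      (∀ l, I k < l → l < e → heightAt L.ht x (I k) < heightAt L.ht x l) ∧
      ∀ l l', e ≤ l → l ≤ l' → l' ≤ I (k + 1) → heightAt L.ht x l' ≤ heightAt L.ht x l := by
    intro k
    obtain ⟨-, c, hc, d, hd, hcd⟩ := (mem_wordsPos_iff hL).1 (hw k)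
    obtain ⟨e, he1, he2, he3, rfl, rfl⟩ := exists_split_of_zword_eq_append (hI k).le hcd
    obtain ⟨-, h1, -, h2, h3⟩ := (mem_corePos_iff hL).1 hc
    rw [wordHeight_zword _ _ he1] at h2
    rw [length_zword] at h1
    refine ⟨e, by omega, he2, by omega, fun l hl hl' => ?_, fun l l' hl hll' hl' => ?_⟩
    · have := h3 (l - I k).toNat (by omega) (by rw [length_zword]; omega)
      rw [take_zword x _ (by omega), wordHeight_zword _ _ (by omega),
        show I k + ((l - I k).toNat : ℤ) = l by omega] at this
      omega
    · induction l', hll' using Int.leInduction with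
      | base => exact le_rfl
      | succ l' hll' ih =>
        have h0 : x l' ∈ {a | L.ht a ≤ 0} := mem_of_zword_mem_wordsOver hd (by omega) (by omega)
        rw [Set.mem_ofPred_eq] at h0
        have := ih (by omega)
        rw [heightAt_succ]
        omega
  have hblock : ∀ k l, I k ≤ l → l ≤ I (k + 1) →
      heightAt L.ht x (I (k + 1)) ≤ heightAt L.ht x l := by
    intro k l h1 h2
    obtain ⟨e, he1, he2, he3, he4, he5⟩ := hb k
    have he6 := he5 e _ le_rfl he2 le_rfl
    rcases h1.eq_or_lt with rfl | h1
    · exact he6.trans he3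
    rcases lt_or_ge l e with hl | hl
    · exact (he6.trans he3).trans (he4 l h1 hl).le
    · exact he5 l _ hl h2 le_rfl
  have hmin := le_of_forall_block' hI hblock
  obtain ⟨e, he1, he2, he3, he4, he5⟩ := hb k
  refine ⟨⟨hmin k, fun h => ?_⟩, fun m h1 h2 h => ?_⟩
  · have := h (I k) (by omega)
    have := he4 (I k + 1) (by omega) he1
    omega
  · rcases lt_or_ge m e with hm | hm
    · have := he4 m h1 hm
      have := h.1 (I k) h1.le
      omega
    · refine h.2 fun l hl => ?_
      have h6 := he5 e (m + 1) le_rfl (by omega) (by omega)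
      rcases lt_or_ge l e with hl' | hl'
      · rcases le_or_gt l (I k) with hl2 | hl2
        · exact (h6.trans he3).trans (hmin k l hl2)
        · exact (h6.trans he3).trans (he4 l hl2 hl').le
      · exact he5 l (m + 1) hl' hl (by omega)

end LabelledGraph

/-! ### The zeta function -/

section Endpoints

variable {V E : Type*} {s t : E → V}

theorem IsWalk.head_getLast {u v : V} {w : List E} (h : IsWalk s t u w v) (hw : w ≠ []) :
    s (w.head hw) = u ∧ t (w.getLast hw) = v := by
  induction w generalizing u with
  | nil => exact (hw rfl).elim
  | cons a w ih =>
    refine ⟨h.1, ?_⟩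
    rcases eq_or_ne w [] with rfl | hne
    · exact h.2
    · rw [List.getLast_cons hne]
      exact (ih h.2 hne).2

end Endpoints

namespace LabelledGraph

open RGraph PowerSeries

variable {P Em Ep V E : Type*} {G : RGraph P Em Ep} {L : LabelledGraph G V E}

theorem codeOf_H {T : Set (List E)} {hT : ∀ c ∈ T, c ≠ []}
    (hwalk : ∀ c ∈ T, ∃ U W, IsWalk L.src L.tgt U c W) :
    (L.codeOf T hT).H = walkMatrix L.src L.tgt T := by
  ext u v n
  change coeff n ((L.codeOf T hT).genFun u v) = coeff n (genSeries _)
  rw [MarkovCode.genFun, genSeries, coeff_mk, coeff_mk, ← Nat.card_coe_set_eq]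
  congr 1
  symm
  refine Nat.card_eq_of_bijective (fun w : {w : WalkIn L.src L.tgt T u v // w.1.length = n} =>
    ⟨⟨w.1.1, w.1.2.1⟩, (w.1.2.2.head_getLast (hT _ w.1.2.1)).1,
      (w.1.2.2.head_getLast (hT _ w.1.2.1)).2, w.2⟩) ⟨?_, ?_⟩
  · intro w w' h
    exact Subtype.ext (Subtype.ext (congrArg (fun c => c.1.1) h))
  · rintro ⟨⟨c, hc⟩, h1, h2, h3⟩
    obtain ⟨U, W, h⟩ := hwalk c hc
    obtain ⟨h4, h5⟩ := h.head_getLast (hT c hc)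
    have h6 : U = u := h4.symm.trans h1
    have h7 : W = v := h5.symm.trans h2
    subst h6 h7
    exact ⟨⟨⟨c, hc, h⟩, h3⟩, rfl⟩

theorem det_code0 [Fintype V] [DecidableEq V] (hL : L.IsPresentation) :
    (1 - L.code0.H).det =
      (1 - walkMatrix (negSystem hL).src (negSystem hL).tgt ((negSystem hL).steps {0})).det := by
  rw [code0, codeOf_H fun c hc => ((mem_words0_iff hL).1 hc).1]
  refine congrArg (fun M : Matrix V V ℚ⟦X⟧ => (1 - M).det) (walkMatrix_congr fun u v w hw => ?_)
  rw [mem_words0_iff hL]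
  have key : wordHeight L.ht w = 0 → ∀ J, (0 < wordHeight L.ht (w.take J) ↔
      wordHeight L.ht (w.drop J) < 0) := fun h J => by
    have := wordHeight_take_add_drop L.ht w J
    omega
  constructor
  · rintro ⟨-, h1, h2, h3, h4⟩
    exact ⟨h1, h2, h3, fun J hJ hJ' => (key h3 J).1 (h4 J hJ hJ')⟩
  · rintro ⟨h1, h2, h3, h4⟩
    exact ⟨⟨u, v, hw⟩, h1, h2, h3, fun J hJ hJ' => (key h3 J).2 (h4 J hJ hJ')⟩

theorem det_codeNeg [Fintype V] [DecidableEq V] [Finite E] (hL : L.IsPresentation) :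
    detOneSub L.Aneg * (1 - L.codeNeg.H).det =
      (1 - walkMatrix (negSystem hL).src (negSystem hL).tgt
        ((negSystem hL).steps (Set.Ici 0))).det := by
  have h1 : detOneSub L.Aneg = (1 - walkMatrix L.src L.tgt (letterWords {a | 0 ≤ L.ht a})).det := by
    have h := detOneSub_edgeMatrix (s := L.src) (t := L.tgt) (fun a : L.NegState => a.1)
      Subtype.val_injective
    have hr : Set.range (fun a : L.NegState => a.1) = {a | 0 ≤ L.ht a} := by
      ext a
      rw [Set.mem_ofPred_eq, ← lab_mem_Sneg_union_ones_iff hL]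
      exact ⟨fun ⟨b, hb⟩ => hb ▸ b.2, fun h => ⟨⟨a, h⟩, rfl⟩⟩
    rw [hr] at h
    exact h
  rw [h1, codeNeg, codeOf_H fun c hc => ((mem_wordsNeg_iff hL).1 hc).1,
    ← det_one_sub_walkMatrix_union (K := L.coreNeg) (C := L.wordsNeg)]
  · refine congrArg (fun M : Matrix V V ℚ⟦X⟧ => (1 - M).det) (walkMatrix_congr fun u v w hw => ?_)
    rw [Set.mem_union, mem_coreNeg_iff hL]
    constructor
    · rintro (⟨a, ha, rfl⟩ | ⟨-, h1, h2, h3, h4⟩)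
      · refine ⟨List.cons_ne_nil _ _, singleton_mem_nonzeroWords hL a, ?_, fun J hJ hJ' => ?_⟩
        · change 0 ≤ wordHeight L.ht [a]
          simpa using ha
        · simp at hJ'
          omega
      · exact ⟨List.ne_nil_of_length_pos (by omega), h2, h3, h4⟩
    · rintro ⟨h1, h2, h3, h4⟩
      rcases Nat.lt_or_ge 1 w.length with hlen | hlen
      · exact Or.inr ⟨⟨u, v, hw⟩, hlen, h2, h3, h4⟩
      · obtain ⟨a, rfl⟩ := List.length_eq_one_iff.1
          (le_antisymm hlen (List.length_pos_iff.2 h1))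
        refine Or.inl ⟨a, ?_, rfl⟩
        have h3 : 0 ≤ wordHeight L.ht [a] := h3
        simpa using h3
  · exact fun w hw => hw.2.1
  · intro u v w a b hwa hwb ha hb
    exact (mem_wordsNeg_iff hL).2 ⟨⟨u, w, isWalk_append.2 ⟨v, hwa, hwb⟩⟩, a, ha, b, hb, rfl⟩
  · exact fun u v c _ hc => ((mem_wordsNeg_iff hL).1 hc).2
  · have key : ∀ a ∈ L.coreNeg, ∀ b ∈ wordsOver {a | 0 ≤ L.ht a}, ∀ a' ∈ L.coreNeg, ∀ b',
        a ++ b = a' ++ b' → a'.length ≤ a.length := by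
      intro a ha b hb a' ha' b' h
      by_contra hlt
      have h1 := ((mem_coreNeg_iff hL).1 ha').2.2.2.2 a.length
        (by have := ha.2.1; omega) (by omega)
      have h2 : a'.drop a.length = b.take (a'.length - a.length) := by
        have h3 := congrArg (fun l => (l.take a'.length).drop a.length) h
        rw [List.take_left, List.take_append, List.take_of_length_le (by omega),
          List.drop_left] at h3
        exact h3.symm
      rw [h2] at h1
      have h4 : ∀ l : List E, (∀ c ∈ l, 0 ≤ L.ht c) → 0 ≤ wordHeight L.ht l := by
        intro l hl
        refine List.sum_nonneg fun z hz => ?_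
        obtain ⟨c, hc, rfl⟩ := List.mem_map.1 hz
        exact hl c hc
      have := h4 (b.take (a'.length - a.length)) fun c hc => hb c (List.mem_of_mem_take hc)
      omega
    intro a ha b hb a' ha' b' hb' h
    exact (List.append_inj h (le_antisymm (key a' ha' b' hb' a ha b h.symm)
      (key a ha b hb a' ha' b' h))).1

theorem det_codePos [Fintype V] [DecidableEq V] [Finite E] (hL : L.IsPresentation) :
    detOneSub L.Apos * (1 - L.codePos.H).det =
      (1 - walkMatrix (posSystem hL).src (posSystem hL).tgt
        ((posSystem hL).steps (Set.Ici 0))).det := by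
  have h1 : detOneSub L.Apos = (1 - walkMatrix L.src L.tgt (letterWords {a | L.ht a ≤ 0})).det := by
    have h := detOneSub_edgeMatrix (s := L.src) (t := L.tgt) (fun a : L.PosState => a.1)
      Subtype.val_injective
    have hr : Set.range (fun a : L.PosState => a.1) = {a | L.ht a ≤ 0} := by
      ext a
      rw [Set.mem_ofPred_eq, ← lab_mem_ones_union_Spos_iff hL]
      exact ⟨fun ⟨b, hb⟩ => hb ▸ b.2, fun h => ⟨⟨a, h⟩, rfl⟩⟩
    rw [hr] at h
    exact h
  rw [h1, codePos, codeOf_H fun c hc => ((mem_wordsPos_iff hL).1 hc).1,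
    ← det_one_sub_walkMatrix_union (K := L.corePos) (C := L.wordsPos)]
  · refine Eq.trans ?_ (det_one_sub_walkMatrix_reverse (s := L.src) (t := L.tgt) _).symm
    refine congrArg (fun M : Matrix V V ℚ⟦X⟧ => (1 - M).det) (walkMatrix_congr fun u v w hw => ?_)
    have hst : w.reverse ∈ (posSystem hL).steps (Set.Ici 0) ↔ w ≠ [] ∧ w ∈ L.nonzeroWords ∧
        wordHeight L.ht w ≤ 0 ∧ ∀ J, 1 ≤ J → J < w.length → 0 < wordHeight L.ht (w.take J) := by
      have e : w.reverse ∈ (posSystem hL).steps (Set.Ici 0) ↔ w.reverse ≠ [] ∧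
        w.reverse.reverse ∈ L.nonzeroWords ∧
        0 ≤ wordHeight (fun a => -L.ht a) w.reverse ∧
        ∀ J, 1 ≤ J → J < w.reverse.length →
          wordHeight (fun a => -L.ht a) (w.reverse.drop J) < 0 := Iff.rfl
      rw [e, List.reverse_reverse, List.reverse_ne_nil_iff, wordHeight_reverse, wordHeight_neg,
        List.length_reverse]
      simp only [List.drop_reverse, wordHeight_reverse, wordHeight_neg]
      refine and_congr_right fun _ => and_congr_right fun _ => and_congr (by omega)
        ⟨fun h J hJ hJ' => ?_, fun h J hJ hJ' => ?_⟩
      · have := h (w.length - J) (by omega) (by omega)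
        rw [Nat.sub_sub_self hJ'.le] at this
        omega
      · have := h (w.length - J) (by omega) (by omega)
        omega
    rw [Set.mem_union, mem_corePos_iff hL, Set.mem_ofPred_eq]
    refine Iff.trans ?_ hst.symm
    constructor
    · rintro (⟨a, ha, rfl⟩ | ⟨-, h1, h2, h3, h4⟩)
      · refine ⟨List.cons_ne_nil _ _, singleton_mem_nonzeroWords hL a, ?_, fun J hJ hJ' => ?_⟩
        · simpa using ha
        · simp at hJ'
          omega
      · exact ⟨List.ne_nil_of_length_pos (by omega), h2, h3, h4⟩
    · rintro ⟨h1, h2, h3, h4⟩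
      rcases Nat.lt_or_ge 1 w.length with hlen | hlen
      · exact Or.inr ⟨⟨u, v, hw⟩, hlen, h2, h3, h4⟩
      · obtain ⟨a, rfl⟩ := List.length_eq_one_iff.1
          (le_antisymm hlen (List.length_pos_iff.2 h1))
        refine Or.inl ⟨a, ?_, rfl⟩
        simpa using h3
  · exact fun w hw => hw.2.1
  · intro u v w a b hwa hwb ha hb
    exact (mem_wordsPos_iff hL).2 ⟨⟨u, w, isWalk_append.2 ⟨v, hwa, hwb⟩⟩, a, ha, b, hb, rfl⟩
  · exact fun u v c _ hc => ((mem_wordsPos_iff hL).1 hc).2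
  · have key : ∀ a ∈ L.corePos, ∀ b, ∀ a' ∈ L.corePos, ∀ b',
        a ++ b = a' ++ b' → a'.length ≤ a.length := by
      intro a ha b a' ha' b' h
      by_contra hlt
      have h1 := ((mem_corePos_iff hL).1 ha').2.2.2.2 a.length
        (by have := ha.2.1; omega) (by omega)
      have h2 : a'.take a.length = a := by
        have h3 := congrArg (fun l => l.take a.length) h
        rw [List.take_left, List.take_append_of_le_length (by omega)] at h3
        exact h3.symm
      rw [h2] at h1
      have := ((mem_corePos_iff hL).1 ha).2.2.2.1
      omega
    intro a ha b _ a' ha' b' _ h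
    exact (List.append_inj h (le_antisymm (key a' ha' b' a ha b h.symm)
      (key a ha b a' ha' b' h))).1

theorem mem_shift_iff {x : ℤ → E} :
    x ∈ L.shift ↔ (∀ i, L.tgt (x i) = L.src (x (i + 1))) ∧ ∀ i j, zword x i j ∈ L.nonzeroWords := by
  constructor
  · intro h
    refine ⟨fun i => ?_, fun i j => ?_⟩
    · obtain ⟨-, ⟨U, W, hw⟩, -⟩ := admissible_iff.1 (h i (i + 1 + 1) (by omega))
      rw [zword_eq_cons x (by omega), zword_succ] at hw
      exact hw.2.1.symm
    · rcases lt_or_ge i j with hij | hij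
      · exact (admissible_iff.1 (h i j hij)).2.2
      · rw [zword_of_le x hij]
        exact L.nil_mem_nonzeroWords
  · rintro ⟨h1, h2⟩ i j hij
    exact admissible_iff.2 ⟨zword_ne_nil x hij, ⟨_, _, isWalk_zword h1 hij.le⟩, h2 i j⟩

theorem finite_setOf_periodic [Finite E] {n : ℕ} (hn : 0 < n) :
    {x : ℤ → E | ∀ i : ℤ, x (i + n) = x i}.Finite := by
  refine Set.Finite.of_finite_image (f := fun x => zword x 0 (0 + n)) ?_ ?_
  · refine (List.finite_length_eq E n).subset ?_
    rintro _ ⟨x, -, rfl⟩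
    change (zword x 0 (0 + n)).length = n
    rw [length_zword]
    omega
  · intro x hx y hy h
    exact eq_of_zword_eq_of_periodic (n := (n : ℤ)) (by omega) hx hy h

theorem card_periodicWalks_posSystem (hL : L.IsPresentation) (n : ℕ) :
    Nat.card ((posSystem hL).periodicWalks (Set.Ici 0) n) =
      {x : ℤ → E | (x ∈ L.shift ∧ ∀ i : ℤ, x (i + n) = x i) ∧
        wordHeight L.ht (zword x 0 n) ≤ 0}.ncard := by
  have key : ∀ x y : ℤ → E, (∀ i, y i = x (-i)) →
      ((x ∈ L.shift ∧ ∀ i : ℤ, x (i + n) = x i) ∧ wordHeight L.ht (zword x 0 n) ≤ 0) →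
      y ∈ (posSystem hL).periodicWalks (Set.Ici 0) n := by
    rintro x y hy ⟨⟨hx1, hx2⟩, hx3⟩
    obtain ⟨hx4, hx5⟩ := mem_shift_iff.1 hx1
    refine ⟨fun i => ?_, fun i j => ?_, fun i => ?_, ?_⟩
    · change L.src (y i) = L.tgt (y (i + 1))
      rw [hy, hy, hx4]
      congr 2
      ring
    · change (zword y i j).reverse ∈ L.nonzeroWords
      rw [zword_reverse hy]
      exact hx5 _ _
    · rw [hy, hy, ← hx2 (-(i + n))]
      congr 1
      ring
    · change 0 ≤ wordHeight (fun a => -L.ht a) (zword y 0 n)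
      rw [wordHeight_neg, ← wordHeight_reverse, zword_reverse hy, wordHeight_zword _ _ (by omega)]
      have h1 := heightAt_add_period L.ht (n := (n : ℤ)) (by omega) hx2 (1 - n)
      rw [sub_add_cancel] at h1
      rw [sub_zero]
      omega
  have key' : ∀ x y : ℤ → E, (∀ i, y i = x (-i)) →
      y ∈ (posSystem hL).periodicWalks (Set.Ici 0) n →
      (x ∈ L.shift ∧ ∀ i : ℤ, x (i + n) = x i) ∧ wordHeight L.ht (zword x 0 n) ≤ 0 := by
    rintro x y hy ⟨h1, h2, h3, h4⟩
    have h2 : ∀ i j, (zword y i j).reverse ∈ L.nonzeroWords := h2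
    have h1 : ∀ i, L.src (y i) = L.tgt (y (i + 1)) := h1
    have h4 : 0 ≤ wordHeight (fun a => -L.ht a) (zword y 0 n) := h4
    have hper : ∀ i : ℤ, x (i + n) = x i := fun i => by
      have := h3 (-(i + n))
      rw [hy, hy] at this
      rw [← neg_neg (i + (n : ℤ)), ← this]
      congr 1
      ring
    refine ⟨⟨mem_shift_iff.2 ⟨fun i => ?_, fun i j => ?_⟩, hper⟩, ?_⟩
    · have := h1 (-(i + 1))
      rw [hy, hy] at this
      rw [show -(-(i + 1) + 1) = i by ring, show -(-(i + 1)) = i + 1 by ring] at this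
      exact this.symm
    · have := h2 (1 - j) (1 - i)
      rw [zword_reverse hy] at this
      simpa using this
    · rw [wordHeight_neg, ← wordHeight_reverse, zword_reverse hy,
        wordHeight_zword _ _ (by omega)] at h4
      have h1 := heightAt_add_period L.ht (n := (n : ℤ)) (by omega) hper (1 - n)
      rw [sub_add_cancel] at h1
      rw [sub_zero] at h4
      omega
  rw [← Nat.card_coe_set_eq]
  refine (Nat.card_congr (Equiv.subtypeEquiv ((Equiv.neg ℤ).arrowCongr (Equiv.refl E))
    fun x => ⟨key x _ fun i => rfl, key' x _ fun i => rfl⟩)).symm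

/-- A periodic point has non-negative or non-positive height along its period, or both. -/
theorem periodCount_add [Finite E] (hL : L.IsPresentation) {n : ℕ} (hn : 0 < n) :
    periodCount L.shift n + Nat.card ((negSystem hL).periodicWalks {0} n) =
      Nat.card ((negSystem hL).periodicWalks (Set.Ici 0) n) +
        Nat.card ((posSystem hL).periodicWalks (Set.Ici 0) n) := by
  have hneg : ∀ Z : Set ℤ, (negSystem hL).periodicWalks Z n =
      {x : ℤ → E | (x ∈ L.shift ∧ ∀ i : ℤ, x (i + n) = x i) ∧
        wordHeight L.ht (zword x 0 n) ∈ Z} := by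
    intro Z
    ext x
    rw [Set.mem_ofPred_eq, mem_shift_iff]
    exact ⟨fun ⟨h1, h2, h3, h4⟩ => ⟨⟨⟨h1, h2⟩, h3⟩, h4⟩,
      fun ⟨⟨⟨h1, h2⟩, h3⟩, h4⟩ => ⟨h1, h2, h3, h4⟩⟩
  rw [card_periodicWalks_posSystem, hneg, hneg, Nat.card_coe_set_eq, Nat.card_coe_set_eq]
  have hfin : ∀ p : (ℤ → E) → Prop,
      {x : ℤ → E | (x ∈ L.shift ∧ ∀ i : ℤ, x (i + n) = x i) ∧ p x}.Finite :=
    fun p => (finite_setOf_periodic hn).subset fun x hx => hx.1.2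
  rw [← Set.ncard_union_add_ncard_inter _ _ (hfin _) (hfin _), periodCount]
  congr 2
  · ext x
    simp only [Set.mem_union, Set.mem_ofPred_eq, Set.mem_Ici]
    have := le_total 0 (wordHeight L.ht (zword x 0 n))
    tauto
  · ext x
    simp only [Set.mem_inter_iff, Set.mem_ofPred_eq, Set.mem_Ici, Set.mem_singleton_iff,
      le_antisymm_iff (b := (0 : ℤ))]
    tauto

end LabelledGraph

theorem theorem9p1 {P Em Ep V E : Type*} [Finite P] [Finite Em] [Finite Ep]
    [Fintype V] [DecidableEq V] [Finite E]
    (G : RGraph P Em Ep) (L : LabelledGraph G V E) (hL : L.IsPresentation) :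
    (L.code0.IsCircular ∧ L.codeNeg.IsCircular ∧ L.codePos.IsCircular) ∧
    IsUnit (detOneSub L.Aneg * (1 - L.codeNeg.H).det *
      (1 - L.codePos.H).det * detOneSub L.Apos) ∧
    zetaSeries L.shift =
      (1 - L.code0.H).det *
        (detOneSub L.Aneg * (1 - L.codeNeg.H).det *
          (1 - L.codePos.H).det * detOneSub L.Apos)⁻¹ := by
  refine ⟨⟨LabelledGraph.isCircular_code0 hL, LabelledGraph.isCircular_codeNeg hL,
    LabelledGraph.isCircular_codePos hL⟩, ?_⟩
  have hconst : ∀ (S : HeightSystem V E) (Z : Set ℤ),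
      PowerSeries.constantCoeff (1 - walkMatrix S.src S.tgt (S.steps Z)).det = 1 := fun S Z =>
    constantCoeff_det_one_sub (constantCoeff_walkMatrix fun w hw => hw.1)
  have h0 := HeightSystem.derivative_det_walkMatrix_steps (S := LabelledGraph.negSystem hL)
    isNonnegFace_singleton_zero
  have hn := HeightSystem.derivative_det_walkMatrix_steps (S := LabelledGraph.negSystem hL)
    isNonnegFace_Ici
  have hp := HeightSystem.derivative_det_walkMatrix_steps (S := LabelledGraph.posSystem hL)
    isNonnegFace_Ici
  have hc0 := hconst (LabelledGraph.negSystem hL) {0}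
  have hcn := hconst (LabelledGraph.negSystem hL) (Set.Ici 0)
  have hcp := hconst (LabelledGraph.posSystem hL) (Set.Ici 0)
  rw [← LabelledGraph.det_code0 hL] at h0 hc0
  rw [← LabelledGraph.det_codeNeg hL] at hn hcn
  rw [← LabelledGraph.det_codePos hL] at hp hcp
  have hD : detOneSub L.Aneg * (1 - L.codeNeg.H).det * (1 - L.codePos.H).det *
      detOneSub L.Apos = (detOneSub L.Aneg * (1 - L.codeNeg.H).det) *
        (detOneSub L.Apos * (1 - L.codePos.H).det) := by ring
  rw [hD]
  generalize detOneSub L.Aneg * (1 - L.codeNeg.H).det = dn at hn hcn ⊢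
  generalize detOneSub L.Apos * (1 - L.codePos.H).det = dp at hp hcp ⊢
  generalize (1 - L.code0.H).det = d0 at h0 hc0 ⊢
  have hcD : PowerSeries.constantCoeff (dn * dp) = 1 := by rw [map_mul, hcn, hcp, one_mul]
  refine ⟨?_, ?_⟩
  · rw [PowerSeries.isUnit_iff_constantCoeff, hcD]
    exact isUnit_one
  rw [PowerSeries.eq_mul_inv_iff_mul_eq (by rw [hcD]; exact one_ne_zero)]
  have hsum : (PowerSeries.mk fun n => (periodCount L.shift (n + 1) : ℚ)) +
      (PowerSeries.mk fun n =>
        (Nat.card ((LabelledGraph.negSystem hL).periodicWalks {0} (n + 1)) : ℚ)) =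
      (PowerSeries.mk fun n =>
        (Nat.card ((LabelledGraph.negSystem hL).periodicWalks (Set.Ici 0) (n + 1)) : ℚ)) +
      (PowerSeries.mk fun n =>
        (Nat.card ((LabelledGraph.posSystem hL).periodicWalks (Set.Ici 0) (n + 1)) : ℚ)) := by
    ext n
    rw [map_add, map_add, PowerSeries.coeff_mk, PowerSeries.coeff_mk, PowerSeries.coeff_mk, PowerSeries.coeff_mk]
    exact_mod_cast LabelledGraph.periodCount_add hL (Nat.succ_pos n)
  have hz := derivative_zetaSeries L.shift
  refine PowerSeries.eq_of_derivative_eq_mul (c := -(PowerSeries.mk fun n =>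
    (Nat.card ((LabelledGraph.negSystem hL).periodicWalks {0} (n + 1)) : ℚ))) ?_ ?_ ?_ hc0
  · rw [Derivation.leibniz, Derivation.leibniz, hz, hn, hp]
    simp only [smul_eq_mul]
    linear_combination (zetaSeries L.shift * dn * dp) * hsum
  · rw [h0]
    ring
  · rw [map_mul, hcD, constantCoeff_zetaSeries, one_mul]
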